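/- For nonzero integers $a_1,a_2$ let $\boldsymbol u$ be the Lucas sequence $u_0=0$, $u_1=1$, $u_n=a_1u_{n-1}+a_2u_{n-2}$, let $D=a_1^2+4a_2$, $K=\mathbb Q(\sqrt D)$, let $\alpha=(a_1+\sqrt D)/2$, $\beta=(a_1-\sqrt D)/2$ be the roots of $X^2-a_1X-a_2$, and put $\gamma=\alpha/\beta$. For $n\ge 1$ let $\zeta_n=e^{2\pi i/n}$, fix an $n$th root $\gamma^{1/n}$ of $\gamma$, and let $K_n=K(\zeta_n,\gamma^{1/n})$. Let $C_n\subseteq\mathrm{Gal}(K_n/\mathbb Q)$ consist of the identity and of the automorphism $\sigma$ with $\sigma(\zeta_n)=\zeta_n^{-1}$ and $\sigma(\gamma^{1/n})=\gamma^{-1/n}$, if it exists. For $t\ge1$ put $$\delta_{\boldsymbol u}(t)=\sum_{n\ge1}\frac{\mu(n)\,\#C_{nt}}{[K_{nt}:\mathbb Q]}.$$ Let $A=\prod_p\bigl(1-\frac1{p(p-1)}\bigr)$ be the Artin constant and, writing $(a,b)$ for the greatest common divisor and $p$ for primes, for positive integers $h,m,n,t$ let $$F_h(t)=\frac{(t,h)}{\varphi(t)t}\prod_{\substack{p>2\\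 p\mid t}}\Bigl(1-\frac{(pt,h)}{p^2(t,h)}\Bigr)\Bigl(1-\frac{(p,h)}{p(p-1)}\Bigr)^{-1},\qquad B_h=2\prod_{\substack{p>2\\ p\mid h}}\Bigl(1-\frac{p-1}{p^2-p-1}\Bigr),$$ $$f_h(t,n)=\frac{(nt,h)\varphi(t)}{(t,h)\varphi(nt)n},\qquad G_{h,m}(t)=\widetilde G_{h,m/(m,t)}(t),$$ where $\widetilde G_{h,m}(t)=|\mu(m)|\prod_{p>2,\,p\mid m}\bigl(1-\tfrac1{f_h(t,p)}\bigr)^{-1}$ times $1-f_h(t,2)$ if $m$ is odd, and times $-f_h(t,2)$ if $m$ is even. Write $\gamma=s\gamma_0^h$ with $s\in\{-1,1\}$, $h$ a positive integer, and $\gamma_0\in K$ such that neither $\gamma_0$ nor $-\gamma_0$ is a perfect power in $K$ (that is, of the form $\delta^k$ with $\delta\in K$ and $k\ge2$). If $c_1,\dots,c_k\in\mathbb Q$ and positive integers $m_1,\dots,m_k$ satisfy $$\frac{\#C_n}{[K_n:\mathbb Q]}=\frac{(n,2h)}{\varphi(n)n}\sum_{1\le i\le k,\ m_i\mid n}c_i\qquad\text{for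 all } n\ge1,$$ put $G_{\boldsymbol u}(t)=B_{2h}\sum_{i=1}^kc_iG_{2h,m_i}(t)$ for $t\geq 1$. In each of the following three cases such $h$, $c_i$, $m_i$ exist, $h$ and the function $G_{\boldsymbol u}$ do not depend on their choice, the series $\delta_{\boldsymbol u}(t)$ converges absolutely and $\delta_{\boldsymbol u}(t)=A\,F_{2h}(t)\,G_{\boldsymbol u}(t)$ for every positive integer $t$, and $h$ and $G_{\boldsymbol u}(t)$ are as follows. 1. $(a_1,a_2)=(1,1)$ (Fibonacci numbers): $h=2$, and $G_{\boldsymbol u}(t)$ equals $3/4$ if $t\equiv0\pmod{20}$; $1$ if $t\equiv1\pmod2$; $29/38$ if $t\equiv2,6,14,18\pmod{20}$; $27/76$ if $t\equiv4,8,12,16\pmod{20}$; $1/2$ if $t\equiv10\pmod{20}$. 2. $(a_1,a_2)=(4,-1)$: $h=2$, and $G_{\boldsymbol u}(t)$ equals $3/2$ if $t\equiv0,2,6,10,14,18,22\pmod{24}$; $0$ if $t\equiv1\pmod2$; $4/5$ if $t\equiv4,20\pmod{24}$; $3/5$ if $t\equiv8,16\pmod{24}$; $1/2$ if $t\equiv12\pmod{24}$.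 3. $(a_1,a_2)=(10,2)$: $h=3$, and $G_{\boldsymbol u}(t)$ equals $9/10$ if $t\equiv0\pmod{24}$; $3/5$ if $t\equiv1,3,4,5,7,9,11,13,15,17,19,20,21,23\pmod{24}$; $9/20$ if $t\equiv2,6,10,14,18,22\pmod{24}$; $0$ if $t\equiv8,16\pmod{24}$; $3/10$ if $t\equiv12\pmod{24}$. -/

import Mathlib

/-! Lucas sequences `u 0 = 0`, `u 1 = 1`, `u n = a₁ * u (n - 1) + a₂ * u (n - 2)` enter through
their pair of coefficients `(a₁, a₂)`. All number fields are subfields of `ℂ`. -/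

namespace Lucas

noncomputable section

/-- The discriminant `D = a₁² + 4 a₂` of the characteristic polynomial `X² - a₁ X - a₂`. -/
def disc (a₁ a₂ : ℤ) : ℤ := a₁ ^ 2 + 4 * a₂

/-- A fixed complex square root of `D`. -/
def sqrtDisc (a₁ a₂ : ℤ) : ℂ := (disc a₁ a₂ : ℂ) ^ ((2 : ℂ)⁻¹)

/-- `alpha` and `beta` are the two roots `α`, `β` of `X² - a₁ X - a₂`. -/
def alpha (a₁ a₂ : ℤ) : ℂ := ((a₁ : ℂ) + sqrtDisc a₁ a₂) / 2

/-- See `alpha`. -/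
def beta (a₁ a₂ : ℤ) : ℂ := ((a₁ : ℂ) - sqrtDisc a₁ a₂) / 2

/-- `γ = α / β`. -/
def gamma (a₁ a₂ : ℤ) : ℂ := alpha a₁ a₂ / beta a₁ a₂

/-- `K = ℚ(√D)`. -/
def fieldK (a₁ a₂ : ℤ) : IntermediateField ℚ ℂ :=
  IntermediateField.adjoin ℚ {sqrtDisc a₁ a₂}

/-- `ζ_n = exp(2πi / n)`. -/
def zeta (n : ℕ) : ℂ := Complex.exp (2 * Real.pi * Complex.I / n)

/-- A fixed `n`-th root of `γ`. -/
def gammaRoot (a₁ a₂ : ℤ) (n : ℕ) : ℂ := gamma a₁ a₂ ^ ((n : ℂ)⁻¹)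

/-- `K_n = K(ζ_n, γ^(1/n))`, as an extension of `ℚ`. -/
def fieldKn (a₁ a₂ : ℤ) (n : ℕ) : IntermediateField ℚ ℂ :=
  IntermediateField.adjoin ℚ {sqrtDisc a₁ a₂, zeta n, gammaRoot a₁ a₂ n}

/-- `ζ_n` as an element of `K_n`. -/
def zetaK (a₁ a₂ : ℤ) (n : ℕ) : fieldKn a₁ a₂ n :=
  ⟨zeta n, IntermediateField.subset_adjoin ℚ _ (by simp)⟩

/-- `γ^(1/n)` as an element of `K_n`. -/
def gammaRootK (a₁ a₂ : ℤ) (n : ℕ) : fieldKn a₁ a₂ n :=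
  ⟨gammaRoot a₁ a₂ n, IntermediateField.subset_adjoin ℚ _ (by simp)⟩

/-- `C_n`: the subset of `Gal(K_n / ℚ)` consisting of the identity and of the automorphism `σ`
with `σ(ζ_n) = ζ_n⁻¹` and `σ(γ^(1/n)) = γ^(-1/n)`, if it exists. -/
def setC (a₁ a₂ : ℤ) (n : ℕ) : Set (fieldKn a₁ a₂ n ≃ₐ[ℚ] fieldKn a₁ a₂ n) :=
  {σ | σ = AlgEquiv.refl ∨
    (σ (zetaK a₁ a₂ n) = (zetaK a₁ a₂ n)⁻¹ ∧ σ (gammaRootK a₁ a₂ n) = (gammaRootK a₁ a₂ n)⁻¹)}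

/-- `#C_n / [K_n : ℚ]`. -/
def density (a₁ a₂ : ℤ) (n : ℕ) : ℚ :=
  ((setC a₁ a₂ n).ncard : ℚ) / (Module.finrank ℚ (fieldKn a₁ a₂ n) : ℚ)

/-- The term `μ(n) #C_{nt} / [K_{nt} : ℚ]` (which is `0` for `n = 0`). -/
def deltaTerm (a₁ a₂ : ℤ) (t n : ℕ) : ℝ :=
  (ArithmeticFunction.moebius n : ℝ) * (density a₁ a₂ (n * t) : ℝ)

/-- `δ_u(t) = ∑_{n ≥ 1} μ(n) #C_{nt} / [K_{nt} : ℚ]`. -/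
def delta (a₁ a₂ : ℤ) (t : ℕ) : ℝ := ∑' n : ℕ, deltaTerm a₁ a₂ t n

/-- The Artin constant `A = ∏_p (1 - 1 / (p (p - 1)))`. -/
def artinConstant : ℝ := ∏' p : Nat.Primes, (1 - 1 / (((p : ℕ) : ℝ) * (((p : ℕ) : ℝ) - 1)))

/-- The odd prime divisors of `n`. -/
def oddPrimeFactors (n : ℕ) : Finset ℕ := n.primeFactors.filter (fun p => 2 < p)

/-- `F_h(t) = (t,h) / (φ(t) t) ∏_{p > 2, p ∣ t}
(1 - (pt,h) / (p² (t,h))) (1 - (p,h) / (p (p - 1)))⁻¹`. -/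
def F (h t : ℕ) : ℚ :=
  (Nat.gcd t h : ℚ) / ((Nat.totient t : ℚ) * (t : ℚ)) *
    ∏ p ∈ oddPrimeFactors t,
      ((1 - (Nat.gcd (p * t) h : ℚ) / ((p : ℚ) ^ 2 * (Nat.gcd t h : ℚ))) *
        (1 - (Nat.gcd p h : ℚ) / ((p : ℚ) * ((p : ℚ) - 1)))⁻¹)

/-- `B_h = 2 ∏_{p > 2, p ∣ h} (1 - (p - 1) / (p² - p - 1))`. -/
def B (h : ℕ) : ℚ :=
  2 * ∏ p ∈ oddPrimeFactors h, (1 - ((p : ℚ) - 1) / ((p : ℚ) ^ 2 - (p : ℚ) - 1))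

/-- `f_h(t,n) = (nt,h) φ(t) / ((t,h) φ(nt) n)`. -/
def f (h t n : ℕ) : ℚ :=
  ((Nat.gcd (n * t) h : ℚ) * (Nat.totient t : ℚ)) /
    ((Nat.gcd t h : ℚ) * (Nat.totient (n * t) : ℚ) * (n : ℚ))

/-- `G̃_{h,m}(t) = |μ(m)| ∏_{p > 2, p ∣ m} (1 - 1 / f_h(t,p))⁻¹` times `1 - f_h(t,2)` if `m` is
odd, and times `-f_h(t,2)` if `m` is even. -/
def Gtilde (h m t : ℕ) : ℚ :=
  |(ArithmeticFunction.moebius m : ℚ)| * (∏ p ∈ oddPrimeFactors m, (1 - 1 / f h t p)⁻¹) *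
    (if 2 ∣ m then - f h t 2 else 1 - f h t 2)

/-- `G_{h,m}(t) = G̃_{h,m/(m,t)}(t)`. -/
def Ghm (h m t : ℕ) : ℚ := Gtilde h (m / Nat.gcd m t) t

/-- `γ = s γ₀ ^ h` where `s = ±1`, `h` is a positive integer and `γ₀ ∈ K` is, up to sign, not a
perfect power in `K`. -/
def IsExponent (a₁ a₂ : ℤ) (h : ℕ) : Prop :=
  0 < h ∧ ∃ s : ℤ, (s = 1 ∨ s = -1) ∧ ∃ γ₀ ∈ fieldK a₁ a₂,
    gamma a₁ a₂ = (s : ℂ) * γ₀ ^ h ∧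
    ∀ δ ∈ fieldK a₁ a₂, ∀ k : ℕ, 2 ≤ k → δ ^ k ≠ γ₀ ∧ δ ^ k ≠ -γ₀

/-- `h` is the exponent attached to `u`, and `G` is the function `G_u` on the positive integers:
there are rational numbers `c_i` and positive integers `m_i` such that
`#C_n / [K_n : ℚ] = (n, 2h) / (φ(n) n) ∑_i c_i χ_{m_i}(n)` for every positive integer `n`,
where `χ_m` is the characteristic function of the multiples of `m`, and
`G(t) = B_{2h} ∑_i c_i G_{2h,m_i}(t)` for every positive integer `t`. -/
def IsGu (a₁ a₂ : ℤ) (h : ℕ) (G : ℕ → ℚ) : Prop :=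
  IsExponent a₁ a₂ h ∧
  ∃ (k : ℕ) (c : Fin k → ℚ) (m : Fin k → ℕ),
    (∀ i, 0 < m i) ∧
    (∀ n : ℕ, 0 < n →
      density a₁ a₂ n =
        (Nat.gcd n (2 * h) : ℚ) / ((Nat.totient n : ℚ) * (n : ℚ)) *
          ∑ i, c i * (if m i ∣ n then 1 else 0)) ∧
    (∀ t : ℕ, 0 < t → G t = B (2 * h) * ∑ i, c i * Ghm (2 * h) (m i) t)

end

end Lucas

/-! The argument has an analytic half, valid for every Lucas sequence with a density formula of the
given shape, and an arithmetic half that produces such formulas for the three sequences.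

Analytic half. The weight `w(n) = (n,h)/(φ(n)n)` is multiplicative and `f_h(t,n) = w(nt)/w(t)` is
multiplicative in `n`. A density of the form `w(n) ∑ c_i χ_{m_i}(n)`, with `2h` as the parameter of
`w`, turns the series for `δ_u(t)` into a linear combination of sums of `μ(n) w(nt)` over the `n`
with `m_i ∣ nt`, that is `k ∣ n` with `k = m_i/(m_i,t)`. Writing `n = k n'`, the Möbius function
forces `n'` coprime to `k`, and the remaining sum is an Euler product. It differs from the Artin
product at finitely many primes only, and comparing local factors gives `A F B G`
(`hasSum_moebius_mul_weight`). The characteristic functions `χ_m` are linearly independent, so `G_u`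
does not depend on the representation (`sum_mul_eq_of_sum_dvd_eq`).

Arithmetic half. In the three cases `γ` is `-ε²`, `η²`, `-η³`, with `ε` the golden ratio and `η = 2
+ √3`. Neither unit is a perfect power up to sign, which gives `h`. Put `L = K(ζ_n)` and let `d` be
the largest divisor of `n` for which `γ` is a `d`-th power in `L`. Kummer theory gives `[K_n : L] =
n/d`. If `y ^ d = γ` with `y ∈ L`, then, as `L/ℚ` is abelian, `|y|²` is a real element of `K`, so
`d` divides `2h` (`dvd_two_mul_of_pow_eq`). Total positivity, and the facts that `i` or `√±2` lies
in `L` only if `4 ∣ n` or `8 ∣ n`, then determine `d`.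

An automorphism inverting `ζ_n` and `γ^(1/n)` exists exactly when one inverts `ζ_n` and `y`
(`exists_algEquiv_inv_iff`). That question reduces to whether `√D` lies in `ℚ(ζ_n)`, with an
additional obstruction when `y` involves `i` or `√±2`. These computations take place in an algebraic
closure of `ℚ` embedded in `ℂ` and are then transported to the fields `K_n`. -/

namespace Lucas

/-! ### The multiplicative weight and its local factors -/

/-- The weight `(n,h) / (φ(n) n)` as an arithmetic function. -/
noncomputable def weight (h : ℕ) : ArithmeticFunction ℚ :=
  ⟨fun n => (Nat.gcd n h : ℚ) / ((Nat.totient n : ℚ) * (n : ℚ)), by simp⟩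

theorem weight_apply (h n : ℕ) :
    weight h n = (Nat.gcd n h : ℚ) / ((Nat.totient n : ℚ) * (n : ℚ)) := rfl

theorem weight_isMultiplicative (h : ℕ) : (weight h).IsMultiplicative := by
  constructor
  · simp [weight_apply]
  · intro m n hmn
    simp only [weight_apply, Nat.totient_mul hmn, Nat.gcd_comm _ h, hmn.gcd_mul h]
    push_cast
    rw [div_mul_div_comm]
    congr 1
    ring

theorem weight_pos {h n : ℕ} (hn : 0 < n) : 0 < weight h n := by
  rw [weight_apply]
  have := Nat.gcd_pos_of_pos_left h hn
  have := Nat.totient_pos.2 hn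
  positivity

/-- This reading of `f` extracts the constant `weight h t` from the sum of `μ(n) weight h (n * t)`.
-/
theorem f_eq_weight_div {t : ℕ} (ht : 0 < t) (h n : ℕ) :
    f h t n = weight h (n * t) / weight h t := by
  have h1 : (Nat.gcd t h : ℚ) ≠ 0 := by exact_mod_cast (Nat.gcd_pos_of_pos_left h ht).ne'
  have h2 : (t : ℚ) ≠ 0 := by exact_mod_cast ht.ne'
  rw [f, weight_apply, weight_apply]
  push_cast
  have h3 : (Nat.totient t : ℚ) ≠ 0 := by exact_mod_cast (Nat.totient_pos.2 ht).ne'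
  rcases Nat.eq_zero_or_pos n with rfl | hn
  · simp
  have h4 : (n : ℚ) ≠ 0 := by exact_mod_cast hn.ne'
  have h5 : (Nat.totient (n * t) : ℚ) ≠ 0 := by
    exact_mod_cast (Nat.totient_pos.2 (Nat.mul_pos hn ht)).ne'
  field_simp

/-- A multiplicative function takes the same product at `x, y` as at their lcm and gcd; here `at`
and `bt` have lcm `abt` and gcd `t`. This makes `f` multiplicative in `n` even when `n` shares
factors with `t`. -/
theorem weight_mul_mul {a b : ℕ} (hab : a.Coprime b) (h t : ℕ) :
    weight h (a * b * t) * weight h t = weight h (a * t) * weight h (b * t) := by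
  have h1 : (a * t).gcd (b * t) = t := by rw [Nat.gcd_mul_right, hab.gcd_eq_one, one_mul]
  have h2 : (a * t).lcm (b * t) = a * b * t := by
    rw [Nat.lcm_mul_right, hab.lcm_eq_mul]
  rw [← (weight_isMultiplicative h).lcm_apply_mul_gcd_apply (x := a * t), h1, h2]

theorem f_pos {t n : ℕ} (ht : 0 < t) (hn : 0 < n) (h : ℕ) : 0 < f h t n := by
  rw [f_eq_weight_div ht]
  exact div_pos (weight_pos (Nat.mul_pos hn ht)) (weight_pos ht)

theorem f_one {t : ℕ} (ht : 0 < t) (h : ℕ) : f h t 1 = 1 := by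
  rw [f_eq_weight_div ht, one_mul, div_self (weight_pos ht).ne']

theorem f_mul {t a b : ℕ} (ht : 0 < t) (hab : a.Coprime b) (h : ℕ) :
    f h t (a * b) = f h t a * f h t b := by
  have h0 := (weight_pos (h := h) ht).ne'
  rw [f_eq_weight_div ht, f_eq_weight_div ht, f_eq_weight_div ht, div_mul_div_comm,
    ← weight_mul_mul hab, mul_div_mul_right _ _ h0]

theorem f_prime_of_not_dvd {t p : ℕ} (hp : p.Prime) (ht : 0 < t) (hpt : ¬ p ∣ t) (h : ℕ) :
    f h t p = (Nat.gcd p h : ℚ) / ((p : ℚ) * ((p : ℚ) - 1)) := by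
  have hc : p.Coprime t := (Nat.Prime.coprime_iff_not_dvd hp).2 hpt
  rw [f_eq_weight_div ht, (weight_isMultiplicative h).map_mul_of_coprime hc,
    mul_div_cancel_right₀ _ (weight_pos ht).ne', weight_apply, Nat.totient_prime hp,
    Nat.cast_sub hp.one_le]
  push_cast
  rw [mul_comm (p : ℚ)]

theorem f_prime_of_dvd {t p : ℕ} (hp : p.Prime) (ht : 0 < t) (hpt : p ∣ t) (h : ℕ) :
    f h t p = (Nat.gcd (p * t) h : ℚ) / ((p : ℚ) ^ 2 * (Nat.gcd t h : ℚ)) := by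
  rw [f, Nat.totient_mul_of_prime_of_dvd hp hpt]
  have h3 : (Nat.totient t : ℚ) ≠ 0 := by exact_mod_cast (Nat.totient_pos.2 ht).ne'
  push_cast
  rw [show (Nat.gcd t h : ℚ) * (p * Nat.totient t) * p
    = (p : ℚ) ^ 2 * (Nat.gcd t h : ℚ) * Nat.totient t by ring, mul_div_mul_right _ _ h3]

/-- Makes `1 - f` and `1 - 1/f` invertible at odd primes. At `p = 2` the value can be `1`, which is
why `Gtilde` treats that prime without inverses. -/
theorem f_prime_lt_one {t p : ℕ} (hp : p.Prime) (hp2 : 2 < p) (ht : 0 < t) (h : ℕ) :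
    f h t p < 1 := by
  have hp0 : (2 : ℚ) < p := by exact_mod_cast hp2
  by_cases hpt : p ∣ t
  · rw [f_prime_of_dvd hp ht hpt]
    have hg : 0 < Nat.gcd t h := Nat.gcd_pos_of_pos_left h ht
    have h1 : Nat.gcd (p * t) h ≤ p * Nat.gcd t h :=
      Nat.le_of_dvd (Nat.mul_pos hp.pos hg) 
        (by rw [← Nat.gcd_mul_left]; exact Nat.gcd_dvd_gcd_mul_left_right _ _ _)
    have h1' : (Nat.gcd (p * t) h : ℚ) ≤ p * Nat.gcd t h := by exact_mod_cast h1
    have hg' : (0 : ℚ) < Nat.gcd t h := by exact_mod_cast hg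
    rw [div_lt_one (by positivity)]
    nlinarith [mul_pos (show (0 : ℚ) < p by linarith) hg']
  · rw [f_prime_of_not_dvd hp ht hpt]
    have h1 : (Nat.gcd p h : ℚ) ≤ p := by
      exact_mod_cast Nat.le_of_dvd hp.pos (Nat.gcd_dvd_left p h)
    rw [div_lt_one (by nlinarith)]
    nlinarith

/-! ### Absolute convergence -/

theorem self_le_two_mul_totient_sq_of_squarefree {n : ℕ} (hn : Squarefree n) :
    n ≤ 2 * n.totient ^ 2 := by
  -- Since `a ≤ (a - 1)²` for `a ≥ 3`, only the prime `2` loses anything, and it accounts for the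
  -- single factor `2`.
  have key : ∀ s : Finset ℕ, (∀ p ∈ s, 1 < p) →
      ∏ p ∈ s, p ≤ (if 2 ∈ s then 2 else 1) * (∏ p ∈ s, (p - 1)) ^ 2 := by
    intro s
    induction s using Finset.induction with
    | empty => simp
    | insert a s ha ih =>
      intro h
      have ih' := ih fun p hp => h p (Finset.mem_insert_of_mem hp)
      rw [Finset.prod_insert ha, Finset.prod_insert ha]
      have h1 := h a (Finset.mem_insert_self a s)
      by_cases h2 : a = 2
      · subst h2
        simp only [ha, if_false, one_mul] at ih'
        simpa using ih'
      · have h3 : a ≤ (a - 1) ^ 2 := by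
          obtain ⟨b, rfl⟩ : ∃ b, a = b + 3 := ⟨a - 3, by omega⟩
          simp only [show b + 3 - 1 = b + 2 by omega]
          nlinarith
        have h4 : (2 ∈ insert a s) ↔ 2 ∈ s := by
          simp [Finset.mem_insert, Ne.symm h2]
        rw [mul_pow]
        simp only [h4]
        calc a * ∏ p ∈ s, p ≤ (a - 1) ^ 2 * ((if 2 ∈ s then 2 else 1) * (∏ p ∈ s, (p - 1)) ^ 2) :=
              Nat.mul_le_mul h3 ih'
          _ = _ := by ring
  have h1 := key n.primeFactors fun p hp => (Nat.prime_of_mem_primeFactors hp).one_lt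
  rw [Nat.prod_primeFactors_of_squarefree hn] at h1
  have h2 : ∏ p ∈ n.primeFactors, (p - 1) = n.totient := by
    have := Nat.totient_mul_prod_primeFactors n
    rw [Nat.prod_primeFactors_of_squarefree hn] at this
    exact (Nat.eq_of_mul_eq_mul_right (Nat.pos_of_ne_zero hn.ne_zero)
      (by rw [this]; ring)).symm
  rw [h2] at h1
  refine h1.trans (Nat.mul_le_mul_right _ ?_)
  split_ifs <;> norm_num

theorem weight_mul_le {h t n : ℕ} (hh : 0 < h) (ht : 0 < t) (hn : 0 < n) :
    weight h (n * t) ≤ h / (n.totient * n) := by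
  rw [weight_apply]
  have h1 : (Nat.gcd (n * t) h : ℚ) ≤ h := by
    exact_mod_cast Nat.le_of_dvd hh (Nat.gcd_dvd_right _ _)
  have h2 : (n.totient : ℚ) ≤ (n * t).totient := by
    exact_mod_cast Nat.le_of_dvd (Nat.totient_pos.2 (Nat.mul_pos hn ht))
      (Nat.totient_dvd_of_dvd (Dvd.intro t rfl))
  have h3 : (n : ℚ) ≤ (n * t : ℕ) := by exact_mod_cast Nat.le_mul_of_pos_right n ht
  have h4 : (0 : ℚ) < n := by exact_mod_cast hn
  have h5 : (0 : ℚ) < n.totient := by exact_mod_cast Nat.totient_pos.2 hn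
  gcongr

/-- Only squarefree `n` contribute, and for those `φ(n) ≥ √(n/2)`, so the terms are `O(n^(-3/2))`.
-/
theorem summable_moebius_mul_weight {h t : ℕ} (hh : 0 < h) (ht : 0 < t) :
    Summable fun n : ℕ => ‖(ArithmeticFunction.moebius n : ℝ) * (weight h (n * t) : ℝ)‖ := by
  have hs : Summable fun n : ℕ => (h * Real.sqrt 2) * (1 / (n : ℝ) ^ (3 / 2 : ℝ)) :=
    (Real.summable_one_div_nat_rpow.2 (by norm_num)).mul_left _
  refine Summable.of_nonneg_of_le (fun n => norm_nonneg _) (fun n => ?_) hs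
  by_cases hn : Squarefree n
  · have hn0 : 0 < n := Nat.pos_of_ne_zero hn.ne_zero
    have h4 : (0 : ℝ) < n := by exact_mod_cast hn0
    have h5 : (0 : ℝ) < n.totient := by exact_mod_cast Nat.totient_pos.2 hn0
    have h1 : (weight h (n * t) : ℝ) ≤ h / (n.totient * n) := by
      have := weight_mul_le hh ht hn0
      have h' : ((weight h (n * t) : ℚ) : ℝ) ≤ ((h / (n.totient * n) : ℚ) : ℝ) := by
        exact_mod_cast this
      simpa using h'
    have h2 : (0 : ℝ) < weight h (n * t) := by
      exact_mod_cast weight_pos (Nat.mul_pos hn0 ht)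
    have h3 : |(ArithmeticFunction.moebius n : ℝ)| = 1 := by
      exact_mod_cast ArithmeticFunction.abs_moebius_eq_one_of_squarefree hn
    rw [norm_mul, Real.norm_eq_abs, h3, one_mul, Real.norm_eq_abs, abs_of_pos h2]
    refine h1.trans ?_
    have h6 : (n : ℝ) ≤ 2 * (n.totient : ℝ) ^ 2 := by
      exact_mod_cast self_le_two_mul_totient_sq_of_squarefree hn
    have h7 : Real.sqrt n ≤ Real.sqrt 2 * n.totient := by
      rw [Real.sqrt_le_left (by positivity), mul_pow, Real.sq_sqrt (by norm_num)]
      exact h6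
    have h8 : (n : ℝ) ^ (3 / 2 : ℝ) = Real.sqrt n * n := by
      rw [Real.sqrt_eq_rpow]
      nth_rewrite 3 [← Real.rpow_one (n : ℝ)]
      rw [← Real.rpow_add h4]
      norm_num
    rw [h8, mul_one_div, div_le_div_iff₀ (by positivity) (by positivity)]
    have h9 : (0 : ℝ) ≤ h := by positivity
    calc (h : ℝ) * (Real.sqrt n * n) ≤ h * (Real.sqrt 2 * n.totient * n) := by gcongr
      _ = _ := by ring
  · rw [ArithmeticFunction.moebius_eq_zero_of_not_squarefree hn]
    simp only [Int.cast_zero, zero_mul, norm_zero]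
    positivity

/-! ### Euler products -/

/-- The summand `μ(n) f_h(t,n)` as an arithmetic function. -/
noncomputable def eulerTerm (h t : ℕ) : ArithmeticFunction ℚ :=
  ⟨fun n => (ArithmeticFunction.moebius n : ℚ) * f h t n, by simp⟩

theorem eulerTerm_apply (h t n : ℕ) :
    eulerTerm h t n = (ArithmeticFunction.moebius n : ℚ) * f h t n := rfl

theorem eulerTerm_isMultiplicative {t : ℕ} (ht : 0 < t) (h : ℕ) :
    (eulerTerm h t).IsMultiplicative := by
  constructor
  · simp [eulerTerm_apply, f_one ht]
  · intro m n hmn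
    rw [eulerTerm_apply, eulerTerm_apply, eulerTerm_apply, f_mul ht hmn,
      ArithmeticFunction.isMultiplicative_moebius.map_mul_of_coprime hmn]
    push_cast
    ring

theorem eulerTerm_prime {p : ℕ} (hp : p.Prime) (h t : ℕ) : eulerTerm h t p = - f h t p := by
  simp [eulerTerm_apply, ArithmeticFunction.moebius_apply_prime hp]

theorem eulerTerm_eq_zero_of_not_squarefree {n : ℕ} (hn : ¬ Squarefree n) (h t : ℕ) :
    eulerTerm h t n = 0 := by
  simp [eulerTerm_apply, ArithmeticFunction.moebius_eq_zero_of_not_squarefree hn]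

theorem summable_norm_eulerTerm {h t : ℕ} (hh : 0 < h) (ht : 0 < t) :
    Summable fun n : ℕ => ‖((eulerTerm h t n : ℚ) : ℝ)‖ := by
  refine ((summable_moebius_mul_weight hh ht).mul_right ‖((weight h t)⁻¹ : ℝ)‖).congr
    fun n => ?_
  rw [← norm_mul, eulerTerm_apply, f_eq_weight_div ht]
  push_cast
  rw [div_eq_mul_inv, mul_assoc]

/-- Restricting a multiplicative function to arguments coprime to `m` keeps it multiplicative and
replaces the local factors at `p ∣ m` by `1`. Elsewhere the Möbius function removes all powers
beyond the first. -/
theorem hasProd_one_sub_f {h t : ℕ} (hh : 0 < h) (ht : 0 < t) (m : ℕ) :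
    HasProd (fun p : Nat.Primes => if (p : ℕ) ∣ m then (1 : ℝ) else 1 - (f h t p : ℝ))
      (∑' n : ℕ, if n.Coprime m then ((eulerTerm h t n : ℚ) : ℝ) else 0) := by
  have hm := eulerTerm_isMultiplicative ht h
  set e : ℕ → ℝ := fun n => if n.Coprime m then ((eulerTerm h t n : ℚ) : ℝ) else 0 with he
  have h1 : e 1 = 1 := by simp [he, hm.1]
  have hmul : ∀ {a b : ℕ}, a.Coprime b → e (a * b) = e a * e b := by
    intro a b hab
    simp only [he, Nat.coprime_mul_iff_left, hm.map_mul_of_coprime hab]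
    by_cases ha : a.Coprime m
    · by_cases hb : b.Coprime m
      · rw [if_pos ⟨ha, hb⟩, if_pos ha, if_pos hb, Rat.cast_mul]
      · rw [if_neg fun h' => hb h'.2, if_neg hb, mul_zero]
    · rw [if_neg fun h' => ha h'.1, if_neg ha, zero_mul]
  have h0 : e 0 = 0 := by simp [he]
  have hs : Summable fun n => ‖e n‖ := by
    refine Summable.of_nonneg_of_le (fun n => norm_nonneg _) (fun n => ?_)
      (summable_norm_eulerTerm hh ht)
    simp only [he]
    split_ifs
    · exact le_rfl
    · simp
  have key : (fun p : Nat.Primes => ∑' k, e ((p : ℕ) ^ k)) =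
      fun p : Nat.Primes => if (p : ℕ) ∣ m then (1 : ℝ) else 1 - (f h t p : ℝ) := by
    funext p
    have hp := p.2
    rw [tsum_eq_sum (s := Finset.range 2)]
    · rw [Finset.sum_range_succ, Finset.sum_range_one, pow_zero, pow_one, h1]
      simp only [he, Nat.Prime.coprime_iff_not_dvd hp, eulerTerm_prime hp]
      split_ifs <;> simp_all [sub_eq_add_neg]
    · intro k hk
      have hk2 : 1 < k := by simpa using hk
      have : ¬ Squarefree ((p : ℕ) ^ k) := by
        intro hsq
        have := (Nat.squarefree_pow_iff hp.ne_one (by omega)).1 hsq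
        omega
      simp [he, eulerTerm_eq_zero_of_not_squarefree this]
  exact key ▸ EulerProduct.eulerProduct_hasProd h1 hmul hs h0

theorem multipliable_artin :
    Multipliable fun p : Nat.Primes => (1 - 1 / (((p : ℕ) : ℝ) * (((p : ℕ) : ℝ) - 1))) := by
  have h : Summable fun p : Nat.Primes => -(1 / (((p : ℕ) : ℝ) * (((p : ℕ) : ℝ) - 1))) := by
    refine Summable.neg ?_
    have h2 : Summable fun p : Nat.Primes => 2 * (1 / (((p : ℕ) : ℝ) ^ 2)) :=
      ((Real.summable_one_div_nat_pow.2 one_lt_two).comp_injective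
        Nat.Primes.coe_nat_injective).mul_left 2
    refine Summable.of_nonneg_of_le (fun p => ?_) (fun p => ?_) h2
    · have : (2 : ℝ) ≤ ((p : ℕ) : ℝ) := by exact_mod_cast p.2.two_le
      exact one_div_nonneg.2 (mul_nonneg (by linarith) (by linarith))
    · have : (2 : ℝ) ≤ ((p : ℕ) : ℝ) := by exact_mod_cast p.2.two_le
      rw [mul_one_div, div_le_div_iff₀ (by nlinarith) (by positivity)]
      nlinarith
  simpa [sub_eq_add_neg] using Real.multipliable_one_add_of_summable h

theorem artin_factor_ne_zero {p : ℕ} (hp : p.Prime) :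
    (1 - 1 / ((p : ℚ) * ((p : ℚ) - 1))) ≠ 0 := by
  have : (2 : ℚ) ≤ p := by exact_mod_cast hp.two_le
  have h1 : 1 / ((p : ℚ) * ((p : ℚ) - 1)) < 1 := by
    rw [div_lt_one (by nlinarith)]
    nlinarith
  linarith

/-- At a prime dividing none of `t`, `h`, `m` the local factor is exactly the Artin factor, so the
quotient by the Artin product is a finite product over the primes of any common multiple `N`. -/
theorem tsum_coprime_eulerTerm {h t m N : ℕ} (hh : 0 < h) (ht : 0 < t) (hN : N ≠ 0)
    (htN : t ∣ N) (hhN : h ∣ N) (hmN : m ∣ N) :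
    (∑' n : ℕ, if n.Coprime m then ((eulerTerm h t n : ℚ) : ℝ) else 0) =
      artinConstant * ((∏ p ∈ N.primeFactors,
        ((if p ∣ m then 1 else 1 - f h t p) / (1 - 1 / ((p : ℚ) * ((p : ℚ) - 1)))) : ℚ) : ℝ) := by
  set c : ℕ → ℚ := fun p =>
    (if p ∣ m then 1 else 1 - f h t p) / (1 - 1 / ((p : ℚ) * ((p : ℚ) - 1))) with hc
  have h1 := multipliable_artin.hasProd
  have h2 : HasProd (fun p : Nat.Primes => ((c p : ℚ) : ℝ))
      (∏ p ∈ N.primeFactors.subtype Nat.Prime, ((c p : ℚ) : ℝ)) := by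
    refine hasProd_prod_of_ne_finset_one fun p hp => ?_
    have hpN : ¬ (p : ℕ) ∣ N := by
      exact fun hd => hp (Finset.mem_subtype.2 (Nat.mem_primeFactors.2 ⟨p.2, hd, hN⟩))
    have hpm : ¬ (p : ℕ) ∣ m := fun hd => hpN (hd.trans hmN)
    have hpt : ¬ (p : ℕ) ∣ t := fun hd => hpN (hd.trans htN)
    have hph : ¬ (p : ℕ) ∣ h := fun hd => hpN (hd.trans hhN)
    have hg : Nat.gcd p h = 1 := (Nat.Prime.coprime_iff_not_dvd p.2).2 hph
    have : c p = 1 := by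
      simp only [hc, hpm, if_false, f_prime_of_not_dvd p.2 ht hpt, hg]
      rw [Nat.cast_one]
      exact div_self (artin_factor_ne_zero p.2)
    rw [this, Rat.cast_one]
  have h3 := h1.mul h2
  rw [Finset.prod_subtype_of_mem (fun p : ℕ => ((c p : ℚ) : ℝ))
    fun p hp => Nat.prime_of_mem_primeFactors hp] at h3
  have h4 : (fun p : Nat.Primes => (1 - 1 / (((p : ℕ) : ℝ) * (((p : ℕ) : ℝ) - 1))) *
      ((c p : ℚ) : ℝ)) = fun p : Nat.Primes =>
        if (p : ℕ) ∣ m then (1 : ℝ) else 1 - (f h t p : ℝ) := by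
    funext p
    have h5 : (1 - 1 / (((p : ℕ) : ℝ) * (((p : ℕ) : ℝ) - 1))) ≠ 0 := by
      exact_mod_cast artin_factor_ne_zero p.2
    simp only [hc]
    push_cast
    rw [mul_div_cancel₀ _ h5]
    split_ifs <;> simp
  rw [h4] at h3
  rw [(hasProd_one_sub_f hh ht m).unique h3, artinConstant, Rat.cast_prod]

theorem prod_oddPrimeFactors_of_dvd {a N : ℕ} (hN : N ≠ 0) (ha : a ∣ N) (u : ℕ → ℚ) :
    ∏ p ∈ oddPrimeFactors a, u p = ∏ p ∈ oddPrimeFactors N, if p ∣ a then u p else 1 := by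
  rw [← Finset.prod_filter]
  refine Finset.prod_congr ?_ fun _ _ => rfl
  ext p
  simp only [oddPrimeFactors, Finset.mem_filter, Nat.mem_primeFactors]
  constructor
  · rintro ⟨⟨hp, hpa, -⟩, h2⟩
    exact ⟨⟨⟨hp, hpa.trans ha, hN⟩, h2⟩, hpa⟩
  · rintro ⟨⟨⟨hp, -, -⟩, h2⟩, hpa⟩
    exact ⟨⟨hp, hpa, fun h0 => hN (by simpa [h0] using ha)⟩, h2⟩

theorem primeFactors_eq_insert_two {N : ℕ} (hN : N ≠ 0) (h2 : 2 ∣ N) :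
    N.primeFactors = insert 2 (oddPrimeFactors N) := by
  ext p
  simp only [oddPrimeFactors, Finset.mem_insert, Finset.mem_filter, Nat.mem_primeFactors]
  constructor
  · rintro ⟨hp, hd, h0⟩
    rcases hp.two_le.eq_or_lt with h | h
    · exact Or.inl h.symm
    · exact Or.inr ⟨⟨hp, hd, h0⟩, h⟩
  · rintro (rfl | h)
    · exact ⟨Nat.prime_two, h2, hN⟩
    · exact h.1

/-- The comparison is made prime by prime over one index set, the primes of `N`. At `2` the Artin
factor is `1/2`, whence the leading `2` in `B`, and only `Gtilde` records `f h t 2`. -/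
theorem weight_mul_eulerTerm_mul_prod {h t m N : ℕ} (ht : 0 < t) (hN : N ≠ 0)
    (h2N : 2 ∣ N) (htN : t ∣ N) (hhN : h ∣ N) (hmN : m ∣ N) :
    weight h t * (eulerTerm h t m * ∏ p ∈ N.primeFactors,
      ((if p ∣ m then 1 else 1 - f h t p) / (1 - 1 / ((p : ℚ) * ((p : ℚ) - 1))))) =
    F h t * B h * Gtilde h m t := by
  by_cases hm : Squarefree m
  swap
  · simp [Gtilde, ArithmeticFunction.moebius_eq_zero_of_not_squarefree hm,
      eulerTerm_eq_zero_of_not_squarefree hm]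
  have hmu : |(ArithmeticFunction.moebius m : ℚ)| = 1 := by
    exact_mod_cast ArithmeticFunction.abs_moebius_eq_one_of_squarefree hm
  have hm0 : m ≠ 0 := hm.ne_zero
  have he : eulerTerm h t m = ∏ p ∈ N.primeFactors, if p ∣ m then - f h t p else 1 := by
    rw [← (eulerTerm_isMultiplicative ht h).prod_primeFactors hm, ← Finset.prod_filter]
    refine Finset.prod_congr ?_ fun p hp => eulerTerm_prime ?_ h t
    · ext p
      simp only [Finset.mem_filter, Nat.mem_primeFactors]
      exact ⟨fun hp => ⟨⟨hp.1, hp.2.1.trans hmN, hN⟩, hp.2.1⟩, fun hp => ⟨hp.1.1, hp.2, hm0⟩⟩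
    · simp only [Finset.mem_filter, Nat.mem_primeFactors] at hp
      exact hp.1.1
  have h2 : 2 ∉ oddPrimeFactors N := by simp [oddPrimeFactors]
  rw [he, ← Finset.prod_mul_distrib, F, B, Gtilde, hmu, primeFactors_eq_insert_two hN h2N,
    Finset.prod_insert h2, prod_oddPrimeFactors_of_dvd hN htN, prod_oddPrimeFactors_of_dvd hN hhN,
    prod_oddPrimeFactors_of_dvd hN hmN, weight_apply]
  -- With `q = (p,h)/(p(p-1))` and `a` the Artin factor, `F` contributes `(1-f)/(1-q)`, `B`
  -- contributes `(1-q)/a`, and for `p ∣ m` the factor of `Gtilde` is `-f/(1-f)`. The middle terms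
  -- telescope.
  have hodd : ∀ p ∈ oddPrimeFactors N,
      (if p ∣ m then - f h t p else 1) *
        ((if p ∣ m then 1 else 1 - f h t p) / (1 - 1 / ((p : ℚ) * ((p : ℚ) - 1)))) =
      (if p ∣ t then (1 - (Nat.gcd (p * t) h : ℚ) / ((p : ℚ) ^ 2 * (Nat.gcd t h : ℚ))) *
        (1 - (Nat.gcd p h : ℚ) / ((p : ℚ) * ((p : ℚ) - 1)))⁻¹ else 1) *
      (if p ∣ h then (1 - ((p : ℚ) - 1) / ((p : ℚ) ^ 2 - (p : ℚ) - 1)) else 1) *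
      (if p ∣ m then (1 - 1 / f h t p)⁻¹ else 1) := by
    intro p hp
    simp only [oddPrimeFactors, Finset.mem_filter, Nat.mem_primeFactors] at hp
    obtain ⟨⟨hp, -, -⟩, hp2⟩ := hp
    have hp3 : (3 : ℚ) ≤ p := by exact_mod_cast hp2
    have hf1 := f_prime_lt_one hp hp2 ht h
    have hf0 := f_pos ht hp.pos h
    have ha := artin_factor_ne_zero hp
    have hgle : (Nat.gcd p h : ℚ) ≤ p := by
      exact_mod_cast Nat.le_of_dvd hp.pos (Nat.gcd_dvd_left p h)
    have hb : (1 - (Nat.gcd p h : ℚ) / ((p : ℚ) * ((p : ℚ) - 1))) ≠ 0 := by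
      have h1 : (Nat.gcd p h : ℚ) / ((p : ℚ) * ((p : ℚ) - 1)) < 1 := by
        rw [div_lt_one (by nlinarith)]
        nlinarith
      linarith
    have e1 : (if p ∣ t then (1 - (Nat.gcd (p * t) h : ℚ) / ((p : ℚ) ^ 2 * (Nat.gcd t h : ℚ))) *
        (1 - (Nat.gcd p h : ℚ) / ((p : ℚ) * ((p : ℚ) - 1)))⁻¹ else 1) =
        (1 - f h t p) / (1 - (Nat.gcd p h : ℚ) / ((p : ℚ) * ((p : ℚ) - 1))) := by
      split_ifs with hd
      · rw [f_prime_of_dvd hp ht hd, div_eq_mul_inv _ (1 - (Nat.gcd p h : ℚ) / _)]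
      · rw [f_prime_of_not_dvd hp ht hd, div_self hb]
    have e2 : (if p ∣ h then (1 - ((p : ℚ) - 1) / ((p : ℚ) ^ 2 - (p : ℚ) - 1)) else 1) =
        (1 - (Nat.gcd p h : ℚ) / ((p : ℚ) * ((p : ℚ) - 1))) /
          (1 - 1 / ((p : ℚ) * ((p : ℚ) - 1))) := by
      split_ifs with hd
      · rw [Nat.gcd_eq_left hd]
        have h1 : (p : ℚ) ≠ 0 := by linarith
        have h2 : (p : ℚ) - 1 ≠ 0 := by linarith
        have h3 : (p : ℚ) ^ 2 - p - 1 ≠ 0 := by nlinarith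
        have h4 : (1 - 1 / ((p : ℚ) * ((p : ℚ) - 1))) =
            ((p : ℚ) ^ 2 - p - 1) / (p * (p - 1)) := by
          field_simp
        rw [h4, mul_comm (p : ℚ) (p - 1)]
        rw [eq_div_iff (div_ne_zero h3 (mul_ne_zero h2 h1))]
        generalize hq : (p : ℚ) ^ 2 - p - 1 = q at h3 ⊢
        field_simp
        linear_combination -hq
      · rw [(Nat.Prime.coprime_iff_not_dvd hp).2 hd, Nat.cast_one, div_self ha]
    have e3 : (1 - 1 / f h t p)⁻¹ = - f h t p / (1 - f h t p) := by
      have h1 : f h t p - 1 ≠ 0 := by linarith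
      have h2 : 1 - f h t p ≠ 0 := by linarith
      have h3 : 1 - 1 / f h t p = (f h t p - 1) / f h t p := by
        field_simp
      rw [h3, inv_div, div_eq_div_iff h1 h2]
      ring
    have h2 : 1 - f h t p ≠ 0 := by linarith
    rw [e1, e2, e3, div_mul_div_cancel₀ hb]
    split_ifs
    · field_simp
    · simp
  rw [Finset.prod_congr rfl hodd, Finset.prod_mul_distrib, Finset.prod_mul_distrib]
  by_cases h2m : 2 ∣ m
  · simp only [h2m, if_true]
    norm_num
    ring
  · simp only [h2m, if_false]
    norm_num
    ring

/-- The condition `m ∣ nt` is `k ∣ n` with `k = m/(m,t)`, so the sum runs over `n = k n'`, and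
squarefreeness of `k n'` splits the term as a value at `k` times a value at `n'` coprime to `k`. -/
theorem hasSum_moebius_mul_weight {h t m : ℕ} (hh : 0 < h) (ht : 0 < t) (hm : 0 < m) :
    HasSum (fun n : ℕ => (ArithmeticFunction.moebius n : ℝ) * (weight h (n * t) : ℝ) *
      (if m ∣ n * t then 1 else 0)) (artinConstant * ((F h t * B h * Ghm h m t : ℚ) : ℝ)) := by
  set k := m / Nat.gcd m t with hk
  have hg : 0 < Nat.gcd m t := Nat.gcd_pos_of_pos_left t hm
  have hkm : k * Nat.gcd m t = m := Nat.div_mul_cancel (Nat.gcd_dvd_left m t)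
  have hk0 : 0 < k := Nat.pos_of_ne_zero fun h0 => by simp [h0] at hkm; omega
  have hdvd : ∀ n : ℕ, m ∣ n * t ↔ k ∣ n := by
    intro n
    obtain ⟨t', ht'⟩ := Nat.gcd_dvd_right m t
    have hc : k.Coprime t' := by
      have := Nat.coprime_div_gcd_div_gcd hg
      rwa [← hk, show t / Nat.gcd m t = t' from
        Nat.div_eq_of_eq_mul_right hg ht'] at this
    constructor
    · intro hd
      have : k ∣ n * t' := by
        refine Nat.dvd_of_mul_dvd_mul_right hg ?_
        rw [hkm]
        convert hd using 1
        conv_rhs => rw [ht']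
        ring
      exact hc.dvd_of_dvd_mul_right this
    · rintro ⟨c, rfl⟩
      refine ⟨c * t', ?_⟩
      conv_lhs => rw [ht']
      conv_rhs => rw [← hkm]
      ring
  -- Any common multiple of `t`, `h`, `k` would do; the factor `2` ensures that the prime `2` can be
  -- split off.
  set N := 2 * t * h * k with hN
  have hN0 : N ≠ 0 := by positivity
  have hw : (weight h t : ℝ) ≠ 0 := by exact_mod_cast (weight_pos (h := h) ht).ne'
  have hval : artinConstant * ((F h t * B h * Ghm h m t : ℚ) : ℝ) =
      (weight h t : ℝ) * (eulerTerm h t k : ℝ) *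
        ∑' n : ℕ, if n.Coprime k then ((eulerTerm h t n : ℚ) : ℝ) else 0 := by
    have htN : t ∣ N := ⟨2 * h * k, by rw [hN]; ring⟩
    have hhN : h ∣ N := ⟨2 * t * k, by rw [hN]; ring⟩
    have hkN : k ∣ N := ⟨2 * t * h, by rw [hN]; ring⟩
    have h2N : 2 ∣ N := ⟨t * h * k, by rw [hN]; ring⟩
    rw [tsum_coprime_eulerTerm hh ht hN0 htN hhN hkN, Ghm, ← hk,
      ← weight_mul_eulerTerm_mul_prod ht hN0 h2N htN hhN hkN]
    push_cast
    ring
  have hsum : Summable fun n : ℕ => if n.Coprime k then ((eulerTerm h t n : ℚ) : ℝ) else 0 := by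
    refine Summable.of_norm_bounded (summable_norm_eulerTerm hh ht) fun n => ?_
    split_ifs <;> simp
  have hbase := hsum.hasSum.mul_left ((weight h t : ℝ) * (eulerTerm h t k : ℝ))
  rw [hval]
  -- Reindexing along `n ↦ k * n`: terms outside the image vanish by the divisibility condition, and
  -- those with `n` not coprime to `k` vanish because `k * n` is not squarefree.
  have hinj : Function.Injective fun n : ℕ => k * n := fun a b hab =>
    Nat.eq_of_mul_eq_mul_left hk0 hab
  refine (hinj.hasSum_iff ?_).1 (hbase.congr_fun fun n => ?_)
  · intro n hn
    have : ¬ k ∣ n := fun ⟨c, hc⟩ => hn ⟨c, hc.symm⟩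
    simp [hdvd, this]
  · have hterm : ∀ a : ℕ, (ArithmeticFunction.moebius a : ℝ) * (weight h (a * t) : ℝ) =
        (weight h t : ℝ) * (eulerTerm h t a : ℝ) := by
      intro a
      rw [eulerTerm_apply, f_eq_weight_div ht]
      push_cast
      field_simp
    simp only [Function.comp, hdvd, dvd_mul_right, if_true, mul_one, hterm]
    split_ifs with hc
    · rw [(eulerTerm_isMultiplicative ht h).map_mul_of_coprime hc.symm]
      push_cast
      ring
    · rw [eulerTerm_eq_zero_of_not_squarefree]
      · simp
      · intro hsq
        exact hc (Nat.coprime_of_squarefree_mul hsq).symm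

/-! ### Independence of the representation -/

theorem sum_mul_eq_zero_of_sum_dvd_eq_zero {ι : Type*} [Fintype ι] (c : ι → ℚ) (m : ι → ℕ)
    (hm : ∀ i, 0 < m i) (h : ∀ n : ℕ, 0 < n → ∑ i, c i * (if m i ∣ n then 1 else 0) = 0)
    (u : ℕ → ℚ) : ∑ i, c i * u (m i) = 0 := by
  classical
  -- For each modulus the coefficients attached to it sum to zero: evaluating at `n = v` leaves the
  -- moduli dividing `v`, and the proper divisors drop out by induction.
  have key : ∀ v : ℕ, 0 < v → ∑ i with m i = v, c i = 0 := by
    intro v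
    induction v using Nat.strong_induction_on with
    | _ v ih =>
      intro hv
      have h1 := h v hv
      simp only [mul_ite, mul_one, mul_zero, ← Finset.sum_filter] at h1
      rw [← Finset.sum_fiberwise_of_maps_to (t := v.divisors) (g := m)
        (fun i hi => Nat.mem_divisors.2 ⟨(Finset.mem_filter.1 hi).2, hv.ne'⟩)] at h1
      rw [← h1, Finset.sum_eq_single_of_mem v (Nat.mem_divisors_self v hv.ne')]
      · refine Finset.sum_congr ?_ fun _ _ => rfl
        ext i
        simp only [Finset.mem_filter, Finset.mem_univ, true_and]
        exact ⟨fun hi => ⟨hi ▸ dvd_rfl, hi⟩, fun hi => hi.2⟩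
      · intro w hw hwv
        have hwd := Nat.mem_divisors.1 hw
        have hw0 : 0 < w := Nat.pos_of_dvd_of_pos hwd.1 hv
        rw [← ih w (lt_of_le_of_ne (Nat.le_of_dvd hv hwd.1) hwv) hw0]
        refine Finset.sum_congr ?_ fun _ _ => rfl
        ext i
        simp only [Finset.mem_filter, Finset.mem_univ, true_and]
        exact ⟨fun hi => hi.2, fun hi => ⟨hi ▸ hwd.1, hi⟩⟩
  rw [← Finset.sum_fiberwise_of_maps_to (t := Finset.univ.image m) (g := m)
    (fun i _ => Finset.mem_image_of_mem m (Finset.mem_univ i))]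
  refine Finset.sum_eq_zero fun v hv => ?_
  obtain ⟨i, -, rfl⟩ := Finset.mem_image.1 hv
  rw [← mul_zero (u (m i)), ← key (m i) (hm i), Finset.mul_sum]
  refine Finset.sum_congr rfl fun j hj => ?_
  rw [(Finset.mem_filter.1 hj).2, mul_comm]

/-- The vanishing criterion is applied to the disjoint union of the two families, the second with
negated coefficients. -/
theorem sum_mul_eq_of_sum_dvd_eq {ι κ : Type*} [Fintype ι] [Fintype κ] {c : ι → ℚ} {m : ι → ℕ}
    {c' : κ → ℚ} {m' : κ → ℕ} (hm : ∀ i, 0 < m i) (hm' : ∀ i, 0 < m' i)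
    (h : ∀ n : ℕ, 0 < n → ∑ i, c i * (if m i ∣ n then 1 else 0) =
      ∑ i, c' i * (if m' i ∣ n then 1 else 0))
    (u : ℕ → ℚ) : ∑ i, c i * u (m i) = ∑ i, c' i * u (m' i) := by
  have := sum_mul_eq_zero_of_sum_dvd_eq_zero (Sum.elim c (-c')) (Sum.elim m m')
    (by rintro (i | i) <;> simp [hm, hm'])
    (fun n hn => by
      rw [Fintype.sum_sum_type]
      simp only [Sum.elim_inl, Sum.elim_inr, Pi.neg_apply, neg_mul, Finset.sum_neg_distrib]
      exact add_neg_eq_zero.2 (h n hn)) u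
  rw [Fintype.sum_sum_type] at this
  simp only [Sum.elim_inl, Sum.elim_inr, Pi.neg_apply, neg_mul, Finset.sum_neg_distrib] at this
  linarith

/-- The weight is nonzero, so two density formulas have equal divisibility sums; hence any known
representation may be used to compute `G`. -/
theorem IsGu.eq_of_density {a₁ a₂ : ℤ} {h : ℕ} {G : ℕ → ℚ} (hG : IsGu a₁ a₂ h G)
    {k : ℕ} {c : Fin k → ℚ} {m : Fin k → ℕ} (hm : ∀ i, 0 < m i)
    (hd : ∀ n : ℕ, 0 < n → density a₁ a₂ n =
      (Nat.gcd n (2 * h) : ℚ) / ((Nat.totient n : ℚ) * (n : ℚ)) *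
        ∑ i, c i * (if m i ∣ n then 1 else 0)) {t : ℕ} (ht : 0 < t) :
    G t = B (2 * h) * ∑ i, c i * Ghm (2 * h) (m i) t := by
  obtain ⟨-, k', c', m', hm', hd', hG'⟩ := hG
  rw [hG' t ht]
  congr 1
  refine sum_mul_eq_of_sum_dvd_eq (u := fun m => Ghm (2 * h) m t) hm' hm fun n hn => ?_
  exact mul_left_cancel₀ (weight_pos (h := 2 * h) hn).ne' ((hd' n hn).symm.trans (hd n hn))

theorem IsGu.hasSum_deltaTerm {a₁ a₂ : ℤ} {h : ℕ} {G : ℕ → ℚ} (hG : IsGu a₁ a₂ h G)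
    {t : ℕ} (ht : 0 < t) :
    HasSum (deltaTerm a₁ a₂ t) (artinConstant * (F (2 * h) t : ℝ) * (G t : ℝ)) := by
  obtain ⟨⟨hh, -⟩, k, c, m, hm, hd, hG⟩ := hG
  have hh2 : 0 < 2 * h := by omega
  have h1 := hasSum_sum (s := Finset.univ) fun i (_ : i ∈ Finset.univ) =>
    (hasSum_moebius_mul_weight hh2 ht (hm i)).mul_left (c i : ℝ)
  have hv : artinConstant * (F (2 * h) t : ℝ) * (G t : ℝ) =
      ∑ i, (c i : ℝ) * (artinConstant * ((F (2 * h) t * B (2 * h) * Ghm (2 * h) (m i) t : ℚ) : ℝ))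
      := by
    rw [hG t ht]
    push_cast
    rw [Finset.mul_sum, Finset.mul_sum]
    refine Finset.sum_congr rfl fun i _ => ?_
    ring
  rw [hv]
  refine h1.congr_fun fun n => ?_
  rcases Nat.eq_zero_or_pos n with rfl | hn
  · simp [deltaTerm]
  · rw [deltaTerm, hd (n * t) (Nat.mul_pos hn ht), ← weight_apply]
    push_cast
    rw [Finset.mul_sum, Finset.mul_sum]
    refine Finset.sum_congr rfl fun i _ => ?_
    split_ifs <;> ring

/-! ### Tables of `G` for the three sequences -/

theorem oddPrimeFactors_prime {p : ℕ} (hp : p.Prime) (h2 : 2 < p) : oddPrimeFactors p = {p} := by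
  rw [oddPrimeFactors, hp.primeFactors, Finset.filter_singleton, if_pos h2]

theorem oddPrimeFactors_two_mul {n : ℕ} (hn : n ≠ 0) :
    oddPrimeFactors (2 * n) = oddPrimeFactors n := by
  ext p
  simp only [oddPrimeFactors, Finset.mem_filter, Nat.mem_primeFactors]
  constructor
  · rintro ⟨⟨hp, hd, -⟩, h2⟩
    refine ⟨⟨hp, (hp.dvd_mul.1 hd).resolve_left fun h => ?_, hn⟩, h2⟩
    have := Nat.le_of_dvd two_pos h
    omega
  · rintro ⟨⟨hp, hd, -⟩, h2⟩
    exact ⟨⟨hp, hd.mul_left 2, by omega⟩, h2⟩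

theorem oddPrimeFactors_one : oddPrimeFactors 1 = ∅ := by
  simp [oddPrimeFactors]

theorem Gtilde_one (h t : ℕ) : Gtilde h 1 t = 1 - f h t 2 := by
  simp [Gtilde, oddPrimeFactors_one]

theorem oddPrimeFactors_two : oddPrimeFactors 2 = ∅ :=
  (oddPrimeFactors_two_mul one_ne_zero).trans oddPrimeFactors_one

theorem Gtilde_two (h t : ℕ) : Gtilde h 2 t = - f h t 2 := by
  rw [Gtilde, ArithmeticFunction.moebius_apply_prime Nat.prime_two,
    oddPrimeFactors_two]
  simp

theorem Gtilde_prime {p : ℕ} (hp : p.Prime) (h2 : 2 < p) (h t : ℕ) :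
    Gtilde h p t = (1 - 1 / f h t p)⁻¹ * (1 - f h t 2) := by
  have h3 : ¬ 2 ∣ p := fun hd => by
    have := (Nat.prime_dvd_prime_iff_eq Nat.prime_two hp).1 hd
    omega
  rw [Gtilde, ArithmeticFunction.moebius_apply_prime hp, oddPrimeFactors_prime hp h2]
  simp [h3]

theorem Gtilde_two_mul_prime {p : ℕ} (hp : p.Prime) (h2 : 2 < p) (h t : ℕ) :
    Gtilde h (2 * p) t = (1 - 1 / f h t p)⁻¹ * (- f h t 2) := by
  have h3 : Nat.Coprime 2 p := (Nat.coprime_primes Nat.prime_two hp).2 (by omega)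
  rw [Gtilde, ArithmeticFunction.isMultiplicative_moebius.map_mul_of_coprime h3,
    ArithmeticFunction.moebius_apply_prime hp, ArithmeticFunction.moebius_apply_prime Nat.prime_two,
    oddPrimeFactors_two_mul hp.ne_zero, oddPrimeFactors_prime hp h2]
  simp

theorem Gtilde_eq_zero_of_four_dvd {m : ℕ} (hm : 4 ∣ m) (h t : ℕ) : Gtilde h m t = 0 := by
  have : ¬ Squarefree m := fun hs => by
    have := hs 2 hm
    simp at this
  simp [Gtilde, ArithmeticFunction.moebius_eq_zero_of_not_squarefree this]

theorem B_four : B 4 = 2 := by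
  rw [B, show 4 = 2 * 2 by norm_num, oddPrimeFactors_two_mul (by norm_num), oddPrimeFactors_two]
  simp

theorem B_six : B 6 = 6 / 5 := by
  rw [B, show 6 = 2 * 3 by norm_num, oddPrimeFactors_two_mul (by norm_num),
    oddPrimeFactors_prime Nat.prime_three (by norm_num)]
  norm_num

theorem gcd_eq_gcd_mod {m M : ℕ} (h : m ∣ M) (t : ℕ) : Nat.gcd m t = Nat.gcd m (t % M) := by
  rw [Nat.gcd_comm, Nat.gcd_comm m]
  exact ((Nat.mod_modEq t M).of_dvd h).gcd_eq.symm

theorem f_four_two {t : ℕ} (ht : 0 < t) :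
    f 4 t 2 = if t % 2 = 1 then 1 else if t % 4 = 2 then 1 / 2 else 1 / 4 := by
  by_cases h2 : 2 ∣ t
  · rw [f_prime_of_dvd Nat.prime_two ht h2, Nat.gcd_comm _ 4, Nat.gcd_comm _ 4,
      gcd_eq_gcd_mod dvd_rfl, gcd_eq_gcd_mod dvd_rfl t, if_neg (by omega)]
    have : 2 * t % 4 = 0 := by omega
    rw [this]
    split_ifs with h
    · rw [h]; norm_num
    · rw [show t % 4 = 0 by omega]; norm_num
  · rw [f_prime_of_not_dvd Nat.prime_two ht h2, if_pos (by omega)]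
    norm_num

theorem f_six_two {t : ℕ} (ht : 0 < t) :
    f 6 t 2 = if t % 2 = 1 then 1 else 1 / 4 := by
  by_cases h2 : 2 ∣ t
  · rw [f_prime_of_dvd Nat.prime_two ht h2, Nat.gcd_comm _ 6, Nat.gcd_comm _ 6,
      gcd_eq_gcd_mod dvd_rfl, gcd_eq_gcd_mod dvd_rfl t, if_neg (by omega)]
    have h6 : t % 6 = 0 ∨ t % 6 = 2 ∨ t % 6 = 4 := by omega
    rcases h6 with h | h | h
    · rw [h, show 2 * t % 6 = 0 by omega]; norm_num
    · rw [h, show 2 * t % 6 = 4 by omega]; norm_num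
    · rw [h, show 2 * t % 6 = 2 by omega]; norm_num
  · rw [f_prime_of_not_dvd Nat.prime_two ht h2, if_pos (by omega)]
    norm_num

theorem f_prime_of_coprime {p h t : ℕ} (hp : p.Prime) (ht : 0 < t) (hph : p.Coprime h) :
    f h t p = if t % p = 0 then 1 / (p : ℚ) ^ 2 else 1 / ((p : ℚ) * (p - 1)) := by
  split_ifs with hd
  · have hg : (Nat.gcd t h : ℚ) ≠ 0 := by exact_mod_cast (Nat.gcd_pos_of_pos_left h ht).ne'
    rw [f_prime_of_dvd hp ht (Nat.dvd_of_mod_eq_zero hd), hph.gcd_mul_left_cancel, mul_comm,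
      div_mul_cancel_left₀ hg, one_div]
  · rw [f_prime_of_not_dvd hp ht fun h => hd (Nat.mod_eq_zero_of_dvd h), hph, Nat.cast_one]

theorem f_six_three {t : ℕ} (ht : 0 < t) :
    f 6 t 3 = if t % 3 = 0 then 1 / 9 else 1 / 2 := by
  by_cases h3 : 3 ∣ t
  · rw [f_prime_of_dvd Nat.prime_three ht h3, Nat.gcd_comm _ 6, Nat.gcd_comm _ 6,
      gcd_eq_gcd_mod dvd_rfl, gcd_eq_gcd_mod dvd_rfl t, if_pos (by omega)]
    have h6 : t % 6 = 0 ∨ t % 6 = 3 := by omega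
    rcases h6 with h | h
    · rw [h, show 3 * t % 6 = 0 by omega]; norm_num
    · rw [h, show 3 * t % 6 = 3 by omega]; norm_num
  · rw [f_prime_of_not_dvd Nat.prime_three ht h3, if_neg (by omega)]
    norm_num

theorem f_four_three {t : ℕ} (ht : 0 < t) :
    f 4 t 3 = if t % 3 = 0 then 1 / 9 else 1 / 6 := by
  rw [f_prime_of_coprime Nat.prime_three ht (by norm_num)]
  norm_num

theorem f_four_five {t : ℕ} (ht : 0 < t) :
    f 4 t 5 = if t % 5 = 0 then 1 / 25 else 1 / 20 := by
  rw [f_prime_of_coprime Nat.prime_five ht (by norm_num)]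
  norm_num

theorem Gtilde_three (h t : ℕ) :
    Gtilde h 3 t = (1 - 1 / f h t 3)⁻¹ * (1 - f h t 2) :=
  Gtilde_prime Nat.prime_three (by norm_num) h t

theorem Gtilde_five (h t : ℕ) :
    Gtilde h 5 t = (1 - 1 / f h t 5)⁻¹ * (1 - f h t 2) :=
  Gtilde_prime Nat.prime_five (by norm_num) h t

theorem Gtilde_six (h t : ℕ) : Gtilde h 6 t = (1 - 1 / f h t 3)⁻¹ * (- f h t 2) :=
  Gtilde_two_mul_prime Nat.prime_three (by norm_num) h t

theorem Gtilde_ten (h t : ℕ) : Gtilde h 10 t = (1 - 1 / f h t 5)⁻¹ * (- f h t 2) :=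
  Gtilde_two_mul_prime Nat.prime_five (by norm_num) h t

theorem Gtilde_four_mul (h t k : ℕ) : Gtilde h (4 * k) t = 0 :=
  Gtilde_eq_zero_of_four_dvd (Dvd.intro k rfl) h t

/-- The coefficients and moduli in the density formula for the Fibonacci numbers. -/
def coeffFib : Fin 4 → ℚ := ![1, -1 / 2, -1 / 4, 1 / 4]

/-- See `coeffFib`. -/
def modFib : Fin 4 → ℕ := ![1, 2, 4, 20]

/-- The coefficients and moduli in the density formula for the coefficients `(4, -1)`. -/
def coeffFour : Fin 3 → ℚ := ![1, -1 / 2, 1 / 2]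

/-- See `coeffFour`. -/
def modFour : Fin 3 → ℕ := ![1, 4, 24]

/-- The coefficients and moduli in the density formula for the coefficients `(10, 2)`. -/
def coeffTen : Fin 3 → ℚ := ![1, -1 / 2, 1 / 2]

/-- See `coeffTen`. -/
def modTen : Fin 3 → ℕ := ![1, 2, 24]

theorem sum_Ghm_fib {t : ℕ} (ht : 0 < t) :
    B 4 * ∑ i, coeffFib i * Ghm 4 (modFib i) t =
      if t % 2 = 1 then 1 else if t % 20 = 0 then 3 / 4 else if t % 20 = 10 then 1 / 2
        else if t % 4 = 2 then 29 / 38 else 27 / 76 := by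
  have h1 := gcd_eq_gcd_mod (show 1 ∣ 20 by norm_num) t
  have h2 := gcd_eq_gcd_mod (show 2 ∣ 20 by norm_num) t
  have h4 := gcd_eq_gcd_mod (show 4 ∣ 20 by norm_num) t
  have h20 := gcd_eq_gcd_mod (show 20 ∣ 20 by norm_num) t
  simp only [Fin.sum_univ_four, coeffFib, modFib, B_four, Ghm, Matrix.cons_val, h1, h2, h4, h20]
  have e2 : t % 2 = t % 20 % 2 := by omega
  have e4 : t % 4 = t % 20 % 4 := by omega
  have e5 : t % 5 = t % 20 % 5 := by omega
  have f2 := f_four_two ht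
  have f5 := f_four_five ht
  -- The moduli still divisible by `4` after removing the gcd with `t` are not squarefree and
  -- contribute nothing.
  have g4 := Gtilde_four_mul 4 t 1
  have g20 := Gtilde_four_mul 4 t 5
  rw [e2, e4] at f2
  rw [e5] at f5
  rw [e2, e4]
  have hlt : t % 20 < 20 := Nat.mod_lt _ (by norm_num)
  -- All gcds and local factors now depend only on `t` modulo `20`, which leaves a finite check.
  generalize t % 20 = r at *
  interval_cases r <;> norm_num at f2 f5 g4 g20 ⊢ <;>
    norm_num [Gtilde_one, Gtilde_two, Gtilde_five, Gtilde_ten, f2, f5, g4, g20]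

theorem sum_Ghm_four {t : ℕ} (ht : 0 < t) :
    B 4 * ∑ i, coeffFour i * Ghm 4 (modFour i) t =
      if t % 2 = 1 then 0 else if t % 24 = 0 ∨ t % 4 = 2 then 3 / 2 else if t % 24 = 12 then 1 / 2
        else if t % 8 = 4 then 4 / 5 else 3 / 5 := by
  have h1 := gcd_eq_gcd_mod (show 1 ∣ 24 by norm_num) t
  have h4 := gcd_eq_gcd_mod (show 4 ∣ 24 by norm_num) t
  have h24 := gcd_eq_gcd_mod (show 24 ∣ 24 by norm_num) t
  simp only [Fin.sum_univ_three, coeffFour, modFour, B_four, Ghm, Matrix.cons_val, h1, h4, h24]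
  have e2 : t % 2 = t % 24 % 2 := by omega
  have e4 : t % 4 = t % 24 % 4 := by omega
  have e8 : t % 8 = t % 24 % 8 := by omega
  have e3 : t % 3 = t % 24 % 3 := by omega
  have f2 := f_four_two ht
  have f3 := f_four_three ht
  have g4 := Gtilde_four_mul 4 t 1
  have g8 := Gtilde_four_mul 4 t 2
  have g12 := Gtilde_four_mul 4 t 3
  have g24 := Gtilde_four_mul 4 t 6
  rw [e2, e4] at f2
  rw [e3] at f3
  rw [e2, e4, e8]
  have hlt : t % 24 < 24 := Nat.mod_lt _ (by norm_num)
  generalize t % 24 = r at *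
  interval_cases r <;> norm_num at f2 f3 g4 g8 g12 g24 ⊢ <;>
    norm_num [Gtilde_one, Gtilde_two, Gtilde_three, Gtilde_six, f2, f3, g4, g8, g12, g24]

theorem sum_Ghm_ten {t : ℕ} (ht : 0 < t) :
    B 6 * ∑ i, coeffTen i * Ghm 6 (modTen i) t =
      if t % 24 = 0 then 9 / 10 else if t % 4 = 2 then 9 / 20 else if t % 24 = 12 then 3 / 10
        else if t % 8 = 0 then 0 else 3 / 5 := by
  have h1 := gcd_eq_gcd_mod (show 1 ∣ 24 by norm_num) t
  have h2 := gcd_eq_gcd_mod (show 2 ∣ 24 by norm_num) t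
  have h24 := gcd_eq_gcd_mod (show 24 ∣ 24 by norm_num) t
  simp only [Fin.sum_univ_three, coeffTen, modTen, B_six, Ghm, Matrix.cons_val, h1, h2, h24]
  have e2 : t % 2 = t % 24 % 2 := by omega
  have e4 : t % 4 = t % 24 % 4 := by omega
  have e8 : t % 8 = t % 24 % 8 := by omega
  have e3 : t % 3 = t % 24 % 3 := by omega
  have f2 := f_six_two ht
  have f3 := f_six_three ht
  have g4 := Gtilde_four_mul 6 t 1
  have g8 := Gtilde_four_mul 6 t 2
  have g12 := Gtilde_four_mul 6 t 3
  have g24 := Gtilde_four_mul 6 t 6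
  rw [e2] at f2
  rw [e3] at f3
  rw [e4, e8]
  have hlt : t % 24 < 24 := Nat.mod_lt _ (by norm_num)
  generalize t % 24 = r at *
  interval_cases r <;> norm_num at f2 f3 g4 g8 g12 g24 ⊢ <;>
    norm_num [Gtilde_one, Gtilde_two, Gtilde_three, Gtilde_six, f2, f3, g4, g8, g12, g24]

/-! ### Perfect powers in real quadratic fields -/

open IntermediateField

theorem mem_adjoin_sqrt {E : Type*} [Field E] [Algebra ℚ E] {s : E} {c : ℚ}
    (hs : s ^ 2 = algebraMap ℚ E c) {x : E} (hx : x ∈ adjoin ℚ {s}) :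
    ∃ a b : ℚ, x = algebraMap ℚ E a + algebraMap ℚ E b * s := by
  have hint : IsIntegral ℚ s := ⟨Polynomial.X ^ 2 - Polynomial.C c,
    Polynomial.monic_X_pow_sub_C _ two_ne_zero, by simp [hs]⟩
  have hx' : x ∈ (adjoin ℚ {s}).toSubalgebra := hx
  rw [adjoin_simple_toSubalgebra_of_isAlgebraic hint.isAlgebraic] at hx'
  induction hx' using Algebra.adjoin_induction with
  | mem y hy => exact ⟨0, 1, by simpa using hy⟩
  | algebraMap r => exact ⟨r, 0, by simp⟩
  | add y z _ _ hy hz =>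
    obtain ⟨a, b, rfl⟩ := hy (by rw [← mem_toSubalgebra,
      adjoin_simple_toSubalgebra_of_isAlgebraic hint.isAlgebraic]; assumption)
    obtain ⟨a', b', rfl⟩ := hz (by rw [← mem_toSubalgebra,
      adjoin_simple_toSubalgebra_of_isAlgebraic hint.isAlgebraic]; assumption)
    exact ⟨a + a', b + b', by simp only [map_add]; ring⟩
  | mul y z _ _ hy hz =>
    obtain ⟨a, b, rfl⟩ := hy (by rw [← mem_toSubalgebra,
      adjoin_simple_toSubalgebra_of_isAlgebraic hint.isAlgebraic]; assumption)
    obtain ⟨a', b', rfl⟩ := hz (by rw [← mem_toSubalgebra,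
      adjoin_simple_toSubalgebra_of_isAlgebraic hint.isAlgebraic]; assumption)
    refine ⟨a * a' + b * b' * c, a * b' + a' * b, ?_⟩
    simp only [map_add, map_mul, ← hs]
    ring

/-- Positive reals have unique roots, so the gcd of the exponents can be cancelled. With coprime
exponents `d'` and `m'`, Bézout exhibits `g` as a `d'`-th power in `S`, which forces `d' = 1`. -/
theorem dvd_of_pow_eq_pow {S : IntermediateField ℚ ℝ} {g x : ℝ} (hgS : g ∈ S) (hxS : x ∈ S)
    (hg : 0 < g) (hx : 0 < x) (hnp : ∀ v ∈ S, ∀ k : ℕ, 2 ≤ k → v ^ k ≠ g) {d m : ℕ} (hd : 0 < d)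
    (h : x ^ d = g ^ m) : d ∣ m := by
  have he : 0 < Nat.gcd d m := Nat.gcd_pos_of_pos_left m hd
  obtain ⟨d', hd'⟩ := Nat.gcd_dvd_left d m
  obtain ⟨m', hm'⟩ := Nat.gcd_dvd_right d m
  have h1 : x ^ d' = g ^ m' := by
    have h : (x ^ d') ^ Nat.gcd d m = (g ^ m') ^ Nat.gcd d m := by
      rw [← pow_mul, ← pow_mul, mul_comm d', mul_comm m', ← hd', ← hm', h]
    exact (pow_left_inj₀ (by positivity) (by positivity) he.ne').1 h
  have hcop : Nat.gcd d' m' = 1 := by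
    refine Nat.eq_of_mul_eq_mul_left he ?_
    rw [← Nat.gcd_mul_left, ← hd', ← hm', mul_one]
  have hbez := Nat.gcd_eq_gcd_ab d' m'
  rw [hcop] at hbez
  set a := Nat.gcdA d' m'
  set b := Nat.gcdB d' m'
  have hv : (g ^ a * x ^ b) ^ d' = g := by
    calc (g ^ a * x ^ b) ^ d' = g ^ (a * d') * (x ^ d') ^ b := by
          rw [mul_pow, ← zpow_natCast, ← zpow_natCast, ← zpow_natCast, ← zpow_mul, ← zpow_mul,
            ← zpow_mul, mul_comm b]
      _ = g ^ ((d' : ℤ) * a + m' * b) := by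
          rw [h1, ← zpow_natCast, ← zpow_mul, ← zpow_add₀ hg.ne', mul_comm a]
      _ = g := by rw [← hbez]; simp
  have hvS : g ^ a * x ^ b ∈ S := S.mul_mem (zpow_mem hgS a) (zpow_mem hxS b)
  have hd1 : ¬ 2 ≤ d' := fun h2 => hnp _ hvS d' h2 hv
  have hd0 : d' ≠ 0 := by
    rintro rfl
    omega
  have : d' = 1 := by omega
  rw [this, mul_one] at hd'
  rw [hd']
  exact Nat.gcd_dvd_right d m

theorem irrational_eq {r : ℝ} (hr : Irrational r) {a b a' b' : ℚ}
    (h : (a : ℝ) + b * r = a' + b' * r) : a = a' ∧ b = b' := by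
  have hb : b = b' := by
    by_contra hne
    have h1 : ((b - b' : ℚ) : ℝ) ≠ 0 := by exact_mod_cast sub_ne_zero.2 hne
    refine hr ⟨(a' - a) / (b - b'), ?_⟩
    push_cast at h1 ⊢
    rw [div_eq_iff h1]
    linear_combination -h
  subst hb
  exact ⟨by exact_mod_cast add_right_cancel h, rfl⟩

theorem conj_pow {D : ℕ} (a b : ℚ) (k : ℕ) : ∃ A B : ℚ,
    ((a : ℝ) + b * √D) ^ k = A + B * √D ∧ ((a : ℝ) - b * √D) ^ k = A - B * √D := by
  have hD : √(D : ℝ) ^ 2 = D := Real.sq_sqrt (Nat.cast_nonneg D)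
  induction k with
  | zero => exact ⟨1, 0, by simp, by simp⟩
  | succ k ih =>
    obtain ⟨A, B, h1, h2⟩ := ih
    refine ⟨A * a + B * b * D, A * b + B * a, ?_, ?_⟩
    · rw [pow_succ, h1]
      push_cast
      linear_combination (B * b : ℝ) * hD
    · rw [pow_succ, h2]
      push_cast
      linear_combination (B * b : ℝ) * hD

/-- A unit of a real quadratic field that is a proper power up to sign has a root with integral
trace `T` and norm `N = ±1`, and `T ^ 2 - 2 * N` lies strictly above `2` and below the sum of the
unit and its inverse. -/
theorem exists_trace_norm_of_pow {D : ℕ} (hD : Irrational √(D : ℝ)) {A B : ℚ} {g : ℝ}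
    (hg : g = A + B * √D) (hg1 : 1 < g) (hgi : IsIntegral ℤ g)
    (hgi' : IsIntegral ℤ ((A : ℝ) - B * √D)) (hN : |A ^ 2 - D * B ^ 2| = 1)
    {a b : ℚ} {k : ℕ} (hk : 2 ≤ k)
    (h : ((a : ℝ) + b * √D) ^ k = g ∨ ((a : ℝ) + b * √D) ^ k = -g) :
    ∃ T N : ℤ, (N = 1 ∨ N = -1) ∧ (T : ℚ) ^ 2 - 4 * N = D * (2 * b) ^ 2 ∧
      2 < (T : ℝ) ^ 2 - 2 * N ∧ (T : ℝ) ^ 2 - 2 * N ≤ g + 1 / g := by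
  have hD2 : √(D : ℝ) ^ 2 = D := Real.sq_sqrt (Nat.cast_nonneg D)
  have hk0 : k ≠ 0 := by omega
  set x := (a : ℝ) + b * √D with hx
  set y := (a : ℝ) - b * √D with hy
  obtain ⟨A', B', h1, h2⟩ := conj_pow (D := D) a b k
  rw [← hx] at h1
  rw [← hy] at h2
  -- Irrationality of `√D` identifies the rational coordinates, so the equation for `x` implies the
  -- conjugate one for `y`.
  have hxy : (x ^ k = g ∧ y ^ k = A - B * √D) ∨ (x ^ k = -g ∧ y ^ k = -(A - B * √D)) := by
    rcases h with h | h
    · left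
      obtain ⟨rfl, rfl⟩ := irrational_eq hD (h1.symm.trans (h.trans hg))
      exact ⟨h, h2⟩
    · right
      have h3 : (A' : ℝ) + B' * √D = ((-A : ℚ) : ℝ) + ((-B : ℚ) : ℝ) * √D := by
        rw [← h1, h, hg]
        push_cast
        ring
      obtain ⟨rfl, rfl⟩ := irrational_eq hD h3
      refine ⟨h, h2.trans ?_⟩
      push_cast
      ring
  have hxi : IsIntegral ℤ x := by
    refine IsIntegral.of_pow (Nat.pos_of_ne_zero hk0) ?_
    rcases hxy with h | h
    · rwa [h.1]
    · rw [h.1]; exact hgi.neg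
  have hyi : IsIntegral ℤ y := by
    refine IsIntegral.of_pow (Nat.pos_of_ne_zero hk0) ?_
    rcases hxy with h | h
    · rwa [h.2]
    · rw [h.2]; exact hgi'.neg
  have hsum : x + y = algebraMap ℚ ℝ (2 * a) := by
    simp [hx, hy]
    ring
  obtain ⟨T, hT⟩ := IsIntegrallyClosed.isIntegral_iff.1
    ((isIntegral_algebraMap_iff (algebraMap ℚ ℝ).injective).1 (hsum ▸ hxi.add hyi))
  have hT' : (T : ℚ) = 2 * a := by simpa using hT
  have hprod : x * y = ((a ^ 2 - D * b ^ 2 : ℚ) : ℝ) := by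
    push_cast
    simp only [hx, hy]
    linear_combination -(b : ℝ) ^ 2 * hD2
  have hgg : g * (A - B * √D) = ((A ^ 2 - D * B ^ 2 : ℚ) : ℝ) := by
    push_cast
    rw [hg]
    linear_combination -(B : ℝ) ^ 2 * hD2
  have hpow : (x * y) ^ k = ((A ^ 2 - D * B ^ 2 : ℚ) : ℝ) := by
    rw [← hgg, mul_pow]
    rcases hxy with h | h
    · rw [h.1, h.2]
    · rw [h.1, h.2]; ring
  have habs : |x * y| = 1 := by
    have : |x * y| ^ k = 1 := by
      rw [← abs_pow, hpow]
      exact_mod_cast hN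
    exact (pow_eq_one_iff_of_nonneg (abs_nonneg _) hk0).1 this
  have hNq : (a ^ 2 - D * b ^ 2 = 1) ∨ (a ^ 2 - D * b ^ 2 = -1) := by
    rw [hprod] at habs
    have : |a ^ 2 - D * b ^ 2| = 1 := by exact_mod_cast habs
    exact eq_or_eq_neg_of_abs_eq this
  obtain ⟨N, hN1, hNa⟩ : ∃ N : ℤ, (N = 1 ∨ N = -1) ∧ (N : ℚ) = a ^ 2 - D * b ^ 2 := by
    rcases hNq with h | h
    · exact ⟨1, Or.inl rfl, by rw [h]; simp⟩
    · exact ⟨-1, Or.inr rfl, by rw [h]; simp⟩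
  have hxk : |x| ^ k = g := by
    rw [← abs_pow]
    rcases hxy with h | h
    · rw [h.1, abs_of_pos (by linarith)]
    · rw [h.1, abs_neg, abs_of_pos (by linarith)]
  have hx1 : 1 < |x| := by
    by_contra hle
    have := pow_le_one₀ (n := k) (abs_nonneg x) (not_lt.1 hle)
    linarith
  have hx2 : x ^ 2 ≤ g := by
    rw [← sq_abs, ← hxk]
    exact pow_le_pow_right₀ hx1.le hk
  have hx2' : 1 < x ^ 2 := by
    rw [← sq_abs]
    nlinarith
  have hy2 : y ^ 2 = 1 / x ^ 2 := by
    rw [eq_div_iff (by positivity), ← mul_pow, ← sq_abs, mul_comm y, habs, one_pow]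
  -- This is `(x + y)² - 2xy = x² + y²`, with `y² = 1/x²` because `xy = ±1`.
  have htr : (T : ℝ) ^ 2 - 2 * N = x ^ 2 + 1 / x ^ 2 := by
    rw [← hy2]
    have e1 : (T : ℝ) = 2 * a := by exact_mod_cast hT'
    have e2 : (N : ℝ) = a ^ 2 - D * b ^ 2 := by exact_mod_cast hNa
    rw [e1, e2]
    simp only [hx, hy]
    linear_combination -2 * (b : ℝ) ^ 2 * hD2
  refine ⟨T, N, hN1, ?_, ?_, ?_⟩
  · rw [hT', hNa]
    ring
  · rw [htr]
    generalize x ^ 2 = z at *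
    have hz : 0 < z := by linarith
    rw [← sub_pos, show z + 1 / z - 2 = (z - 1) ^ 2 / z by field_simp; ring]
    have : 0 < z - 1 := by linarith
    positivity
  · rw [htr]
    generalize x ^ 2 = z at *
    have hz : 0 < z := by linarith
    have hg0 : 0 < g := by linarith
    -- `z ↦ z + 1/z` increases beyond `1`, and `1 < z = x² ≤ |x|^k = g`.
    rw [← sub_nonneg, show g + 1 / g - (z + 1 / z) = (g - z) * (g * z - 1) / (g * z) by
      field_simp; ring]
    have h1 : 0 ≤ g - z := by linarith
    have h2 : 0 ≤ g * z - 1 := by nlinarith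
    positivity

theorem irrational_sqrt_five : Irrational √((5 : ℕ) : ℝ) :=
  Nat.Prime.irrational_sqrt Nat.prime_five

theorem irrational_sqrt_three : Irrational √((3 : ℕ) : ℝ) :=
  Nat.Prime.irrational_sqrt Nat.prime_three

/-- The golden ratio, as an element of `ℚ(√5)`. -/
noncomputable def unitFive : ℝ := (1 + √((5 : ℕ) : ℝ)) / 2

/-- The fundamental unit `2 + √3` of `ℚ(√3)`. -/
noncomputable def unitThree : ℝ := 2 + √((3 : ℕ) : ℝ)

theorem sq_sqrt_five : √((5 : ℕ) : ℝ) ^ 2 = 5 := by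
  rw [Real.sq_sqrt (Nat.cast_nonneg 5)]; norm_num

theorem sq_sqrt_three : √((3 : ℕ) : ℝ) ^ 2 = 3 := by
  rw [Real.sq_sqrt (Nat.cast_nonneg 3)]; norm_num

theorem one_lt_unitFive : 1 < unitFive := by
  have h : 1 < √((5 : ℕ) : ℝ) := Real.lt_sqrt_of_sq_lt (by norm_num)
  rw [unitFive]
  generalize √((5 : ℕ) : ℝ) = s at *
  linarith

theorem one_lt_unitThree : 1 < unitThree := by
  have := Real.sqrt_nonneg ((3 : ℕ) : ℝ)
  rw [unitThree]
  linarith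

theorem unitFive_not_pow {v : ℝ} (hv : v ∈ adjoin ℚ {√((5 : ℕ) : ℝ)}) {k : ℕ} (hk : 2 ≤ k) :
    v ^ k ≠ unitFive ∧ v ^ k ≠ -unitFive := by
  obtain ⟨a, b, rfl⟩ := mem_adjoin_sqrt (c := 5) (by simp) hv
  rw [← not_or]
  intro h
  have hs := sq_sqrt_five
  have hpoly : ∀ x : ℝ, x ^ 2 = x + 1 → IsIntegral ℤ x := fun x hx =>
    ⟨Polynomial.X ^ 2 - Polynomial.X - 1, by monicity!, by simp [hx]⟩
  obtain ⟨T, N, hN, -, h1, h2⟩ := exists_trace_norm_of_pow (A := 1 / 2) (B := 1 / 2)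
    irrational_sqrt_five (by rw [unitFive]; push_cast; ring) one_lt_unitFive
    (hpoly _ (by rw [unitFive]; linear_combination hs / 4))
    (hpoly _ (by push_cast; linear_combination hs / 4)) (by norm_num [abs_div]) hk h
  -- The sum equals `√5`, and no integer lies strictly above `2` and at most `√5`.
  have h3 : unitFive + 1 / unitFive < 3 := by
    have h5 : √((5 : ℕ) : ℝ) < 3 := by
      rw [Real.sqrt_lt' (by norm_num)]
      norm_num
    have h6 : 1 / unitFive = unitFive - 1 := by
      have := one_lt_unitFive
      rw [div_eq_iff (by linarith), unitFive]
      linear_combination -hs / 4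
    rw [h6, unitFive]
    generalize √((5 : ℕ) : ℝ) = s at h5 ⊢
    linarith
  have h4 : 2 < T ^ 2 - 2 * N := by exact_mod_cast h1
  have h5 : T ^ 2 - 2 * N < 3 := by exact_mod_cast h2.trans_lt h3
  omega

theorem unitThree_not_pow {v : ℝ} (hv : v ∈ adjoin ℚ {√((3 : ℕ) : ℝ)}) {k : ℕ} (hk : 2 ≤ k) :
    v ^ k ≠ unitThree ∧ v ^ k ≠ -unitThree := by
  obtain ⟨a, b, rfl⟩ := mem_adjoin_sqrt (c := 3) (by simp) hv
  rw [← not_or]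
  intro h
  have hs := sq_sqrt_three
  have hpoly : ∀ x : ℝ, x ^ 2 = 4 * x - 1 → IsIntegral ℤ x := fun x hx =>
    ⟨Polynomial.X ^ 2 - 4 * Polynomial.X + 1, by monicity!, by simp [hx]⟩
  obtain ⟨T, N, hN, h0, h1, h2⟩ := exists_trace_norm_of_pow (A := 2) (B := 1)
    irrational_sqrt_three (by rw [unitThree]; push_cast; ring) one_lt_unitThree
    (hpoly _ (by rw [unitThree]; linear_combination hs))
    (hpoly _ (by push_cast; linear_combination hs)) (by norm_num) hk h
  have h3 : unitThree + 1 / unitThree = 4 := by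
    have h6 : 1 / unitThree = 4 - unitThree := by
      have := one_lt_unitThree
      rw [div_eq_iff (by linarith), unitThree]
      linear_combination hs
    rw [h6]
    ring
  rw [h3] at h2
  have h4 : 2 < T ^ 2 - 2 * N := by exact_mod_cast h1
  have h5 : T ^ 2 - 2 * N ≤ 4 := by exact_mod_cast h2
  have hT1 : T ≤ 2 := by rcases hN with rfl | rfl <;> nlinarith
  have hT2 : -2 ≤ T := by rcases hN with rfl | rfl <;> nlinarith
  -- Here `T² - 2N` is `3` or `4`, which leaves only `N = -1`, `T = ±1`. Then `T² - 4N = 5 = 12 b²`,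
  -- so `15` would be a rational square.
  have hb : (6 * b) ^ 2 = 15 := by
    rcases hN with rfl | rfl <;> interval_cases T <;>
      first | omega | (norm_num at h0; linarith)
  have hirr : Irrational √((15 : ℕ) : ℝ) := by
    rw [irrational_sqrt_natCast_iff]
    rintro ⟨r, hr⟩
    have : r ≤ 3 := by nlinarith
    interval_cases r <;> omega
  refine hirr ⟨|6 * b|, ?_⟩
  have : ((6 * b : ℚ) : ℝ) ^ 2 = ((15 : ℕ) : ℝ) := by exact_mod_cast hb
  rw [← this, Real.sqrt_sq_eq_abs, Rat.cast_abs]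

/-! ### Kummer theory and inverting automorphisms -/

open Polynomial

theorem minpoly_eq_cyclotomic {Ω : Type*} [Field Ω] [Algebra ℚ Ω] {n : ℕ} (hn : 0 < n) {ζ : Ω}
    (hζ : IsPrimitiveRoot ζ n) : minpoly ℚ ζ = cyclotomic n ℚ := by
  have : CharZero Ω := algebraRat.charZero Ω
  obtain rfl : ‹Algebra ℚ Ω› = DivisionRing.toRatAlgebra := Subsingleton.elim _ _
  exact (cyclotomic_eq_minpoly_rat hζ hn).symm

theorem exists_isPrimitiveRoot {Ω : Type*} [Field Ω] [Algebra ℚ Ω] [IsAlgClosed Ω] {m : ℕ}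
    (hm : 0 < m) : ∃ η : Ω, IsPrimitiveRoot η m := by
  have : CharZero Ω := algebraRat.charZero Ω
  have : NeZero m := ⟨hm.ne'⟩
  have : NeZero (m : Ω) := ⟨by exact_mod_cast hm.ne'⟩
  exact HasEnoughRootsOfUnity.exists_primitiveRoot Ω m

theorem algEquiv_eq_of_mem_adjoin {F Ω : Type*} [Field F] [Field Ω] [Algebra F Ω]
    {S : Set Ω} {σ τ : Ω ≃ₐ[F] Ω} (h : ∀ x ∈ S, σ x = τ x) {y : Ω}
    (hy : y ∈ adjoin F S) : σ y = τ y := by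
  induction hy using adjoin_induction with
  | mem x hx => exact h x hx
  | algebraMap r => simp
  | add x y _ _ hx hy => rw [map_add, map_add, hx, hy]
  | inv x _ hx => rw [map_inv₀, map_inv₀, hx]
  | mul x y _ _ hx hy => rw [map_mul, map_mul, hx, hy]

/-- A root of unity of order dividing `n` times `y` is the only way to solve `x ^ d = y ^ d`. -/
theorem exists_pow_mul_of_pow_eq {Ω : Type*} [Field Ω] {n d : ℕ} (hn : 0 < n) {ζ x y : Ω} (hζ : IsPrimitiveRoot ζ n)
    (hd : d ∣ n) (hy : y ≠ 0) (h : x ^ d = y ^ d) : ∃ j : ℕ, x = ζ ^ j * y := by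
  have : NeZero n := ⟨hn.ne'⟩
  have h1 : (x / y) ^ n = 1 := by
    obtain ⟨k, rfl⟩ := hd
    rw [pow_mul, div_pow, h, div_self (pow_ne_zero _ hy), one_pow]
  obtain ⟨j, -, hj⟩ := hζ.eq_pow_of_pow_eq_one h1
  exact ⟨j, by rw [hj, div_mul_cancel₀ _ hy]⟩

theorem finrank_adjoin_insert {Ω : Type*} [Field Ω] [Algebra ℚ Ω] [Algebra.IsAlgebraic ℚ Ω] (S : Set Ω) (x : Ω) :
    Module.finrank ℚ (adjoin ℚ (S ∪ {x})) =
      Module.finrank ℚ (adjoin ℚ S) * (minpoly (adjoin ℚ S) x).natDegree := by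
  have hint : IsIntegral (adjoin ℚ S) x := Algebra.IsIntegral.isIntegral x
  rw [← adjoin_adjoin_left, ← adjoin.finrank hint]
  exact (Module.finrank_mul_finrank ℚ (adjoin ℚ S) (adjoin (adjoin ℚ S) {x})).symm

theorem finrank_adjoin_zeta {Ω : Type*} [Field Ω] [Algebra ℚ Ω] [Algebra.IsAlgebraic ℚ Ω] {n : ℕ} (hn : 0 < n) {ζ : Ω} (hζ : IsPrimitiveRoot ζ n) :
    Module.finrank ℚ (adjoin ℚ {ζ}) = n.totient := by
  have : CharZero Ω := algebraRat.charZero Ω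
  have hint : IsIntegral ℚ ζ := Algebra.IsIntegral.isIntegral ζ
  rw [adjoin.finrank hint, minpoly_eq_cyclotomic hn hζ, natDegree_cyclotomic]

/-- The Kummer exponent: if `d` is the largest divisor of `n` such that `γ` is a `d`-th power in
`L`, then `n / d` is the least exponent that moves an `n`-th root of `γ` into `L`. -/
theorem pow_mem_and_le_of_isGreatest {Ω : Type*} [Field Ω] [Algebra ℚ Ω] {L : IntermediateField ℚ Ω} {n d : ℕ} (hn : 0 < n)
    {ζ ρ γ y : Ω} (hζ : IsPrimitiveRoot ζ n) (hζL : ζ ∈ L) (hγ : γ ≠ 0) (hρ : ρ ^ n = γ)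
    (hdn : d ∣ n) (hy : y ∈ L) (hyd : y ^ d = γ)
    (hmax : ∀ d', d' ∣ n → ∀ z ∈ L, z ^ d' = γ → d' ≤ d) :
    ρ ^ (n / d) ∈ L ∧ ∀ k, 0 < k → ρ ^ k ∈ L → n / d ≤ k := by
  have hd0 : 0 < d := Nat.pos_of_dvd_of_pos hdn hn
  have hy0 : y ≠ 0 := by
    rintro rfl
    rw [zero_pow hd0.ne'] at hyd
    exact hγ hyd.symm
  have hρ0 : ρ ≠ 0 := by
    rintro rfl
    rw [zero_pow hn.ne'] at hρ
    exact hγ hρ.symm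
  have hγL : γ ∈ L := hyd ▸ pow_mem hy d
  constructor
  · obtain ⟨j, hj⟩ := exists_pow_mul_of_pow_eq (x := ρ ^ (n / d)) hn hζ hdn hy0 (by
      rw [← pow_mul, Nat.div_mul_cancel hdn, hρ, hyd])
    rw [hj]
    exact mul_mem (pow_mem hζL j) hy
  · intro k hk hkL
    -- Both `ρ ^ k` and `ρ ^ n = γ` lie in `L`. The element `ρ ^ gcd(k,n)` is then an `n /
    -- gcd(k,n)`-th root of `γ` in `L`, and maximality of `d` applies.
    have hg : ρ ^ Nat.gcd k n ∈ L := by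
      have hbez := Nat.gcd_eq_gcd_ab k n
      have : ρ ^ Nat.gcd k n = (ρ ^ k) ^ Nat.gcdA k n * (ρ ^ n) ^ Nat.gcdB k n := by
        rw [← zpow_natCast, hbez, zpow_add₀ hρ0, zpow_mul, zpow_mul, zpow_natCast, zpow_natCast]
      rw [this, hρ]
      exact mul_mem (zpow_mem hkL _) (zpow_mem hγL _)
    have hgn := Nat.gcd_dvd_right k n
    have h1 := hmax (n / Nat.gcd k n) (Nat.div_dvd_of_dvd hgn) _ hg (by
      rw [← pow_mul, Nat.mul_div_cancel' hgn, hρ])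
    have h2 : Nat.gcd k n ≤ k := Nat.le_of_dvd hk (Nat.gcd_dvd_left k n)
    have h3 : n = n / Nat.gcd k n * Nat.gcd k n := (Nat.div_mul_cancel hgn).symm
    refine Nat.div_le_of_le_mul ?_
    calc n = n / Nat.gcd k n * Nat.gcd k n := h3
      _ ≤ d * k := Nat.mul_le_mul h1 h2

section Galois

variable {Ω : Type*} [Field Ω] [Algebra ℚ Ω] [IsAlgClosed Ω] [Algebra.IsAlgebraic ℚ Ω]

theorem normal_of_isAlgClosed (F : IntermediateField ℚ Ω) : Normal F Ω :=
  have : IsAlgClosure F Ω := ⟨inferInstance, inferInstance⟩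
  IsAlgClosure.normal F Ω

theorem exists_algEquiv_of_isConjRoot (F : IntermediateField ℚ Ω) {x y : Ω}
    (h : IsConjRoot F x y) : ∃ σ : Ω ≃ₐ[ℚ] Ω, (∀ z ∈ F, σ z = z) ∧ σ x = y := by
  have := normal_of_isAlgClosed F
  obtain ⟨σ, hσ⟩ := h.symm.exists_algEquiv
  exact ⟨σ.restrictScalars ℚ, fun z hz => σ.commutes ⟨z, hz⟩, hσ⟩

theorem exists_algEquiv_ne (F : IntermediateField ℚ Ω) {x : Ω} (hx : x ∉ F) :
    ∃ σ : Ω ≃ₐ[ℚ] Ω, (∀ z ∈ F, σ z = z) ∧ σ x ≠ x := by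
  have hn := normal_of_isAlgClosed F
  have : CharZero F := algebraRat.charZero F
  have hs : IsSeparable F x := Algebra.IsSeparable.isSeparable F x
  have hx' : x ∉ (⊥ : Subalgebra F Ω) := by
    rintro ⟨z, rfl⟩
    exact hx z.2
  obtain ⟨y, hy, hc⟩ := (notMem_iff_exists_ne_and_isConjRoot hs (hn.splits x)).1 hx'
  obtain ⟨σ, h1, h2⟩ := exists_algEquiv_of_isConjRoot F hc
  exact ⟨σ, h1, fun h => hy (h.symm.trans h2)⟩

/-- Irreducibility of the cyclotomic polynomial over `ℚ` makes `η` and `η ^ a` conjugate. This is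
the source of all explicit automorphisms below. -/
theorem exists_algEquiv_rootsOfUnity {m a : ℕ} (hm : 0 < m) (ha : a.Coprime m) :
    ∃ σ : Ω ≃ₐ[ℚ] Ω, ∀ x : Ω, x ^ m = 1 → σ x = x ^ a := by
  have : CharZero Ω := algebraRat.charZero Ω
  have : NeZero m := ⟨hm.ne'⟩
  have : NeZero (m : Ω) := ⟨by exact_mod_cast hm.ne'⟩
  obtain ⟨η, hη⟩ := HasEnoughRootsOfUnity.exists_primitiveRoot Ω m
  have hη' := hη.pow_of_coprime a ha
  have : IsAlgClosure ℚ Ω := ⟨inferInstance, inferInstance⟩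
  have : Normal ℚ Ω := IsAlgClosure.normal ℚ Ω
  have hc : IsConjRoot ℚ (η ^ a) η := by
    rw [isConjRoot_def, minpoly_eq_cyclotomic hm hη, minpoly_eq_cyclotomic hm hη']
  obtain ⟨σ, hσ⟩ := hc.exists_algEquiv
  refine ⟨σ, fun x hx => ?_⟩
  obtain ⟨j, -, rfl⟩ := hη.eq_pow_of_pow_eq_one hx
  rw [map_pow, hσ, ← pow_mul, ← pow_mul, mul_comm]

/-- Every conjugate of `ρ` over `F` is `ρ` times a root of unity in `F`. The constant coefficient of
the minimal polynomial is, up to sign, the product of the conjugates, hence an element of `F` times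
`ρ ^ deg`. -/
theorem pow_natDegree_minpoly_mem (F : IntermediateField ℚ Ω) {n : ℕ} (hn : 0 < n) {ζ ρ : Ω}
    (hζ : IsPrimitiveRoot ζ n) (hζF : ζ ∈ F) (hρ : ρ ≠ 0) (hρn : ρ ^ n ∈ F) :
    ρ ^ (minpoly F ρ).natDegree ∈ F := by
  have hint : IsIntegral F ρ := Algebra.IsIntegral.isIntegral ρ
  have hmon := minpoly.monic hint
  have hsp := (normal_of_isAlgClosed F).splits ρ
  have hdvd : minpoly F ρ ∣ X ^ n - C ⟨ρ ^ n, hρn⟩ := minpoly.dvd F ρ (by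
    simp only [map_sub, map_pow, aeval_X, aeval_C]
    exact sub_self _)
  have hroot : ∀ x ∈ ((minpoly F ρ).map (algebraMap F Ω)).roots, x / ρ ∈ F := by
    intro x hx
    have h1 : aeval x (minpoly F ρ) = 0 := by
      have := isRoot_of_mem_roots hx
      rwa [IsRoot.def, eval_map_algebraMap] at this
    have h2 : aeval x (X ^ n - C (⟨ρ ^ n, hρn⟩ : F)) = 0 := by
      obtain ⟨q, hq⟩ := hdvd
      rw [hq, map_mul, h1, zero_mul]
    simp only [map_sub, map_pow, aeval_X, aeval_C] at h2
    have h3 : x ^ n = ρ ^ n := sub_eq_zero.1 h2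
    have h4 : (x / ρ) ^ n = 1 := by
      rw [div_pow, h3, div_self (pow_ne_zero _ hρ)]
    have : NeZero n := ⟨hn.ne'⟩
    obtain ⟨j, -, hj⟩ := hζ.eq_pow_of_pow_eq_one h4
    rw [← hj]
    exact pow_mem hζF j
  have hms : ∀ s : Multiset Ω, (∀ x ∈ s, x / ρ ∈ F) → s.prod / ρ ^ Multiset.card s ∈ F := by
    intro s
    induction s using Multiset.induction with
    | empty => intro _; simp
    | cons x s ih =>
      intro h
      rw [Multiset.prod_cons, Multiset.card_cons, pow_succ', mul_div_mul_comm]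
      exact mul_mem (h x (Multiset.mem_cons_self x s))
        (ih fun y hy => h y (Multiset.mem_cons_of_mem hy))
  have h1 := hms _ hroot
  have hdeg : Multiset.card ((minpoly F ρ).map (algebraMap F Ω)).roots =
      (minpoly F ρ).natDegree := by
    rw [← hsp.natDegree_eq_card_roots, natDegree_map]
  have h2 := hsp.coeff_zero_eq_prod_roots_of_monic (hmon.map _)
  rw [hdeg] at h1
  have h3 : ((minpoly F ρ).map (algebraMap F Ω)).roots.prod ∈ F := by
    have h4 : ((minpoly F ρ).map (algebraMap F Ω)).coeff 0 ∈ F := by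
      rw [coeff_map]
      exact ((minpoly F ρ).coeff 0).2
    rw [h2] at h4
    rcases neg_one_pow_eq_or Ω ((minpoly F ρ).map (algebraMap F Ω)).natDegree with h | h <;>
      rw [h] at h4
    · simpa using h4
    · simpa using h4
  have h5 : ((minpoly F ρ).map (algebraMap F Ω)).roots.prod ≠ 0 := by
    intro h0
    rw [h0, mul_zero, coeff_map, map_eq_zero] at h2
    have := minpoly.coeff_zero_eq_zero hint
    exact hρ (this.1 h2)
  have h6 := div_mem h3 h1
  rwa [div_div_cancel₀ h5] at h6

theorem natDegree_minpoly_eq (F : IntermediateField ℚ Ω) {n e : ℕ} (hn : 0 < n) {ζ ρ : Ω}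
    (hζ : IsPrimitiveRoot ζ n) (hζF : ζ ∈ F) (hρ : ρ ≠ 0) (hρn : ρ ^ n ∈ F) (he0 : 0 < e)
    (he : ρ ^ e ∈ F) (hmin : ∀ k, 0 < k → ρ ^ k ∈ F → e ≤ k) :
    minpoly F ρ = X ^ e - C ⟨ρ ^ e, he⟩ := by
  have hint : IsIntegral F ρ := Algebra.IsIntegral.isIntegral ρ
  have hdvd : minpoly F ρ ∣ X ^ e - C ⟨ρ ^ e, he⟩ := minpoly.dvd F ρ (by
    simp only [map_sub, map_pow, aeval_X, aeval_C]
    exact sub_self _)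
  refine (eq_of_monic_of_dvd_of_natDegree_le (minpoly.monic hint)
    (monic_X_pow_sub_C _ he0.ne') hdvd ?_).symm
  rw [natDegree_X_pow_sub_C]
  exact hmin _ (minpoly.natDegree_pos hint) (pow_natDegree_minpoly_mem F hn hζ hζF hρ hρn)

theorem finrank_adjoin_sqrt_zeta {n : ℕ} (hn : 0 < n) {ζ s : Ω} (hζ : IsPrimitiveRoot ζ n)
    (hs0 : s ≠ 0) {D : ℚ} (hs : s ^ 2 = algebraMap ℚ Ω D) :
    (s ∈ adjoin ℚ {ζ} → Module.finrank ℚ (adjoin ℚ {s, ζ}) = n.totient) ∧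
    (s ∉ adjoin ℚ {ζ} → Module.finrank ℚ (adjoin ℚ {s, ζ}) = n.totient * 2) := by
  have hs2 : s ^ 2 ∈ adjoin ℚ {ζ} := hs ▸ IntermediateField.algebraMap_mem _ D
  have hset : ({s, ζ} : Set Ω) = {ζ} ∪ {s} := by rw [Set.union_singleton]
  have : CharZero Ω := algebraRat.charZero Ω
  have key : ∀ e, 0 < e → s ^ e ∈ adjoin ℚ {ζ} →
      (∀ k, 0 < k → s ^ k ∈ adjoin ℚ {ζ} → e ≤ k) →
      Module.finrank ℚ (adjoin ℚ {s, ζ}) = n.totient * e := by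
    intro e he0 he hmin
    rw [hset, finrank_adjoin_insert, finrank_adjoin_zeta hn hζ,
      -- Adjoining a square root is the Kummer case of exponent `2`, with `-1` as primitive root.
      natDegree_minpoly_eq _ two_pos (IsPrimitiveRoot.neg_one 0 two_ne_zero.symm)
        (neg_mem (one_mem _)) hs0 hs2 he0 he hmin, natDegree_X_pow_sub_C]
  constructor
  · intro h
    rw [key 1 one_pos (by simpa using h) (fun k hk _ => hk), mul_one]
  · intro h
    refine key 2 two_pos hs2 fun k hk hks => ?_
    by_contra hlt
    have : k = 1 := by omega
    subst this
    exact h (by simpa using hks)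

/-- Up to a power of `ζ`, `y` is `ρ ^ (n/d)`, so inverting `ρ` inverts `y`. Conversely, an
automorphism inverting `ζ` and `y` can fail on `ρ` only by a root of unity of order dividing `n/d`,
and such a factor is absorbed by an automorphism over `ℚ(s, ζ)`. -/
theorem exists_algEquiv_inv_iff {s ζ ρ γ y : Ω} {n d : ℕ} (hn : 0 < n)
    (hζ : IsPrimitiveRoot ζ n) (hγ : γ ≠ 0) (hρ : ρ ^ n = γ)
    (hdn : d ∣ n) (hy : y ∈ adjoin ℚ {s, ζ}) (hyd : y ^ d = γ)
    (hmax : ∀ d', d' ∣ n → ∀ z ∈ adjoin ℚ {s, ζ}, z ^ d' = γ → d' ≤ d) :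
    (∃ g : Ω ≃ₐ[ℚ] Ω, g ζ = ζ⁻¹ ∧ g ρ = ρ⁻¹) ↔ ∃ g : Ω ≃ₐ[ℚ] Ω, g ζ = ζ⁻¹ ∧ g y = y⁻¹ := by
  have hζL : ζ ∈ adjoin ℚ {s, ζ} := subset_adjoin ℚ _ (by simp)
  obtain ⟨hmem, hle⟩ := pow_mem_and_le_of_isGreatest hn hζ hζL hγ hρ hdn hy hyd hmax
  have hd0 : 0 < d := Nat.pos_of_dvd_of_pos hdn hn
  have hρ0 : ρ ≠ 0 := by
    rintro rfl
    rw [zero_pow hn.ne'] at hρ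
    exact hγ hρ.symm
  have hζ0 : ζ ≠ 0 := hζ.ne_zero hn.ne'
  have hy0 : y ≠ 0 := by
    rintro rfl
    rw [zero_pow hd0.ne'] at hyd
    exact hγ hyd.symm
  obtain ⟨j, hj⟩ := exists_pow_mul_of_pow_eq (x := ρ ^ (n / d)) hn hζ hdn hy0 (by
      rw [← pow_mul, Nat.div_mul_cancel hdn, hρ, hyd])
  have hyj : y = ρ ^ (n / d) * (ζ ^ j)⁻¹ := by
    rw [hj, mul_comm (ζ ^ j), mul_inv_cancel_right₀ (pow_ne_zero _ hζ0)]
  constructor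
  · rintro ⟨g, h1, h2⟩
    refine ⟨g, h1, ?_⟩
    rw [hyj, map_mul, map_inv₀, map_pow, map_pow, h1, h2, mul_inv, inv_pow, inv_pow]
  · rintro ⟨g, h1, h2⟩
    have he0 : 0 < n / d := Nat.div_pos (Nat.le_of_dvd hn hdn) hd0
    have hmp := natDegree_minpoly_eq _ hn hζ hζL hρ0 (hρ ▸ hyd ▸ pow_mem hy d) he0 hmem hle
    have hgρ : g ρ ^ (n / d) = (ρ⁻¹) ^ (n / d) := by
      rw [← map_pow, hj, map_mul, map_pow, h1, h2, inv_pow, inv_pow, ← mul_inv, ← hj]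
    -- `ξ` measures the failure of `g` to invert `ρ`. The correction `τ` fixes `ℚ(s, ζ)` and sends
    -- `ρ` to `ξ * ρ`; as `g` inverts `ξ`, the composite sends `ρ` to `ξ⁻¹ * (ξ * ρ⁻¹)`.
    set ξ := g ρ * ρ with hξ
    have hξe : ξ ^ (n / d) = 1 := by
      rw [hξ, mul_pow, hgρ, ← mul_pow, inv_mul_cancel₀ hρ0, one_pow]
    have hξ0 : ξ ≠ 0 := by
      intro h0
      rw [h0, zero_pow he0.ne'] at hξe
      exact zero_ne_one hξe
    have hconj : IsConjRoot (adjoin ℚ {s, ζ}) ρ (ξ * ρ) := by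
      refine isConjRoot_of_aeval_eq_zero (Algebra.IsIntegral.isIntegral ρ) ?_
      rw [hmp]
      simp only [map_sub, map_pow, aeval_X, aeval_C]
      rw [mul_pow, hξe, one_mul]
      exact sub_self _
    obtain ⟨τ, hτ1, hτ2⟩ := exists_algEquiv_of_isConjRoot _ hconj
    refine ⟨τ.trans g, ?_, ?_⟩
    · rw [AlgEquiv.trans_apply, hτ1 _ hζL, h1]
    · have hgξ : g ξ = ξ⁻¹ := by
        have : NeZero n := ⟨hn.ne'⟩
        have h3 : ξ ^ n = 1 := by
          obtain ⟨k, hk⟩ := Nat.div_dvd_of_dvd hdn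
          rw [hk, pow_mul, hξe, one_pow]
        obtain ⟨i, -, hi⟩ := hζ.eq_pow_of_pow_eq_one h3
        rw [← hi, map_pow, h1, inv_pow]
      rw [AlgEquiv.trans_apply, hτ2, map_mul, hgξ, inv_mul_eq_iff_eq_mul₀ hξ0, hξ,
        mul_inv_cancel_right₀ hρ0]

end Galois

theorem pow_eq_self_of_dvd {M : Type*} [Monoid M] {n k : ℕ} {x : M} (hx : x ^ n = 1) (h : n ∣ k) : x ^ (1 + k) = x := by
  obtain ⟨c, rfl⟩ := h
  rw [pow_add, pow_one, pow_mul, hx, one_pow, mul_one]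

/-! ### Quadratic irrationalities as sums of roots of unity -/

section RootsOfUnity

variable {Ω : Type*} [Field Ω] [Algebra ℚ Ω] [IsAlgClosed Ω]

/-- The quadratic Gauss sum modulo `5`. Replacing `η` by `η²` changes its sign, since `2` is a
non-residue, so either square root is reached. -/
theorem exists_rootOfUnity_sqrt_five {s : Ω} (hs : s ^ 2 = 5) :
    ∃ η : Ω, η ^ 5 = 1 ∧ 1 + η + η ^ 2 + η ^ 3 + η ^ 4 = 0 ∧ s = 1 + 2 * (η + η ^ 4) := by
  obtain ⟨η, hη⟩ := exists_isPrimitiveRoot (Ω := Ω) (m := 5) (by norm_num)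
  have h5 := hη.pow_eq_one
  have h1 : η - 1 ≠ 0 := sub_ne_zero.2 (hη.ne_one (by norm_num))
  have h0 : 1 + η + η ^ 2 + η ^ 3 + η ^ 4 = 0 :=
    (mul_eq_zero.1 (show (η - 1) * (1 + η + η ^ 2 + η ^ 3 + η ^ 4) = 0 by
      linear_combination h5)).resolve_left h1
  have hsq : (s - (1 + 2 * (η + η ^ 4))) * (s + (1 + 2 * (η + η ^ 4))) = 0 := by
    linear_combination hs - 4 * h0 - (8 + 4 * η ^ 3) * h5
  rcases mul_eq_zero.1 hsq with h | h
  · exact ⟨η, h5, h0, sub_eq_zero.1 h⟩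
  · refine ⟨η ^ 2, ?_, ?_, ?_⟩
    · linear_combination (η ^ 5 + 1) * h5
    · linear_combination h0 + (η + η ^ 3) * h5
    · linear_combination h - 2 * h0 - 2 * η ^ 3 * h5

/-- For a primitive twelfth root of unity `η + η⁻¹` is a square root of `3`; writing `η ^ 11` for
the inverse keeps all identities polynomial. -/
theorem exists_rootOfUnity_sqrt_three {s : Ω} (hs : s ^ 2 = 3) :
    ∃ η : Ω, η ^ 6 = -1 ∧ s = η + η ^ 11 := by
  obtain ⟨η, hη⟩ := exists_isPrimitiveRoot (Ω := Ω) (m := 12) (by norm_num)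
  have h12 := hη.pow_eq_one
  have h6 : η ^ 6 - 1 ≠ 0 := sub_ne_zero.2 (hη.pow_ne_one_of_pos_of_lt (by norm_num) (by norm_num))
  have h4 : η ^ 4 - 1 ≠ 0 := sub_ne_zero.2 (hη.pow_ne_one_of_pos_of_lt (by norm_num) (by norm_num))
  have h6' : η ^ 6 + 1 = 0 :=
    (mul_eq_zero.1 (show (η ^ 6 - 1) * (η ^ 6 + 1) = 0 by linear_combination h12)).resolve_left h6
  have h2 : η ^ 2 + 1 ≠ 0 := fun h => h4 (by linear_combination (η ^ 2 - 1) * h)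
  have h0 : η ^ 4 - η ^ 2 + 1 = 0 :=
    (mul_eq_zero.1 (show (η ^ 2 + 1) * (η ^ 4 - η ^ 2 + 1) = 0 by
      linear_combination h6')).resolve_left h2
  have hsq : (s - (η + η ^ 11)) * (s + (η + η ^ 11)) = 0 := by
    have e : η ^ 11 = - η ^ 5 := by linear_combination η ^ 5 * h6'
    rw [e]
    linear_combination hs + h0 + (2 - η ^ 4) * h6'
  rcases mul_eq_zero.1 hsq with h | h
  · exact ⟨η, eq_neg_of_add_eq_zero_left h6', sub_eq_zero.1 h⟩
  · exact ⟨-η, by linear_combination h6', by linear_combination h⟩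

theorem exists_rootOfUnity_sqrt_two {w : Ω} (hw : w ^ 2 = 2) :
    ∃ η : Ω, η ^ 4 = -1 ∧ w = η + η ^ 7 := by
  obtain ⟨η, hη⟩ := exists_isPrimitiveRoot (Ω := Ω) (m := 8) (by norm_num)
  have h8 := hη.pow_eq_one
  have h4 : η ^ 4 - 1 ≠ 0 := sub_ne_zero.2 (hη.pow_ne_one_of_pos_of_lt (by norm_num) (by norm_num))
  have h4' : η ^ 4 + 1 = 0 :=
    (mul_eq_zero.1 (show (η ^ 4 - 1) * (η ^ 4 + 1) = 0 by linear_combination h8)).resolve_left h4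
  have hsq : (w - (η + η ^ 7)) * (w + (η + η ^ 7)) = 0 := by
    linear_combination hw - (2 + η ^ 6) * h8 - η ^ 2 * h4'
  rcases mul_eq_zero.1 hsq with h | h
  · exact ⟨η, eq_neg_of_add_eq_zero_left h4', sub_eq_zero.1 h⟩
  · exact ⟨-η, by linear_combination h4', by linear_combination h⟩

theorem exists_rootOfUnity_sqrt_neg_two {w : Ω} (hw : w ^ 2 = -2) :
    ∃ η : Ω, η ^ 4 = -1 ∧ w = η + η ^ 3 := by
  obtain ⟨η, hη⟩ := exists_isPrimitiveRoot (Ω := Ω) (m := 8) (by norm_num)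
  have h8 := hη.pow_eq_one
  have h4 : η ^ 4 - 1 ≠ 0 := sub_ne_zero.2 (hη.pow_ne_one_of_pos_of_lt (by norm_num) (by norm_num))
  have h4' : η ^ 4 + 1 = 0 :=
    (mul_eq_zero.1 (show (η ^ 4 - 1) * (η ^ 4 + 1) = 0 by linear_combination h8)).resolve_left h4
  have hsq : (w - (η + η ^ 3)) * (w + (η + η ^ 3)) = 0 := by
    linear_combination hw - (2 + η ^ 2) * h4'
  rcases mul_eq_zero.1 hsq with h | h
  · exact ⟨η, eq_neg_of_add_eq_zero_left h4', sub_eq_zero.1 h⟩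
  · exact ⟨-η, by linear_combination h4', by linear_combination h⟩

variable [Algebra.IsAlgebraic ℚ Ω]

/-- An exponent congruent to `1` modulo `n` and to `2` modulo `5` fixes `ζ` and sends `η` to `η²`,
negating the Gauss sum. -/
theorem exists_algEquiv_neg_sqrt_five {n : ℕ} (hn : 0 < n) (h5 : ¬ 5 ∣ n) {ζ s : Ω}
    (hζ : ζ ^ n = 1) (hs : s ^ 2 = 5) : ∃ τ : Ω ≃ₐ[ℚ] Ω, τ ζ = ζ ∧ τ s = -s := by
  obtain ⟨j, hj⟩ : ∃ j, (1 + j * n) % 5 = 2 := by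
    have : n % 5 = 1 ∨ n % 5 = 2 ∨ n % 5 = 3 ∨ n % 5 = 4 := by omega
    rcases this with h | h | h | h
    · exact ⟨1, by omega⟩
    · exact ⟨3, by omega⟩
    · exact ⟨2, by omega⟩
    · exact ⟨4, by omega⟩
  have hc : (1 + j * n).Coprime (n * 5) := by
    refine Nat.Coprime.mul_right (by simp) ?_
    rw [Nat.coprime_comm, Nat.Prime.coprime_iff_not_dvd Nat.prime_five]
    omega
  obtain ⟨τ, hτ⟩ := exists_algEquiv_rootsOfUnity (Ω := Ω) (by positivity) hc
  obtain ⟨η, hη, h0, rfl⟩ := exists_rootOfUnity_sqrt_five hs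
  refine ⟨τ, ?_, ?_⟩
  · rw [hτ ζ (by rw [pow_mul, hζ, one_pow]), pow_eq_self_of_dvd hζ (Dvd.intro_left j rfl)]
  · have h2 : τ η = η ^ 2 := by
      rw [hτ η (by rw [mul_comm, pow_mul, hη, one_pow]), ← Nat.div_add_mod (1 + j * n) 5, hj,
        pow_add, pow_mul, hη, one_pow, one_mul]
    simp only [map_add, map_mul, map_one, map_ofNat, map_pow, h2]
    linear_combination 2 * h0 + 2 * η ^ 3 * hη

/-- Exponents congruent to `5` or `7` modulo `12` negate `η + η⁻¹`. If `3 ∣ n` then `4 ∤ n`, and an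
exponent `1 + L` with `L ≡ 6` gives `7`; if `3 ∤ n`, an exponent `1` modulo `4n` and `2` modulo `3`
gives `5`. -/
theorem exists_algEquiv_neg_sqrt_three {n : ℕ} (hn : 0 < n) (h12 : ¬ 12 ∣ n) {ζ s : Ω}
    (hζ : ζ ^ n = 1) (hs : s ^ 2 = 3) : ∃ τ : Ω ≃ₐ[ℚ] Ω, τ ζ = ζ ∧ τ s = -s := by
  obtain ⟨η, h6, rfl⟩ := exists_rootOfUnity_sqrt_three hs
  have hη : η ^ 12 = 1 := by linear_combination (η ^ 6 - 1) * h6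
  obtain ⟨a, m, hm, hc, hnm, ha, h12m⟩ : ∃ a m : ℕ, 0 < m ∧ a.Coprime m ∧ n ∣ m ∧
      ((a % 12 = 5 ∨ a % 12 = 7) ∧ ζ ^ a = ζ) ∧ 12 ∣ m := by
    by_cases h3 : 3 ∣ n
    · obtain ⟨L, hL, hLn, hL12⟩ : ∃ L, 0 < L ∧ n ∣ L ∧ L % 12 = 6 := by
        by_cases h2 : 2 ∣ n
        · exact ⟨n, hn, dvd_rfl, by omega⟩
        · exact ⟨2 * n, by omega, Dvd.intro_left 2 rfl, by omega⟩
      refine ⟨1 + L, L * 2, by omega, Nat.Coprime.mul_right (by simp) ?_, hLn.mul_right 2,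
        ⟨by omega, pow_eq_self_of_dvd hζ hLn⟩, by omega⟩
      rw [Nat.coprime_comm, Nat.Prime.coprime_iff_not_dvd Nat.prime_two]
      omega
    · obtain ⟨j, hj⟩ : ∃ j, (1 + j * (4 * n)) % 12 = 5 := by
        have : n % 3 = 1 ∨ n % 3 = 2 := by omega
        rcases this with h | h
        · exact ⟨1, by omega⟩
        · exact ⟨2, by omega⟩
      refine ⟨1 + j * (4 * n), 4 * n * 3, by omega, Nat.Coprime.mul_right (by simp) ?_,
        ⟨12, by ring⟩, ⟨by omega, pow_eq_self_of_dvd hζ ⟨j * 4, by ring⟩⟩, ⟨n, by ring⟩⟩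
      rw [Nat.coprime_comm, Nat.Prime.coprime_iff_not_dvd Nat.prime_three]
      omega
  obtain ⟨τ, hτ⟩ := exists_algEquiv_rootsOfUnity (Ω := Ω) hm hc
  have hroot : ∀ k x, x ^ k = (1 : Ω) → k ∣ m → x ^ m = 1 := by
    rintro k x hx ⟨c, rfl⟩
    rw [pow_mul, hx, one_pow]
  refine ⟨τ, ?_, ?_⟩
  · rw [hτ ζ (hroot n ζ hζ hnm), ha.2]
  · have h1 : τ η = η ^ (a % 12) := by
      rw [hτ η (hroot 12 η hη h12m)]
      conv_lhs => rw [← Nat.div_add_mod a 12]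
      rw [pow_add, pow_mul, hη, one_pow, one_mul]
    rw [map_add, map_pow, h1]
    rcases ha.1 with h | h <;> rw [h]
    · have e1 : (η ^ 5) ^ 11 = η ^ 7 := by
        linear_combination (η ^ 43 + η ^ 31 + η ^ 19 + η ^ 7) * hη
      rw [e1]
      linear_combination (η + η ^ 5) * h6
    · have e1 : (η ^ 7) ^ 11 = η ^ 5 := by
        linear_combination (η ^ 65 + η ^ 53 + η ^ 41 + η ^ 29 + η ^ 17 + η ^ 5) * hη
      rw [e1]
      linear_combination (η + η ^ 5) * h6

theorem exists_algEquiv_neg_I {n : ℕ} (hn : 0 < n) (h4 : ¬ 4 ∣ n) {ζ s x : Ω}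
    (hζ : ζ ^ n = 1) (hs : s ^ 2 = 5) (hx : x ^ 2 = -1) :
    ∃ τ : Ω ≃ₐ[ℚ] Ω, τ ζ = ζ ∧ τ s = s ∧ τ x = -x := by
  obtain ⟨η, hη, -, rfl⟩ := exists_rootOfUnity_sqrt_five hs
  -- The exponent `1 + L` is `1` modulo `n` and modulo `5` but `3` modulo `4`, so it moves only `i`.
  obtain ⟨L, hL, hnL, h5L, hL4⟩ : ∃ L, 0 < L ∧ n ∣ L ∧ 5 ∣ L ∧ L % 4 = 2 := by
    by_cases h2 : 2 ∣ n
    · exact ⟨5 * n, by omega, Dvd.intro_left 5 rfl, Dvd.intro n rfl, by omega⟩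
    · exact ⟨10 * n, by omega, Dvd.intro_left 10 rfl, ⟨2 * n, by ring⟩, by omega⟩
  have hc : (1 + L).Coprime (L * 2) := by
    refine Nat.Coprime.mul_right (by simp) ?_
    rw [Nat.coprime_comm, Nat.Prime.coprime_iff_not_dvd Nat.prime_two]
    omega
  obtain ⟨τ, hτ⟩ := exists_algEquiv_rootsOfUnity (Ω := Ω) (by omega) hc
  have hroot : ∀ k y, y ^ k = (1 : Ω) → k ∣ L * 2 → y ^ (L * 2) = 1 := by
    rintro k y hy ⟨c, hc⟩
    rw [hc, pow_mul, hy, one_pow]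
  refine ⟨τ, ?_, ?_, ?_⟩
  · rw [hτ ζ (hroot n ζ hζ (hnL.mul_right 2)), pow_eq_self_of_dvd hζ hnL]
  · have : τ η = η := by rw [hτ η (hroot 5 η hη (h5L.mul_right 2)), pow_eq_self_of_dvd hη h5L]
    simp only [map_add, map_mul, map_one, map_ofNat, map_pow, this]
  · have hx4 : x ^ 4 = 1 := by linear_combination (x ^ 2 - 1) * hx
    rw [hτ x (hroot 4 x hx4 (by omega)), ← Nat.div_add_mod (1 + L) 4,
      show (1 + L) % 4 = 3 by omega, pow_add, pow_mul, hx4, one_pow]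
    linear_combination x * hx

theorem exists_algEquiv_neg_sqrt_two {n : ℕ} (hn : 0 < n) (h8 : ¬ 8 ∣ n) {ζ s w : Ω}
    (hζ : ζ ^ n = 1) (hs : s ^ 2 = 3) (hw : w ^ 2 = 2 ∨ w ^ 2 = -2) :
    ∃ τ : Ω ≃ₐ[ℚ] Ω, τ ζ = ζ ∧ τ s = s ∧ τ w = -w := by
  obtain ⟨η, h6, rfl⟩ := exists_rootOfUnity_sqrt_three hs
  have hη : η ^ 12 = 1 := by linear_combination (η ^ 6 - 1) * h6
  -- The exponent `1 + L` is `1` modulo `n` and `12` but `5` modulo `8`; it negates primitive eighth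
  -- roots of unity, hence both `√2` and `√-2`.
  obtain ⟨L, hL, hnL, h3L, hL8⟩ : ∃ L, 0 < L ∧ n ∣ L ∧ 12 ∣ L ∧ L % 8 = 4 := by
    by_cases h4 : 4 ∣ n
    · exact ⟨3 * n, by omega, Dvd.intro_left 3 rfl, by omega, by omega⟩
    · by_cases h2 : 2 ∣ n
      · exact ⟨6 * n, by omega, Dvd.intro_left 6 rfl, by omega, by omega⟩
      · exact ⟨12 * n, by omega, Dvd.intro_left 12 rfl, by omega, by omega⟩
  have hc : (1 + L).Coprime (L * 2) := by
    refine Nat.Coprime.mul_right (by simp) ?_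
    rw [Nat.coprime_comm, Nat.Prime.coprime_iff_not_dvd Nat.prime_two]
    omega
  obtain ⟨τ, hτ⟩ := exists_algEquiv_rootsOfUnity (Ω := Ω) (by omega) hc
  have hroot : ∀ k y, y ^ k = (1 : Ω) → k ∣ L * 2 → y ^ (L * 2) = 1 := by
    rintro k y hy ⟨c, hc⟩
    rw [hc, pow_mul, hy, one_pow]
  have h8τ : ∀ ξ : Ω, ξ ^ 4 = -1 → τ ξ = -ξ := by
    intro ξ h4
    have hx8 : ξ ^ 8 = 1 := by linear_combination (ξ ^ 4 - 1) * h4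
    rw [hτ ξ (hroot 8 ξ hx8 (by omega)), ← Nat.div_add_mod (1 + L) 8,
      show (1 + L) % 8 = 5 by omega, pow_add, pow_mul, hx8, one_pow]
    linear_combination ξ * h4
  refine ⟨τ, ?_, ?_, ?_⟩
  · rw [hτ ζ (hroot n ζ hζ (hnL.mul_right 2)), pow_eq_self_of_dvd hζ hnL]
  · have : τ η = η := by rw [hτ η (hroot 12 η hη (h3L.mul_right 2)), pow_eq_self_of_dvd hη h3L]
    simp only [map_add, map_pow, this]
  · rcases hw with hw | hw
    · obtain ⟨ξ, h4, rfl⟩ := exists_rootOfUnity_sqrt_two hw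
      rw [map_add, map_pow, h8τ ξ h4]
      ring
    · obtain ⟨ξ, h4, rfl⟩ := exists_rootOfUnity_sqrt_neg_two hw
      rw [map_add, map_pow, h8τ ξ h4]
      ring

end RootsOfUnity

theorem mem_adjoin_of_pow_eq_one {Ω : Type*} [Field Ω] [Algebra ℚ Ω] {n : ℕ} (hn : 0 < n) {ζ x : Ω}
    (hζ : IsPrimitiveRoot ζ n) (hx : x ^ n = 1) : x ∈ adjoin ℚ {ζ} := by
  have : NeZero n := ⟨hn.ne'⟩
  obtain ⟨j, -, rfl⟩ := hζ.eq_pow_of_pow_eq_one hx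
  exact pow_mem (mem_adjoin_simple_self ℚ ζ) j

theorem map_eq_inv_of_pow_eq_one {Ω : Type*} [Field Ω] [Algebra ℚ Ω] {n : ℕ} (hn : 0 < n)
    {ζ x : Ω} (hζ : IsPrimitiveRoot ζ n) (hx : x ^ n = 1) {g : Ω ≃ₐ[ℚ] Ω} (hg : g ζ = ζ⁻¹) :
    g x = x⁻¹ := by
  have : NeZero n := ⟨hn.ne'⟩
  obtain ⟨j, -, rfl⟩ := hζ.eq_pow_of_pow_eq_one hx
  rw [map_pow, hg, inv_pow]

theorem map_eq_or_eq_neg {F Ω : Type*} [Field F] [Field Ω] [Algebra F Ω] {s : Ω} {D : F}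
    (hs : s ^ 2 = algebraMap F Ω D) (g : Ω ≃ₐ[F] Ω) : g s = s ∨ g s = -s := by
  refine sq_eq_sq_iff_eq_or_eq_neg.1 ?_
  rw [← map_pow, hs, AlgEquiv.commutes]

theorem algHom_injective {Ω : Type*} [Field Ω] [Algebra ℚ Ω] (ι : Ω →ₐ[ℚ] ℂ) :
    Function.Injective ι :=
  ι.toRingHom.injective

/-! ### Bounding the Kummer exponent by complex conjugation -/

section Conj

variable {Ω : Type*} [Field Ω] [Algebra ℚ Ω] (ι : Ω →ₐ[ℚ] ℂ) (conj : Ω ≃ₐ[ℚ] Ω)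
  (hconj : ∀ x, ι (conj x) = starRingEnd ℂ (ι x))

include hconj

theorem conj_eq_inv_of_pow_eq_one {n : ℕ} (hn : 0 < n) {x : Ω} (hx : x ^ n = 1) :
    conj x = x⁻¹ := by
  have h1 : ‖ι x‖ = 1 := by
    refine (pow_eq_one_iff_of_nonneg (norm_nonneg _) hn.ne').1 ?_
    rw [← norm_pow, ← map_pow, hx, map_one, norm_one]
  refine eq_inv_of_mul_eq_one_right (algHom_injective ι ?_)
  rw [map_mul, hconj, Complex.mul_conj', h1, map_one]
  simp

theorem conj_eq_self_of_real {x : Ω} {r : ℝ} (hx : ι x = r) : conj x = x := by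
  refine algHom_injective ι ?_
  rw [hconj, hx, Complex.conj_ofReal]

/-- `ℚ(s, ζ)` is abelian over `ℚ`; it suffices to compare the two composites on the generators. -/
theorem conj_comm {n : ℕ} (hn : 0 < n) {s ζ y : Ω} {D : ℚ} (hs : s ^ 2 = algebraMap ℚ Ω D)
    (hsr : conj s = s) (hζ : ζ ^ n = 1) (hy : y ∈ adjoin ℚ {s, ζ}) (σ : Ω ≃ₐ[ℚ] Ω) :
    σ (conj y) = conj (σ y) := by
  refine algEquiv_eq_of_mem_adjoin (σ := conj.trans σ) (τ := σ.trans conj) ?_ hy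
  rintro x (rfl | rfl)
  · rw [AlgEquiv.trans_apply, AlgEquiv.trans_apply, hsr]
    rcases map_eq_or_eq_neg hs σ with h | h
    · rw [h, hsr]
    · rw [h, map_neg, hsr]
  · rw [AlgEquiv.trans_apply, AlgEquiv.trans_apply, conj_eq_inv_of_pow_eq_one ι conj hconj hn hζ,
      conj_eq_inv_of_pow_eq_one ι conj hconj hn (x := σ x) (by rw [← map_pow, hζ, map_one]),
      map_inv₀]

variable [IsAlgClosed Ω] [Algebra.IsAlgebraic ℚ Ω]

/-- If an element `y` of the abelian extension `ℚ(s, ζ)` has a power in the real quadratic field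
`ℚ(s)`, then `|y| ^ 2` is a totally nonnegative element of `ℚ(s)`. -/
theorem exists_mem_adjoin_norm_sq {n d : ℕ} (hn : 0 < n) (hd : 0 < d) {s ζ y : Ω} {D : ℚ}
    (hs : s ^ 2 = algebraMap ℚ Ω D) (hsr : conj s = s) (hζ : ζ ^ n = 1)
    (hy : y ∈ adjoin ℚ {s, ζ}) (hyd : y ^ d ∈ adjoin ℚ {s}) :
    ∃ u ∈ adjoin ℚ {s}, ι u = ((‖ι y‖ ^ 2 : ℝ) : ℂ) ∧
      ∀ σ : Ω ≃ₐ[ℚ] Ω, ∃ r : ℝ, 0 ≤ r ∧ ι (σ u) = r := by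
  have hσ : ∀ σ : Ω ≃ₐ[ℚ] Ω, ι (σ (y * conj y)) = ((‖ι (σ y)‖ ^ 2 : ℝ) : ℂ) := by
    intro σ
    rw [map_mul, conj_comm ι conj hconj hn hs hsr hζ hy, map_mul, hconj, Complex.mul_conj']
    push_cast
    rfl
  refine ⟨y * conj y, ?_, hσ AlgEquiv.refl, fun σ => ⟨_, sq_nonneg _, hσ σ⟩⟩
  -- Galois descent: an automorphism over `ℚ(s)` fixes `y ^ d`, so it preserves `|y|^d`, hence
  -- `|y|²`.
  by_contra hnot
  obtain ⟨σ, h1, h2⟩ := exists_algEquiv_ne _ hnot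
  refine h2 (algHom_injective ι ?_)
  rw [hσ σ, show ι (y * conj y) = _ from hσ AlgEquiv.refl]
  have h3 : ‖ι (σ y)‖ = ‖ι y‖ := by
    refine (pow_left_inj₀ (norm_nonneg _) (norm_nonneg _) hd.ne').1 ?_
    rw [← norm_pow, ← norm_pow, ← map_pow, ← map_pow, ← map_pow, h1 _ hyd]
  rw [h3]
  rfl

/-- Although `y` may be non-real, `|y|²` is a real element of `ℚ(√D)` whose `d`-th power is `g ^
(2H)`; as `g` is not a perfect power, `d` divides `2H`. -/
theorem dvd_two_mul_of_pow_eq {n d D H : ℕ} (hn : 0 < n) (hd : 0 < d) {s ζ y γ : Ω}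
    (hs : ι s = ((√(D : ℝ) : ℝ) : ℂ)) (hζ : ζ ^ n = 1) (hy : y ∈ adjoin ℚ {s, ζ})
    (hγ : γ ∈ adjoin ℚ {s}) (hyd : y ^ d = γ) {g : ℝ} (hg : 0 < g)
    (hgS : g ∈ adjoin ℚ {√(D : ℝ)})
    (hnp : ∀ v ∈ adjoin ℚ {√(D : ℝ)}, ∀ k : ℕ, 2 ≤ k → v ^ k ≠ g) (hγg : ‖ι γ‖ = g ^ H) :
    d ∣ 2 * H := by
  have hs2 : s ^ 2 = algebraMap ℚ Ω D := by
    refine algHom_injective ι ?_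
    rw [map_pow, hs, AlgHom.commutes, ← Complex.ofReal_pow, Real.sq_sqrt (Nat.cast_nonneg D)]
    simp
  obtain ⟨u, hu, hu1, -⟩ := exists_mem_adjoin_norm_sq ι conj hconj hn hd hs2
    (conj_eq_self_of_real ι conj hconj hs) hζ hy (hyd ▸ hγ)
  obtain ⟨a, b, rfl⟩ := mem_adjoin_sqrt hs2 hu
  have hx : ‖ι y‖ ^ 2 = a + b * √(D : ℝ) := by
    have : (((‖ι y‖ ^ 2 : ℝ)) : ℂ) = ((a + b * √(D : ℝ) : ℝ) : ℂ) := by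
      rw [← hu1, map_add, map_mul, AlgHom.commutes, AlgHom.commutes, hs]
      simp
    exact_mod_cast this
  have hxS : ‖ι y‖ ^ 2 ∈ adjoin ℚ {√(D : ℝ)} := by
    rw [hx]
    exact add_mem (IntermediateField.algebraMap_mem _ a)
      (mul_mem (IntermediateField.algebraMap_mem _ b) (mem_adjoin_simple_self ℚ _))
  have hpow : ‖ι y‖ ^ d = g ^ H := by rw [← norm_pow, ← map_pow, hyd, hγg]
  have hy0 : 0 < ‖ι y‖ := by
    refine lt_of_le_of_ne (norm_nonneg _) fun h0 => ?_
    rw [← h0, zero_pow hd.ne'] at hpow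
    exact (pow_pos hg H).ne hpow
  refine dvd_of_pow_eq_pow hgS hxS hg (by positivity) hnp hd ?_
  rw [← pow_mul, mul_comm 2 d, pow_mul, hpow, ← pow_mul, mul_comm]

end Conj

/-! ### Degrees, and which square roots lie in `ℚ(√D, ζ_n)` -/

section Degree

variable {Ω : Type*} [Field Ω] [Algebra ℚ Ω] [IsAlgClosed Ω] [Algebra.IsAlgebraic ℚ Ω]

theorem finrank_adjoin_root_mul {n d : ℕ} (hn : 0 < n) {s ζ ρ γ y : Ω}
    (hζ : IsPrimitiveRoot ζ n) (hγ : γ ≠ 0) (hρ : ρ ^ n = γ)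
    (hdn : d ∣ n) (hy : y ∈ adjoin ℚ {s, ζ}) (hyd : y ^ d = γ)
    (hmax : ∀ d', d' ∣ n → ∀ z ∈ adjoin ℚ {s, ζ}, z ^ d' = γ → d' ≤ d) :
    Module.finrank ℚ (adjoin ℚ {s, ζ, ρ}) * d = Module.finrank ℚ (adjoin ℚ {s, ζ}) * n := by
  have hζL : ζ ∈ adjoin ℚ {s, ζ} := subset_adjoin ℚ _ (by simp)
  obtain ⟨hmem, hle⟩ := pow_mem_and_le_of_isGreatest hn hζ hζL hγ hρ hdn hy hyd hmax
  have hd0 : 0 < d := Nat.pos_of_dvd_of_pos hdn hn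
  have hρ0 : ρ ≠ 0 := by
    rintro rfl
    rw [zero_pow hn.ne'] at hρ
    exact hγ hρ.symm
  have he0 : 0 < n / d := Nat.div_pos (Nat.le_of_dvd hn hdn) hd0
  have hset : ({s, ζ, ρ} : Set Ω) = {s, ζ} ∪ {ρ} := by
    ext x
    simp only [Set.mem_union, Set.mem_insert_iff, Set.mem_singleton_iff, or_assoc]
  rw [hset, finrank_adjoin_insert, natDegree_minpoly_eq _ hn hζ hζL hρ0
    (hρ ▸ hyd ▸ pow_mem hy d) he0 hmem hle, natDegree_X_pow_sub_C, mul_assoc,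
    Nat.div_mul_cancel hdn]

theorem mem_adjoin_zeta_iff_five_dvd {n : ℕ} (hn : 0 < n) {s ζ : Ω} (hζ : IsPrimitiveRoot ζ n)
    (hs : s ^ 2 = 5) : s ∈ adjoin ℚ {ζ} ↔ 5 ∣ n := by
  have : CharZero Ω := algebraRat.charZero Ω
  constructor
  · intro h
    by_contra h5
    obtain ⟨τ, h1, h2⟩ := exists_algEquiv_neg_sqrt_five hn h5 hζ.pow_eq_one hs
    have h3 := algEquiv_eq_of_mem_adjoin (σ := τ) (τ := AlgEquiv.refl) (by simpa using h1) h
    rw [h2, AlgEquiv.coe_refl, id, neg_eq_self] at h3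
    rw [h3] at hs
    norm_num at hs
  · rintro ⟨k, rfl⟩
    obtain ⟨η, h5, -, rfl⟩ := exists_rootOfUnity_sqrt_five hs
    have := mem_adjoin_of_pow_eq_one hn hζ (x := η) (by rw [pow_mul, h5, one_pow])
    exact add_mem (one_mem _) (mul_mem (ofNat_mem _ 2) (add_mem this (pow_mem this 4)))

theorem mem_adjoin_zeta_iff_twelve_dvd {n : ℕ} (hn : 0 < n) {s ζ : Ω} (hζ : IsPrimitiveRoot ζ n)
    (hs : s ^ 2 = 3) : s ∈ adjoin ℚ {ζ} ↔ 12 ∣ n := by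
  have : CharZero Ω := algebraRat.charZero Ω
  constructor
  · intro h
    by_contra h5
    obtain ⟨τ, h1, h2⟩ := exists_algEquiv_neg_sqrt_three hn h5 hζ.pow_eq_one hs
    have h3 := algEquiv_eq_of_mem_adjoin (σ := τ) (τ := AlgEquiv.refl) (by simpa using h1) h
    rw [h2, AlgEquiv.coe_refl, id, neg_eq_self] at h3
    rw [h3] at hs
    norm_num at hs
  · rintro ⟨k, rfl⟩
    obtain ⟨η, h6, rfl⟩ := exists_rootOfUnity_sqrt_three hs
    have := mem_adjoin_of_pow_eq_one hn hζ (x := η) (by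
      rw [pow_mul, show η ^ 12 = (η ^ 6) ^ 2 by ring, h6]
      simp)
    exact add_mem this (pow_mem this 11)

/-- `(1 + s)² = 2(2 + s)`, so a square root of `±(2 + s)` yields a square root of `±2`, which lies
in `ℚ(√3, ζ_n)` only if `8 ∣ n`. -/
theorem eight_dvd_of_sq_eq_unitThree {n : ℕ} (hn : 0 < n) {s ζ z : Ω} (hζ : ζ ^ n = 1)
    (hs : s ^ 2 = 3) (hz : z ∈ adjoin ℚ {s, ζ}) (h : z ^ 2 = 2 + s ∨ z ^ 2 = -(2 + s)) :
    8 ∣ n := by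
  have : CharZero Ω := algebraRat.charZero Ω
  have hu : (2 + s) * (2 - s) = 1 := by linear_combination -hs
  have hu0 : 2 + s ≠ 0 := left_ne_zero_of_mul_eq_one hu
  have hz0 : z ≠ 0 := by
    rintro rfl
    rcases h with h | h
    · exact hu0 (by linear_combination -h)
    · exact hu0 (by linear_combination h)
  by_contra h8
  have hw : ((1 + s) / z) ^ 2 = 2 ∨ ((1 + s) / z) ^ 2 = -2 := by
    rcases h with h | h
    · left
      rw [div_pow, h, div_eq_iff hu0]
      linear_combination hs
    · right
      rw [div_pow, h, div_eq_iff (neg_ne_zero.2 hu0)]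
      linear_combination hs
  obtain ⟨τ, h1, h2, h3⟩ := exists_algEquiv_neg_sqrt_two hn h8 hζ hs hw
  have hmem : (1 + s) / z ∈ adjoin ℚ {s, ζ} :=
    div_mem (add_mem (one_mem _) (subset_adjoin ℚ _ (by simp))) hz
  have h4 := algEquiv_eq_of_mem_adjoin (σ := τ) (τ := AlgEquiv.refl) (by simp [h1, h2]) hmem
  rw [h3, AlgEquiv.coe_refl, id, neg_eq_self] at h4
  rw [h4] at hw
  norm_num at hw

theorem four_dvd_of_sq_eq_neg_unitFive_sq {n : ℕ} (hn : 0 < n) {s ζ z : Ω} (hζ : ζ ^ n = 1)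
    (hs : s ^ 2 = 5) (hz : z ∈ adjoin ℚ {s, ζ}) (h : z ^ 2 = -((1 + s) / 2) ^ 2) :
    4 ∣ n := by
  have : CharZero Ω := algebraRat.charZero Ω
  have hu : (1 + s) / 2 * ((s - 1) / 2) = 1 := by linear_combination hs / 4
  have hu0 : (1 + s) / 2 ≠ 0 := left_ne_zero_of_mul_eq_one hu
  by_contra h4
  have hw : (z / ((1 + s) / 2)) ^ 2 = -1 := by
    rw [div_pow, h, neg_div, div_self (pow_ne_zero 2 hu0)]
  obtain ⟨τ, h1, h2, h3⟩ := exists_algEquiv_neg_I hn h4 hζ hs hw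
  have hmem : z / ((1 + s) / 2) ∈ adjoin ℚ {s, ζ} :=
    div_mem hz (div_mem (add_mem (one_mem _) (subset_adjoin ℚ _ (by simp))) (ofNat_mem _ 2))
  have h4 := algEquiv_eq_of_mem_adjoin (σ := τ) (τ := AlgEquiv.refl) (by simp [h1, h2]) hmem
  rw [h3, AlgEquiv.coe_refl, id, neg_eq_self] at h4
  rw [h4] at hw
  norm_num at hw

end Degree

/-- An automorphism inverting `ζ` acts on `ℚ(ζ)` as complex conjugation does; so it negates `i`, and
in the next two lemmas it fixes `√2` and negates `√-2`. -/
theorem exists_mem_adjoin_zeta_I {Ω : Type*} [Field Ω] [Algebra ℚ Ω]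
    [IsAlgClosed Ω] {n : ℕ} (hn : 0 < n) (h4 : 4 ∣ n) {ζ : Ω}
    (hζ : IsPrimitiveRoot ζ n) : ∃ x ∈ adjoin ℚ {ζ}, x ^ 2 = -1 ∧
      ∀ g : Ω ≃ₐ[ℚ] Ω, g ζ = ζ⁻¹ → g x = -x := by
  obtain ⟨x, hx⟩ := IsAlgClosed.exists_pow_nat_eq (-1 : Ω) two_pos
  have hxn : x ^ n = 1 := by
    obtain ⟨k, rfl⟩ := h4
    rw [pow_mul, show x ^ 4 = (x ^ 2) ^ 2 by ring, hx]
    simp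
  refine ⟨x, mem_adjoin_of_pow_eq_one hn hζ hxn, hx, fun g hg => ?_⟩
  rw [map_eq_inv_of_pow_eq_one hn hζ hxn hg]
  exact inv_eq_of_mul_eq_one_right (by linear_combination -hx)

theorem exists_mem_adjoin_zeta_sqrt_two {Ω : Type*} [Field Ω] [Algebra ℚ Ω]
    [IsAlgClosed Ω] {n : ℕ} (hn : 0 < n) (h8 : 8 ∣ n) {ζ : Ω}
    (hζ : IsPrimitiveRoot ζ n) : ∃ x ∈ adjoin ℚ {ζ}, x ^ 2 = 2 ∧
      ∀ g : Ω ≃ₐ[ℚ] Ω, g ζ = ζ⁻¹ → g x = x := by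
  obtain ⟨x, hx⟩ := IsAlgClosed.exists_pow_nat_eq (2 : Ω) two_pos
  obtain ⟨η, h4, rfl⟩ := exists_rootOfUnity_sqrt_two hx
  have h8' : η ^ 8 = 1 := by linear_combination (η ^ 4 - 1) * h4
  have hηn : η ^ n = 1 := by
    obtain ⟨k, rfl⟩ := h8
    rw [pow_mul, h8', one_pow]
  have hmem := mem_adjoin_of_pow_eq_one hn hζ hηn
  refine ⟨_, add_mem hmem (pow_mem hmem 7), hx, fun g hg => ?_⟩
  have h7 : g η = η ^ 7 := by
    rw [map_eq_inv_of_pow_eq_one hn hζ hηn hg]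
    exact inv_eq_of_mul_eq_one_right (by linear_combination h8')
  rw [map_add, map_pow, h7]
  linear_combination η * (η ^ 40 + η ^ 32 + η ^ 24 + η ^ 16 + η ^ 8 + 1) * h8'

theorem exists_mem_adjoin_zeta_sqrt_neg_two {Ω : Type*} [Field Ω] [Algebra ℚ Ω]
    [IsAlgClosed Ω] {n : ℕ} (hn : 0 < n) (h8 : 8 ∣ n) {ζ : Ω}
    (hζ : IsPrimitiveRoot ζ n) : ∃ x ∈ adjoin ℚ {ζ}, x ^ 2 = -2 ∧
      ∀ g : Ω ≃ₐ[ℚ] Ω, g ζ = ζ⁻¹ → g x = -x := by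
  obtain ⟨x, hx⟩ := IsAlgClosed.exists_pow_nat_eq (-2 : Ω) two_pos
  obtain ⟨η, h4, rfl⟩ := exists_rootOfUnity_sqrt_neg_two hx
  have h8' : η ^ 8 = 1 := by linear_combination (η ^ 4 - 1) * h4
  have hηn : η ^ n = 1 := by
    obtain ⟨k, rfl⟩ := h8
    rw [pow_mul, h8', one_pow]
  have hmem := mem_adjoin_of_pow_eq_one hn hζ hηn
  refine ⟨_, add_mem hmem (pow_mem hmem 3), hx, fun g hg => ?_⟩
  have h7 : g η = η ^ 7 := by
    rw [map_eq_inv_of_pow_eq_one hn hζ hηn hg]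
    exact inv_eq_of_mul_eq_one_right (by linear_combination h8')
  rw [map_add, map_pow, h7]
  linear_combination η ^ 5 * (η ^ 8 + 1) * h8' + (η + η ^ 3) * h4

theorem finrank_adjoin_sqrt_three_zeta {Ω : Type*} [Field Ω] [Algebra ℚ Ω] [IsAlgClosed Ω]
    [Algebra.IsAlgebraic ℚ Ω] {n : ℕ} (hn : 0 < n) {s ζ : Ω} (hs2 : s ^ 2 = 3)
    (hζ : IsPrimitiveRoot ζ n) :
    Module.finrank ℚ (adjoin ℚ {s, ζ}) = n.totient * (if 12 ∣ n then 1 else 2) := by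
  have : CharZero Ω := algebraRat.charZero Ω
  have hs2' : s ^ 2 = algebraMap ℚ Ω 3 := by simpa using hs2
  have hs0 : s ≠ 0 := by
    rintro rfl
    norm_num at hs2
  have h1 := finrank_adjoin_sqrt_zeta hn hζ hs0 hs2'
  rw [mem_adjoin_zeta_iff_twelve_dvd hn hζ hs2] at h1
  split_ifs with h5
  · rw [h1.1 h5, mul_one]
  · exact h1.2 h5

/-! ### Kummer exponent and inversion criterion in the three cases -/

section Conj

variable {Ω : Type*} [Field Ω] [Algebra ℚ Ω] (ι : Ω →ₐ[ℚ] ℂ) (conj : Ω ≃ₐ[ℚ] Ω)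
  (hconj : ∀ x, ι (conj x) = starRingEnd ℂ (ι x))

theorem sq_eq_of_map_eq_sqrt {D : ℕ} {s : Ω} (hs : ι s = ((√(D : ℝ) : ℝ) : ℂ)) :
    s ^ 2 = (D : Ω) := by
  refine algHom_injective ι ?_
  rw [map_pow, hs, ← Complex.ofReal_pow, Real.sq_sqrt (Nat.cast_nonneg D), map_natCast]
  simp

theorem unitThree_pow_ne_one {k : ℕ} (hk : k ≠ 0) {s : Ω}
    (hs : ι s = ((√((3 : ℕ) : ℝ) : ℝ) : ℂ)) : (2 + s) ^ k ≠ 1 := by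
  intro h
  have hιg : ι (2 + s) = (unitThree : ℂ) := by
    simp [unitThree, hs, map_ofNat ι 2]
  have h1 : unitThree ^ k = 1 := by
    have : ι ((2 + s) ^ k) = 1 := by rw [h, map_one]
    rw [map_pow, hιg] at this
    exact_mod_cast this
  exact (one_lt_pow₀ one_lt_unitThree hk).ne' h1

/-- For `v = (1 + s)/w` the product `g(v) v` is `2 + s` or `-1`, according to whether `g` fixes or
negates `s`; no odd power of either is `1`. The hypothesis on `w` covers `√2` fixed by `g` and `√-2`
negated by `g`. -/
theorem map_pow_ne_inv_of_odd {k : ℕ} (hk : Odd k) {s w : Ω}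
    (hs : ι s = ((√((3 : ℕ) : ℝ) : ℝ) : ℂ)) {g : Ω ≃ₐ[ℚ] Ω} (hw0 : w ≠ 0)
    (hw : g w * w = 2) : g (((1 + s) / w) ^ k) ≠ (((1 + s) / w) ^ k)⁻¹ := by
  have : CharZero Ω := algebraRat.charZero Ω
  have hs2 : s ^ 2 = 3 := by simpa using sq_eq_of_map_eq_sqrt ι hs
  have hs2' : s ^ 2 = algebraMap ℚ Ω 3 := by simpa using hs2
  intro h
  have h1s : 1 + s ≠ 0 := fun h0 => by
    rw [show s = -1 by linear_combination h0] at hs2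
    norm_num at hs2
  have h1 : (g ((1 + s) / w) * ((1 + s) / w)) ^ k = 1 := by
    rw [mul_pow, ← map_pow, h, inv_mul_cancel₀ (pow_ne_zero _ (div_ne_zero h1s hw0))]
  rw [map_div₀, div_mul_div_comm, hw, map_add, map_one] at h1
  rcases map_eq_or_eq_neg hs2' g with h2 | h2
  · rw [h2, show (1 + s) * (1 + s) / 2 = 2 + s by linear_combination hs2 / 2] at h1
    exact unitThree_pow_ne_one ι hk.pos.ne' hs h1
  · rw [h2, show (1 + -s) * (1 + s) / 2 = -1 by linear_combination -hs2 / 2, hk.neg_one_pow] at h1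
    norm_num at h1

include hconj in
theorem exists_inv_and_neg {n : ℕ} (hn : 0 < n) {s ζ : Ω} (hζ : ζ ^ n = 1) (hsr : conj s = s)
    (h : ∃ τ : Ω ≃ₐ[ℚ] Ω, τ ζ = ζ ∧ τ s = -s) : ∃ g : Ω ≃ₐ[ℚ] Ω, g ζ = ζ⁻¹ ∧ g s = -s := by
  obtain ⟨τ, h1, h2⟩ := h
  refine ⟨τ.trans conj, ?_, ?_⟩
  · rw [AlgEquiv.trans_apply, h1, conj_eq_inv_of_pow_eq_one ι conj hconj hn hζ]
  · rw [AlgEquiv.trans_apply, h2, map_neg, hsr]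

include hconj in
theorem map_eq_self_of_mem_adjoin_zeta {n : ℕ} (hn : 0 < n) {s ζ : Ω} (hζ : ζ ^ n = 1)
    (hsr : conj s = s) (hmem : s ∈ adjoin ℚ {ζ}) {g : Ω ≃ₐ[ℚ] Ω} (hg : g ζ = ζ⁻¹) : g s = s := by
  rw [algEquiv_eq_of_mem_adjoin (σ := g) (τ := conj) _ hmem, hsr]
  intro x hx
  rw [Set.mem_singleton_iff.1 hx, hg, conj_eq_inv_of_pow_eq_one ι conj hconj hn hζ]

variable [IsAlgClosed Ω] [Algebra.IsAlgebraic ℚ Ω]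

include hconj

/-- The norm argument gives `d ∣ 4`. For `d = 4`, `|z|²` would be the golden ratio, whose conjugate
is negative, whereas `|z|²` is totally nonnegative. For `d = 2`, dividing `z` by the golden ratio
gives `i`, so `4 ∣ n`. -/
theorem le_of_pow_eq_neg_unitFive_sq {n d : ℕ} (hn : 0 < n) {s ζ z : Ω}
    (hs : ι s = ((√((5 : ℕ) : ℝ) : ℝ) : ℂ)) (hζ : ζ ^ n = 1) (hd : d ∣ n)
    (hz : z ∈ adjoin ℚ {s, ζ}) (hzd : z ^ d = -((1 + s) / 2) ^ 2) :
    d ≤ if 4 ∣ n then 2 else 1 := by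
  have hs2 : s ^ 2 = 5 := by simpa using sq_eq_of_map_eq_sqrt ι hs
  have hd0 : 0 < d := Nat.pos_of_dvd_of_pos hd hn
  have hgK : (1 + s) / 2 ∈ adjoin ℚ {s} :=
    div_mem (add_mem (one_mem _) (mem_adjoin_simple_self ℚ s)) (ofNat_mem _ 2)
  have hγK : -((1 + s) / 2) ^ 2 ∈ adjoin ℚ {s} := neg_mem (pow_mem hgK 2)
  have hιg : ι ((1 + s) / 2) = (unitFive : ℂ) := by
    simp [unitFive, hs, map_ofNat ι 2]
  have hgpos : 0 < unitFive := zero_lt_one.trans one_lt_unitFive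
  have hγn : ‖ι (-((1 + s) / 2) ^ 2)‖ = unitFive ^ 2 := by
    rw [map_neg, norm_neg, map_pow, hιg, norm_pow, Complex.norm_real, Real.norm_of_nonneg hgpos.le]
  have hgS : unitFive ∈ adjoin ℚ {√((5 : ℕ) : ℝ)} :=
    div_mem (add_mem (one_mem _) (mem_adjoin_simple_self ℚ _)) (ofNat_mem _ 2)
  have h4 : d ∣ 2 * 2 := dvd_two_mul_of_pow_eq ι conj hconj hn hd0 hs hζ hz hγK hzd hgpos hgS
    (fun v hv k hk => (unitFive_not_pow hv hk).1) hγn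
  have hd4 : d ≠ 4 := by
    rintro rfl
    have hs2' : s ^ 2 = algebraMap ℚ Ω 5 := by simpa using hs2
    obtain ⟨u, -, hu1, hu2⟩ := exists_mem_adjoin_norm_sq ι conj hconj hn hd0 hs2'
      (conj_eq_self_of_real ι conj hconj hs) hζ hz (hzd ▸ hγK)
    have h5 : ‖ι z‖ ^ 2 = unitFive := by
      have : ‖ι z‖ ^ 4 = unitFive ^ 2 := by rw [← norm_pow, ← map_pow, hzd, hγn]
      refine (pow_left_inj₀ (by positivity) hgpos.le two_ne_zero).1 ?_
      rw [← this]
      ring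
    have h6 : u = (1 + s) / 2 := algHom_injective ι (by rw [hu1, h5, hιg])
    obtain ⟨σ, -, hσ⟩ := exists_algEquiv_neg_sqrt_five one_pos (by norm_num) (one_pow 1) hs2
    obtain ⟨r, hr0, hr⟩ := hu2 σ
    have h7 : r = (1 - √((5 : ℕ) : ℝ)) / 2 := by
      have : ι (σ u) = (((1 - √((5 : ℕ) : ℝ)) / 2 : ℝ) : ℂ) := by
        rw [h6, map_div₀, map_add, map_one, hσ, map_ofNat, map_div₀, map_add, map_neg, hs]
        simp [sub_eq_add_neg, map_ofNat ι 2]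
      rw [hr] at this
      exact_mod_cast this
    have h8 := one_lt_unitFive
    rw [unitFive] at h8
    generalize √((5 : ℕ) : ℝ) = q at *
    linarith
  have h124 : d = 1 ∨ d = 2 ∨ d = 4 := by
    have : d ≤ 4 := Nat.le_of_dvd (by norm_num) h4
    interval_cases d <;> simp_all
  rcases h124 with rfl | rfl | rfl
  · split_ifs <;> norm_num
  · rw [if_pos (four_dvd_of_sq_eq_neg_unitFive_sq hn hζ hs2 hz hzd)]
  · exact absurd rfl hd4

theorem le_of_pow_eq_unitThree {n d H : ℕ} (hn : 0 < n) {s ζ z γ : Ω}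
    (hs : ι s = ((√((3 : ℕ) : ℝ) : ℝ) : ℂ)) (hζ : ζ ^ n = 1) (hd : d ∣ n)
    (hz : z ∈ adjoin ℚ {s, ζ}) (hγ : γ = (2 + s) ^ H ∨ γ = -(2 + s) ^ H) (hzd : z ^ d = γ) :
    d ∣ 2 * H := by
  have hd0 : 0 < d := Nat.pos_of_dvd_of_pos hd hn
  have hgK : 2 + s ∈ adjoin ℚ {s} := add_mem (ofNat_mem _ 2) (mem_adjoin_simple_self ℚ s)
  have hγK : γ ∈ adjoin ℚ {s} := by
    rcases hγ with rfl | rfl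
    · exact pow_mem hgK H
    · exact neg_mem (pow_mem hgK H)
  have hιg : ι (2 + s) = (unitThree : ℂ) := by
    simp [unitThree, hs, map_ofNat ι 2]
  have hgpos : 0 < unitThree := zero_lt_one.trans one_lt_unitThree
  have hγn : ‖ι γ‖ = unitThree ^ H := by
    rcases hγ with rfl | rfl
    · rw [map_pow, hιg, norm_pow, Complex.norm_real, Real.norm_of_nonneg hgpos.le]
    · rw [map_neg, norm_neg, map_pow, hιg, norm_pow, Complex.norm_real,
        Real.norm_of_nonneg hgpos.le]
  have hgS : unitThree ∈ adjoin ℚ {√((3 : ℕ) : ℝ)} :=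
    add_mem (ofNat_mem _ 2) (mem_adjoin_simple_self ℚ _)
  exact dvd_two_mul_of_pow_eq ι conj hconj hn hd0 hs hζ hz hγK hzd hgpos hgS
    (fun v hv k hk => (unitThree_not_pow hv hk).1) hγn

theorem le_of_pow_eq_unitThree_sq {n d : ℕ} (hn : 0 < n) {s ζ z : Ω}
    (hs : ι s = ((√((3 : ℕ) : ℝ) : ℝ) : ℂ)) (hζ : ζ ^ n = 1) (hd : d ∣ n)
    (hz : z ∈ adjoin ℚ {s, ζ}) (hzd : z ^ d = (2 + s) ^ 2) :
    d ≤ if 8 ∣ n then 4 else if 2 ∣ n then 2 else 1 := by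
  have hs2 : s ^ 2 = 3 := by simpa using sq_eq_of_map_eq_sqrt ι hs
  have h4 := le_of_pow_eq_unitThree ι conj hconj hn hs hζ hd hz (Or.inl rfl) hzd
  have h124 : d = 1 ∨ d = 2 ∨ d = 4 := by
    have : d ≤ 4 := Nat.le_of_dvd (by norm_num) h4
    interval_cases d <;> simp_all
  rcases h124 with rfl | rfl | rfl
  · split_ifs <;> norm_num
  · rw [if_pos hd]
    split_ifs <;> norm_num
  · rw [if_pos]
    refine eight_dvd_of_sq_eq_unitThree hn hζ hs2 hz (sq_eq_sq_iff_eq_or_eq_neg.1 ?_)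
    rw [← hzd]
    ring

theorem le_of_pow_eq_neg_unitThree_cube {n d : ℕ} (hn : 0 < n) {s ζ z : Ω}
    (hs : ι s = ((√((3 : ℕ) : ℝ) : ℝ) : ℂ)) (hζ : ζ ^ n = 1) (hd : d ∣ n)
    (hz : z ∈ adjoin ℚ {s, ζ}) (hzd : z ^ d = -(2 + s) ^ 3) :
    d ≤ (if 3 ∣ n then 3 else 1) * if 8 ∣ n then 2 else 1 := by
  have hs2 : s ^ 2 = 3 := by simpa using sq_eq_of_map_eq_sqrt ι hs
  have hu : (2 + s) * (2 - s) = 1 := by linear_combination -hs2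
  have hu0 : 2 + s ≠ 0 := left_ne_zero_of_mul_eq_one hu
  have h6 := le_of_pow_eq_unitThree ι conj hconj hn hs hζ hd hz (Or.inr rfl) hzd
  -- If `d = 2k`, then `z ^ k / (2 + s)` squares to `-(2 + s)`.
  have h8 : 2 ∣ d → 8 ∣ n := by
    rintro ⟨k, rfl⟩
    refine eight_dvd_of_sq_eq_unitThree (z := z ^ k / (2 + s)) hn hζ hs2
      (div_mem (pow_mem hz k) (add_mem (ofNat_mem _ 2) (subset_adjoin ℚ _ (by simp))))
      (Or.inr ?_)
    rw [div_pow, ← pow_mul, mul_comm k, hzd, div_eq_iff (pow_ne_zero 2 hu0)]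
    ring
  have h1236 : d = 1 ∨ d = 2 ∨ d = 3 ∨ d = 6 := by
    have : d ≤ 6 := Nat.le_of_dvd (by norm_num) h6
    interval_cases d <;> simp_all
  rcases h1236 with rfl | rfl | rfl | rfl
  · split_ifs <;> norm_num
  · rw [if_pos (h8 dvd_rfl)]
    split_ifs <;> norm_num
  · rw [if_pos hd]
    split_ifs <;> norm_num
  · rw [if_pos (h8 (by norm_num)), if_pos (by omega)]

theorem kummer_unitFive {n : ℕ} (hn : 0 < n) {s ζ ρ : Ω}
    (hs : ι s = ((√((5 : ℕ) : ℝ) : ℝ) : ℂ)) (hζ : IsPrimitiveRoot ζ n)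
    (hρ : ρ ^ n = -((1 + s) / 2) ^ 2) :
    Module.finrank ℚ (adjoin ℚ {s, ζ, ρ}) * (if 4 ∣ n then 2 else 1) =
      n.totient * (if 5 ∣ n then 1 else 2) * n ∧
    ((∃ g : Ω ≃ₐ[ℚ] Ω, g ζ = ζ⁻¹ ∧ g ρ = ρ⁻¹) ↔ ¬ 5 ∣ n ∧ ¬ 4 ∣ n) := by
  have : CharZero Ω := algebraRat.charZero Ω
  have hs2 : s ^ 2 = 5 := by simpa using sq_eq_of_map_eq_sqrt ι hs
  have hs2' : s ^ 2 = algebraMap ℚ Ω 5 := by simpa using hs2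
  have hs0 : s ≠ 0 := by
    rintro rfl
    norm_num at hs2
  have hsr := conj_eq_self_of_real ι conj hconj hs
  have hu : (1 + s) / 2 * ((s - 1) / 2) = 1 := by linear_combination hs2 / 4
  have hu0 : (1 + s) / 2 ≠ 0 := left_ne_zero_of_mul_eq_one hu
  have hγ0 : -((1 + s) / 2) ^ 2 ≠ 0 := neg_ne_zero.2 (pow_ne_zero 2 hu0)
  have hsL : s ∈ adjoin ℚ {s, ζ} := subset_adjoin ℚ _ (by simp)
  have hgL : (1 + s) / 2 ∈ adjoin ℚ {s, ζ} :=
    div_mem (add_mem (one_mem _) hsL) (ofNat_mem _ 2)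
  have hmax := fun d' hd' z hz hzd =>
    le_of_pow_eq_neg_unitFive_sq (d := d') (z := z) ι conj hconj hn hs hζ.pow_eq_one hd' hz hzd
  have hL : Module.finrank ℚ (adjoin ℚ {s, ζ}) = n.totient * (if 5 ∣ n then 1 else 2) := by
    have h1 := finrank_adjoin_sqrt_zeta hn hζ hs0 hs2'
    rw [mem_adjoin_zeta_iff_five_dvd hn hζ hs2] at h1
    split_ifs with h5
    · rw [h1.1 h5, mul_one]
    · exact h1.2 h5
  rw [← hL]
  by_cases h4 : 4 ∣ n
  · simp only [h4, if_true] at hmax ⊢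
    obtain ⟨x, hx, hx2, hxg⟩ := exists_mem_adjoin_zeta_I hn h4 hζ
    -- When `4 ∣ n` the square root of `γ = -ε²` in `L` is `iε`.
    have hy : x * ((1 + s) / 2) ∈ adjoin ℚ {s, ζ} :=
      mul_mem (adjoin.mono ℚ _ _ (by simp) hx) hgL
    have hyd : (x * ((1 + s) / 2)) ^ 2 = -((1 + s) / 2) ^ 2 := by
      rw [mul_pow, hx2, neg_one_mul]
    have h2n : 2 ∣ n := by omega
    refine ⟨finrank_adjoin_root_mul hn hζ hγ0 hρ h2n hy hyd hmax, ?_⟩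
    rw [exists_algEquiv_inv_iff hn hζ hγ0 hρ h2n hy hyd hmax]
    refine ⟨?_, fun h => absurd trivial h.2⟩
    rintro ⟨g, h1, h2⟩
    exfalso
    have hy0 : x * ((1 + s) / 2) ≠ 0 := by
      intro h0
      rw [h0, zero_pow two_ne_zero] at hyd
      exact hγ0 hyd.symm
    have h3 : g (x * ((1 + s) / 2)) * (x * ((1 + s) / 2)) = 1 := by rw [h2, inv_mul_cancel₀ hy0]
    -- As `g` negates `i`, `g(y) y = g(ε) ε`, which is `ε²` or `-1` and never `1`: no inversion
    -- exists when `4 ∣ n`.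
    rw [map_mul, hxg g h1, map_div₀, map_add, map_one, map_ofNat] at h3
    rcases map_eq_or_eq_neg hs2' g with h | h
    · rw [h] at h3
      have h5 : s = -1 := by linear_combination 2 * h3 + (1 + s) ^ 2 / 2 * hx2 - hs2 / 2
      rw [h5] at hs2
      norm_num at hs2
    · rw [h] at h3
      have h5 : (2 : Ω) = 0 := by linear_combination -h3 - (1 - s ^ 2) / 4 * hx2 - hs2 / 4
      norm_num at h5
  · simp only [h4, if_false] at hmax ⊢
    -- Here `d = 1` and `y = γ`. Since `γ` has norm `1`, inverting it means negating `s`, which is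
    -- compatible with inverting `ζ` exactly when `s ∉ ℚ(ζ)`, that is `5 ∤ n`.
    have hy : -((1 + s) / 2) ^ 2 ∈ adjoin ℚ {s, ζ} := neg_mem (pow_mem hgL 2)
    refine ⟨finrank_adjoin_root_mul hn hζ hγ0 hρ (one_dvd n) hy (pow_one _) hmax, ?_⟩
    rw [exists_algEquiv_inv_iff hn hζ hγ0 hρ (one_dvd n) hy (pow_one _) hmax]
    constructor
    · rintro ⟨g, h1, h2⟩
      refine ⟨fun h5 => ?_, not_false⟩
      rw [← mem_adjoin_zeta_iff_five_dvd hn hζ hs2] at h5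
      have h := map_eq_self_of_mem_adjoin_zeta ι conj hconj hn hζ.pow_eq_one hsr h5 h1
      have h3 : g (-((1 + s) / 2) ^ 2) * -((1 + s) / 2) ^ 2 = 1 := by
        rw [h2, inv_mul_cancel₀ hγ0]
      simp only [map_neg, map_pow, map_div₀, map_add, map_one, map_ofNat, h] at h3
      have h6 : s = -(5 / 3) := by
        linear_combination (2 / 3) * h3 - (s ^ 2 + 4 * s + 11) / 24 * hs2
      rw [h6] at hs2
      norm_num at hs2
    · rintro ⟨h5, -⟩
      obtain ⟨g, h1, h2⟩ := exists_inv_and_neg ι conj hconj hn hζ.pow_eq_one hsr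
        (exists_algEquiv_neg_sqrt_five hn h5 hζ.pow_eq_one hs2)
      refine ⟨g, h1, eq_inv_of_mul_eq_one_left ?_⟩
      simp only [map_neg, map_pow, map_div₀, map_add, map_one, map_ofNat, h2]
      linear_combination (s ^ 2 + 3) / 16 * hs2

/-- `2 + s` has norm `1` and infinite order, so inverting a signed positive power of it amounts to
negating `s`. This can be combined with `ζ ↦ ζ⁻¹` exactly when `s ∉ ℚ(ζ)`. -/
theorem exists_algEquiv_inv_unitThree_pow_iff {n k : ℕ} (hn : 0 < n) (hk : 0 < k) {s ζ y : Ω}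
    (hs : ι s = ((√((3 : ℕ) : ℝ) : ℝ) : ℂ)) (hζ : IsPrimitiveRoot ζ n)
    (hy : y = (2 + s) ^ k ∨ y = -(2 + s) ^ k) :
    (∃ g : Ω ≃ₐ[ℚ] Ω, g ζ = ζ⁻¹ ∧ g y = y⁻¹) ↔ ¬ 12 ∣ n := by
  have hs2 : s ^ 2 = 3 := by simpa using sq_eq_of_map_eq_sqrt ι hs
  have hsr := conj_eq_self_of_real ι conj hconj hs
  have hu : (2 - s) * (2 + s) = 1 := by linear_combination -hs2
  have hu0 : 2 + s ≠ 0 := right_ne_zero_of_mul_eq_one hu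
  constructor
  · rintro ⟨g, h1, h2⟩ h12
    rw [← mem_adjoin_zeta_iff_twelve_dvd hn hζ hs2] at h12
    have h := map_eq_self_of_mem_adjoin_zeta ι conj hconj hn hζ.pow_eq_one hsr h12 h1
    have hy2 : y * y = ((2 + s) ^ k) ^ 2 := by
      rcases hy with rfl | rfl <;> ring
    have hgy : g y = y := by
      rcases hy with rfl | rfl <;> simp [h, map_ofNat g 2]
    rw [hgy] at h2
    have hy0 : y ≠ 0 := by
      rintro rfl
      rw [mul_zero] at hy2
      exact pow_ne_zero _ (pow_ne_zero _ hu0) hy2.symm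
    have h3 : y * y = 1 := by
      nth_rewrite 1 [h2]
      exact inv_mul_cancel₀ hy0
    exact unitThree_pow_ne_one ι (k := k * 2) (by omega) hs (by rw [pow_mul, ← hy2, h3])
  · intro h12
    obtain ⟨g, h1, h2⟩ := exists_inv_and_neg ι conj hconj hn hζ.pow_eq_one hsr
      (exists_algEquiv_neg_sqrt_three hn h12 hζ.pow_eq_one hs2)
    refine ⟨g, h1, eq_inv_of_mul_eq_one_left ?_⟩
    have h3 : g ((2 + s) ^ k) * (2 + s) ^ k = 1 := by
      rw [map_pow, ← mul_pow, map_add, h2, map_ofNat, ← sub_eq_add_neg, hu, one_pow]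
    rcases hy with rfl | rfl
    · exact h3
    · rw [map_neg, neg_mul_neg, h3]

theorem kummer_unitThree_sq {n : ℕ} (hn : 0 < n) {s ζ ρ : Ω}
    (hs : ι s = ((√((3 : ℕ) : ℝ) : ℝ) : ℂ)) (hζ : IsPrimitiveRoot ζ n)
    (hρ : ρ ^ n = (2 + s) ^ 2) :
    Module.finrank ℚ (adjoin ℚ {s, ζ, ρ}) * (if 8 ∣ n then 4 else if 2 ∣ n then 2 else 1) =
      n.totient * (if 12 ∣ n then 1 else 2) * n ∧
    ((∃ g : Ω ≃ₐ[ℚ] Ω, g ζ = ζ⁻¹ ∧ g ρ = ρ⁻¹) ↔ ¬ 12 ∣ n ∧ ¬ 8 ∣ n) := by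
  have : CharZero Ω := algebraRat.charZero Ω
  have hs2 : s ^ 2 = 3 := by simpa using sq_eq_of_map_eq_sqrt ι hs
  have hu : (2 - s) * (2 + s) = 1 := by linear_combination -hs2
  have hγ0 : (2 + s) ^ 2 ≠ 0 := pow_ne_zero 2 (right_ne_zero_of_mul_eq_one hu)
  have hsL : s ∈ adjoin ℚ {s, ζ} := subset_adjoin ℚ _ (by simp)
  have hgL : 2 + s ∈ adjoin ℚ {s, ζ} := add_mem (ofNat_mem _ 2) hsL
  have hmax := fun d' hd' z hz hzd =>
    le_of_pow_eq_unitThree_sq (d := d') (z := z) ι conj hconj hn hs hζ.pow_eq_one hd' hz hzd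
  rw [← finrank_adjoin_sqrt_three_zeta hn hs2 hζ]
  by_cases h8 : 8 ∣ n
  · simp only [h8, if_true] at hmax ⊢
    obtain ⟨w, hw, hw2, hwg⟩ := exists_mem_adjoin_zeta_sqrt_two hn h8 hζ
    have hw0 : w ≠ 0 := by
      rintro rfl
      norm_num at hw2
    -- `(1 + s)/√2` is a square root of `2 + s`, hence a fourth root of `γ`. The exponent `1` is
    -- kept to match the lemma on odd powers.
    have hy : ((1 + s) / w) ^ 1 ∈ adjoin ℚ {s, ζ} :=
      pow_mem (div_mem (add_mem (one_mem _) hsL) (adjoin.mono ℚ _ _ (by simp) hw)) 1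
    have hyd : (((1 + s) / w) ^ 1) ^ 4 = (2 + s) ^ 2 := by
      rw [pow_one, show ((1 + s) / w) ^ 4 = (((1 + s) / w) ^ 2) ^ 2 by ring, div_pow, hw2]
      congr 1
      linear_combination hs2 / 2
    have h4n : 4 ∣ n := by omega
    refine ⟨finrank_adjoin_root_mul hn hζ hγ0 hρ h4n hy hyd hmax, ?_⟩
    rw [exists_algEquiv_inv_iff hn hζ hγ0 hρ h4n hy hyd hmax]
    refine ⟨?_, fun h => absurd trivial h.2⟩
    rintro ⟨g, h1, h2⟩
    exact absurd h2 (map_pow_ne_inv_of_odd ι odd_one hs hw0 (by rw [hwg g h1, ← sq, hw2]))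
  · simp only [h8, if_false, not_false_iff, and_true] at hmax ⊢
    by_cases h2 : 2 ∣ n
    · simp only [h2, if_true] at hmax ⊢
      refine ⟨finrank_adjoin_root_mul hn hζ hγ0 hρ h2 hgL rfl hmax, ?_⟩
      rw [exists_algEquiv_inv_iff hn hζ hγ0 hρ h2 hgL rfl hmax]
      exact exists_algEquiv_inv_unitThree_pow_iff ι conj hconj hn one_pos hs hζ
        (Or.inl (pow_one _).symm)
    · simp only [h2, if_false] at hmax ⊢
      have hy := pow_mem hgL 2
      refine ⟨finrank_adjoin_root_mul hn hζ hγ0 hρ (one_dvd n) hy (pow_one _) hmax, ?_⟩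
      rw [exists_algEquiv_inv_iff hn hζ hγ0 hρ (one_dvd n) hy (pow_one _) hmax]
      exact exists_algEquiv_inv_unitThree_pow_iff ι conj hconj hn two_pos hs hζ (Or.inl rfl)

theorem kummer_unitThree_cube {n : ℕ} (hn : 0 < n) {s ζ ρ : Ω}
    (hs : ι s = ((√((3 : ℕ) : ℝ) : ℝ) : ℂ)) (hζ : IsPrimitiveRoot ζ n)
    (hρ : ρ ^ n = -(2 + s) ^ 3) :
    Module.finrank ℚ (adjoin ℚ {s, ζ, ρ}) *
        ((if 3 ∣ n then 3 else 1) * if 8 ∣ n then 2 else 1) =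
      n.totient * (if 12 ∣ n then 1 else 2) * n ∧
    ((∃ g : Ω ≃ₐ[ℚ] Ω, g ζ = ζ⁻¹ ∧ g ρ = ρ⁻¹) ↔ ¬ 12 ∣ n ∧ ¬ 8 ∣ n) := by
  have : CharZero Ω := algebraRat.charZero Ω
  have hs2 : s ^ 2 = 3 := by simpa using sq_eq_of_map_eq_sqrt ι hs
  have hu : (2 - s) * (2 + s) = 1 := by linear_combination -hs2
  have hγ0 : -(2 + s) ^ 3 ≠ 0 := neg_ne_zero.2 (pow_ne_zero 3 (right_ne_zero_of_mul_eq_one hu))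
  have hsL : s ∈ adjoin ℚ {s, ζ} := subset_adjoin ℚ _ (by simp)
  have hgL : 2 + s ∈ adjoin ℚ {s, ζ} := add_mem (ofNat_mem _ 2) hsL
  have hmax := fun d' hd' z hz hzd =>
    le_of_pow_eq_neg_unitThree_cube (d := d') (z := z) ι conj hconj hn hs hζ.pow_eq_one hd' hz hzd
  rw [← finrank_adjoin_sqrt_three_zeta hn hs2 hζ]
  by_cases h8 : 8 ∣ n
  · simp only [h8, if_true, not_true, and_false, iff_false] at hmax ⊢
    obtain ⟨w, hw, hw2, hwg⟩ := exists_mem_adjoin_zeta_sqrt_neg_two hn h8 hζ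
    have hw0 : w ≠ 0 := by
      rintro rfl
      norm_num at hw2
    have hy1 : (1 + s) / w ∈ adjoin ℚ {s, ζ} :=
      div_mem (add_mem (one_mem _) hsL) (adjoin.mono ℚ _ _ (by simp) hw)
    have hyd1 : ((1 + s) / w) ^ 2 = -(2 + s) := by
      rw [div_pow, hw2]
      linear_combination -hs2 / 2
    -- `v = (1 + s)/√-2` has `v² = -(2 + s)`, so `v ^ 6 = γ`. If `3 ∣ n` take `y = v` and `d = 6`;
    -- otherwise `y = v³` and `d = 2`.
    obtain ⟨k, hk, hdn, hyd⟩ : ∃ k, Odd k ∧ (if 3 ∣ n then 3 else 1) * 2 ∣ n ∧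
        (((1 + s) / w) ^ k) ^ ((if 3 ∣ n then 3 else 1) * 2) = -(2 + s) ^ 3 := by
      by_cases h3 : 3 ∣ n
      · rw [if_pos h3]
        refine ⟨1, odd_one, by omega, ?_⟩
        rw [pow_one, mul_comm, pow_mul, hyd1]
        ring
      · rw [if_neg h3]
        refine ⟨3, by decide, by omega, ?_⟩
        rw [one_mul, ← pow_mul, mul_comm, pow_mul, hyd1]
        ring
    refine ⟨finrank_adjoin_root_mul hn hζ hγ0 hρ hdn (pow_mem hy1 k) hyd hmax, ?_⟩
    rw [exists_algEquiv_inv_iff hn hζ hγ0 hρ hdn (pow_mem hy1 k) hyd hmax]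
    rintro ⟨g, h1, h2⟩
    exact map_pow_ne_inv_of_odd ι hk hs hw0 (by rw [hwg g h1]; linear_combination -hw2) h2
  · simp only [h8, if_false, not_false_iff, and_true, mul_one] at hmax ⊢
    -- Without `√-2` only the cube root `-(2 + s)` of `γ` is available, and only when `3 ∣ n`;
    -- otherwise `y = γ`.
    obtain ⟨k, hk, hdn, hyd⟩ : ∃ k, 0 < k ∧ (if 3 ∣ n then 3 else 1) ∣ n ∧
        (-(2 + s) ^ k) ^ (if 3 ∣ n then 3 else 1) = -(2 + s) ^ 3 := by
      by_cases h3 : 3 ∣ n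
      · rw [if_pos h3]
        exact ⟨1, one_pos, h3, by ring⟩
      · rw [if_neg h3]
        exact ⟨3, by norm_num, one_dvd n, by ring⟩
    have hy := neg_mem (pow_mem hgL k)
    refine ⟨finrank_adjoin_root_mul hn hζ hγ0 hρ hdn hy hyd hmax, ?_⟩
    rw [exists_algEquiv_inv_iff hn hζ hγ0 hρ hdn hy hyd hmax]
    exact exists_algEquiv_inv_unitThree_pow_iff ι conj hconj hn hk hs hζ (Or.inr rfl)

end Conj

/-! ### Counting inversions and transport to the fields `K_n` -/

section Transfer

variable {F : Type*} [Field F]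

/-- The automorphisms of a field `E` that are trivial or invert two given elements. -/
def inversions (F : Type*) [Field F] {E : Type*} [Field E] [Algebra F E] (x y : E) : Set (E ≃ₐ[F] E) :=
  {σ | σ = AlgEquiv.refl ∨ (σ x = x⁻¹ ∧ σ y = y⁻¹)}

/-- Because `γ = ρ ^ n` lies in `F(s)` and `γ² ≠ 1`, inverting `ρ` forces `s ↦ -s`. Hence an
inversion is determined on all generators, maps `E` onto itself, and is not the identity: there is
at most one besides the identity, and it comes from the closure. -/
theorem ncard_inversions {Ω : Type*} [Field Ω] [Algebra F Ω] [IsAlgClosed Ω]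
    [Algebra.IsAlgebraic F Ω] {D : F} {s ζ ρ : Ω} (hs : s ^ 2 = algebraMap F Ω D) {n : ℕ}
    (hγ : ρ ^ n ∈ adjoin F {s}) (hγ2 : (ρ ^ n) ^ 2 ≠ 1) (hρ0 : ρ ≠ 0)
    {E : IntermediateField F Ω} (hE : E = adjoin F {s, ζ, ρ}) {z r : E} (hz : (z : Ω) = ζ) (hr : (r : Ω) = ρ) :
    ((∃ g : Ω ≃ₐ[F] Ω, g ζ = ζ⁻¹ ∧ g ρ = ρ⁻¹) → (inversions F z r).ncard = 2) ∧
    ((¬ ∃ g : Ω ≃ₐ[F] Ω, g ζ = ζ⁻¹ ∧ g ρ = ρ⁻¹) → (inversions F z r).ncard = 1) := by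
  have : IsAlgClosure F Ω := ⟨inferInstance, inferInstance⟩
  have : Normal F Ω := IsAlgClosure.normal F Ω
  have hsE : s ∈ E := hE ▸ subset_adjoin F _ (by simp)
  have hζE : ζ ∈ E := hE ▸ subset_adjoin F _ (by simp)
  have hρE : ρ ∈ E := hE ▸ subset_adjoin F _ (by simp)
  have hlift : ∀ σ : E ≃ₐ[F] E, σ z = z⁻¹ ∧ σ r = r⁻¹ →
      ∃ g : Ω ≃ₐ[F] Ω, g ζ = ζ⁻¹ ∧ g ρ = ρ⁻¹ ∧ ∀ x : E, g x = σ x := by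
    rintro σ ⟨h1, h2⟩
    have hg : ∀ x : E, σ.liftNormal Ω x = σ x := fun x => σ.liftNormal_commutes Ω x
    refine ⟨σ.liftNormal Ω, ?_, ?_, hg⟩
    · rw [← hz, hg, h1]
      rfl
    · rw [← hr, hg, h2]
      rfl
  have hneg : ∀ g : Ω ≃ₐ[F] Ω, g ρ = ρ⁻¹ → g s = -s := by
    intro g hg
    refine (map_eq_or_eq_neg hs g).resolve_left fun h => hγ2 ?_
    have h1 := algEquiv_eq_of_mem_adjoin (σ := g) (τ := AlgEquiv.refl) (by simpa using h) hγ
    rw [map_pow, hg, AlgEquiv.coe_refl, id] at h1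
    rw [sq]
    nth_rewrite 1 [← h1]
    rw [← mul_pow, inv_mul_cancel₀ hρ0, one_pow]
  constructor
  · rintro ⟨g, h1, h2⟩
    have hgs := hneg g h2
    have hmap : E.map g.toAlgHom = E := by
      rw [hE, adjoin_map, ← hE]
      refine le_antisymm (adjoin_le_iff.2 ?_) (hE.le.trans (adjoin_le_iff.2 ?_))
      · rintro _ ⟨x, (rfl | rfl | rfl), rfl⟩
        · change g x ∈ E
          rw [hgs]
          exact neg_mem hsE
        · change g x ∈ E
          rw [h1]
          exact inv_mem hζE
        · change g x ∈ E
          rw [h2]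
          exact inv_mem hρE
      · have hs' : g s ∈ adjoin F (g.toAlgHom '' {s, ζ, ρ}) :=
          subset_adjoin F _ ⟨s, by simp, rfl⟩
        have hζ' : g ζ ∈ adjoin F (g.toAlgHom '' {s, ζ, ρ}) :=
          subset_adjoin F _ ⟨ζ, by simp, rfl⟩
        have hρ' : g ρ ∈ adjoin F (g.toAlgHom '' {s, ζ, ρ}) :=
          subset_adjoin F _ ⟨ρ, by simp, rfl⟩
        rw [hgs] at hs'
        rw [h1] at hζ'
        rw [h2] at hρ'
        rintro x (rfl | rfl | rfl)
        · exact neg_mem_iff.1 hs'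
        · exact inv_mem_iff.1 hζ'
        · exact inv_mem_iff.1 hρ'
    let σ : E ≃ₐ[F] E := (intermediateFieldMap g E).trans (equivOfEq hmap)
    have hσ : ∀ x : E, (σ x : Ω) = g x := fun x => rfl
    have hσz : σ z = z⁻¹ := Subtype.ext (by
      rw [hσ, hz, h1, ← hz]
      rfl)
    have hσr : σ r = r⁻¹ := Subtype.ext (by
      rw [hσ, hr, h2, ← hr]
      rfl)
    have hne : AlgEquiv.refl ≠ σ := by
      intro h
      have h3 := hσ r
      rw [← h, hr, h2] at h3
      have h4 : ρ = ρ⁻¹ := by rw [← h3, ← hr]; rfl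
      refine hγ2 ?_
      have h5 : ρ ^ 2 = 1 := by
        rw [sq]
        nth_rewrite 1 [h4]
        exact inv_mul_cancel₀ hρ0
      rw [← pow_mul, mul_comm, pow_mul, h5, one_pow]
    have hset : inversions F z r = {AlgEquiv.refl, σ} := by
      ext τ
      simp only [inversions, Set.mem_ofPred_eq, Set.mem_insert_iff, Set.mem_singleton_iff]
      refine or_congr_right ⟨fun h => ?_, fun h => h ▸ ⟨hσz, hσr⟩⟩
      obtain ⟨g', h1', h2', h3'⟩ := hlift τ h
      refine AlgEquiv.ext fun x => Subtype.ext ?_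
      rw [hσ, ← h3']
      refine algEquiv_eq_of_mem_adjoin ?_ (hE.le x.2)
      rintro y (rfl | rfl | rfl)
      · rw [hneg g' h2', hgs]
      · rw [h1', h1]
      · rw [h2', h2]
    rw [hset, Set.ncard_pair hne]
  · intro hno
    have hset : inversions F z r = {AlgEquiv.refl} := by
      ext τ
      simp only [inversions, Set.mem_ofPred_eq, Set.mem_singleton_iff]
      refine ⟨fun h => h.resolve_right fun h' => ?_, Or.inl⟩
      obtain ⟨g, h1, h2, -⟩ := hlift τ h'
      exact hno ⟨g, h1, h2⟩
    rw [hset, Set.ncard_singleton]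

theorem ncard_inversions_map {E E' : Type*} [Field E] [Algebra F E] [Field E'] [Algebra F E']
    (e : E ≃ₐ[F] E') (x y : E) : (inversions F (e x) (e y)).ncard = (inversions F x y).ncard := by
  have : inversions F (e x) (e y) = e.autCongr '' inversions F x y := by
    ext τ
    constructor
    · rintro (h | ⟨h1, h2⟩)
      · exact ⟨AlgEquiv.refl, Or.inl rfl, by
          rw [h]
          exact AlgEquiv.ext e.apply_symm_apply⟩
      · refine ⟨e.autCongr.symm τ, Or.inr ⟨?_, ?_⟩, e.autCongr.apply_symm_apply τ⟩
        · change e.symm (τ (e x)) = x⁻¹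
          rw [h1, map_inv₀, AlgEquiv.symm_apply_apply]
        · change e.symm (τ (e y)) = y⁻¹
          rw [h2, map_inv₀, AlgEquiv.symm_apply_apply]
    · rintro ⟨σ, (h | ⟨h1, h2⟩), rfl⟩
      · left
        rw [h]
        exact AlgEquiv.ext e.apply_symm_apply
      · right
        constructor
        · change e (σ (e.symm (e x))) = (e x)⁻¹
          rw [AlgEquiv.symm_apply_apply, h1, map_inv₀]
        · change e (σ (e.symm (e y))) = (e y)⁻¹
          rw [AlgEquiv.symm_apply_apply, h2, map_inv₀]
  rw [this, Set.ncard_image_of_injective _ e.autCongr.injective]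

theorem finrank_of_map_eq {Ω L : Type*} [Field Ω] [Algebra F Ω] [Field L] [Algebra F L]
    (ι : Ω →ₐ[F] L) {E : IntermediateField F Ω} {E' : IntermediateField F L}
    (hE : E.map ι = E') : Module.finrank F E' = Module.finrank F E :=
  ((equivMap E ι).trans (equivOfEq hE)).toLinearEquiv.finrank_eq.symm

theorem ncard_inversions_of_map_eq {Ω L : Type*} [Field Ω] [Algebra F Ω] [Field L] [Algebra F L]
    (ι : Ω →ₐ[F] L) {E : IntermediateField F Ω} {E' : IntermediateField F L}
    (hE : E.map ι = E') {z r : E} {z' r' : E'} (hz : (z' : L) = ι z) (hr : (r' : L) = ι r) :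
    (inversions F z' r').ncard = (inversions F z r).ncard := by
  let e : E ≃ₐ[F] E' := (equivMap E ι).trans (equivOfEq hE)
  have h1 : z' = e z := Subtype.ext hz
  have h2 : r' = e r := Subtype.ext hr
  rw [h1, h2, ncard_inversions_map]

theorem density_eq {Ω : Type*} [Field Ω] [Algebra ℚ Ω] [IsAlgClosed Ω]
    [Algebra.IsAlgebraic ℚ Ω] (ι : Ω →ₐ[ℚ] ℂ) {a₁ a₂ : ℤ} {n : ℕ} {q D : ℚ} (hq : q ≠ 0) {s ζ ρ : Ω}
    (hs : sqrtDisc a₁ a₂ = algebraMap ℚ ℂ q * ι s) (hζ : ι ζ = zeta n)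
    (hρ : ι ρ = gammaRoot a₁ a₂ n) (hs2 : s ^ 2 = algebraMap ℚ Ω D)
    (hγ : ρ ^ n ∈ adjoin ℚ {s}) (hγ2 : (ρ ^ n) ^ 2 ≠ 1) (hρ0 : ρ ≠ 0) :
    ((∃ g : Ω ≃ₐ[ℚ] Ω, g ζ = ζ⁻¹ ∧ g ρ = ρ⁻¹) →
      density a₁ a₂ n = 2 / (Module.finrank ℚ (adjoin ℚ {s, ζ, ρ}) : ℚ)) ∧
    ((¬ ∃ g : Ω ≃ₐ[ℚ] Ω, g ζ = ζ⁻¹ ∧ g ρ = ρ⁻¹) →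
      density a₁ a₂ n = 1 / (Module.finrank ℚ (adjoin ℚ {s, ζ, ρ}) : ℚ)) := by
  have hqC : algebraMap ℚ ℂ q ≠ 0 := by simpa using hq
  have hE : (adjoin ℚ {s, ζ, ρ}).map ι = fieldKn a₁ a₂ n := by
    rw [adjoin_map, fieldKn, Set.image_insert_eq, Set.image_pair, hζ, hρ]
    refine le_antisymm (adjoin_le_iff.2 ?_) (adjoin_le_iff.2 ?_)
    · rintro x (rfl | rfl | rfl)
      · have h1 : ι s = (algebraMap ℚ ℂ q)⁻¹ * sqrtDisc a₁ a₂ := by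
          rw [hs, inv_mul_cancel_left₀ hqC]
        rw [h1]
        exact mul_mem (inv_mem (IntermediateField.algebraMap_mem _ q))
          (subset_adjoin ℚ _ (by simp))
      · exact subset_adjoin ℚ _ (by simp)
      · exact subset_adjoin ℚ _ (by simp)
    · rintro x (rfl | rfl | rfl)
      · rw [hs]
        exact mul_mem (IntermediateField.algebraMap_mem _ q) (subset_adjoin ℚ _ (by simp))
      · exact subset_adjoin ℚ _ (by simp)
      · exact subset_adjoin ℚ _ (by simp)
  let z : adjoin ℚ {s, ζ, ρ} := ⟨ζ, subset_adjoin ℚ _ (by simp)⟩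
  let r : adjoin ℚ {s, ζ, ρ} := ⟨ρ, subset_adjoin ℚ _ (by simp)⟩
  have hmap := ncard_inversions_of_map_eq ι hE (z := z) (r := r) (z' := zetaK a₁ a₂ n)
    (r' := gammaRootK a₁ a₂ n) hζ.symm hρ.symm
  have hset := Eq.trans (show (setC a₁ a₂ n).ncard = _ by unfold setC inversions; congr!) hmap
  have hfr : Module.finrank ℚ (fieldKn a₁ a₂ n) = Module.finrank ℚ (adjoin ℚ {s, ζ, ρ}) := by
    rw [← finrank_of_map_eq ι hE]
  have hc := ncard_inversions (z := z) (r := r) hs2 hγ hγ2 hρ0 rfl rfl rfl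
  rw [density, hfr, hset]
  exact ⟨fun h => by rw [hc.1 h]; norm_num, fun h => by rw [hc.2 h]; norm_num⟩

end Transfer

/-! ### The exponent `h` -/

theorem isExponent_iff {a₁ a₂ : ℤ} {D H : ℕ} {q : ℚ} (hq : q ≠ 0) {g : ℝ}
    (hs : sqrtDisc a₁ a₂ = algebraMap ℚ ℂ q * ((√(D : ℝ) : ℝ) : ℂ)) (hg : 1 < g)
    (hgS : g ∈ adjoin ℚ {√(D : ℝ)}) (hH : 0 < H)
    (hnp : ∀ v ∈ adjoin ℚ {√(D : ℝ)}, ∀ k : ℕ, 2 ≤ k → v ^ k ≠ g ∧ v ^ k ≠ -g)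
    (hγ : gamma a₁ a₂ = (g : ℂ) ^ H ∨ gamma a₁ a₂ = -(g : ℂ) ^ H) (h : ℕ) :
    IsExponent a₁ a₂ h ↔ h = H := by
  have hqC : algebraMap ℚ ℂ q ≠ 0 := by simpa using hq
  have hg0 : 0 < g := zero_lt_one.trans hg
  let j : ℝ →ₐ[ℚ] ℂ := Complex.ofRealAm.restrictScalars ℚ
  have hj : ∀ x : ℝ, j x = (x : ℂ) := fun x => rfl
  have hK : fieldK a₁ a₂ = (adjoin ℚ {√(D : ℝ)}).map j := by
    rw [adjoin_map, fieldK, Set.image_singleton, hs, hj]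
    refine le_antisymm (adjoin_simple_le_iff.2 ?_) (adjoin_simple_le_iff.2 ?_)
    · exact mul_mem (IntermediateField.algebraMap_mem _ q) (mem_adjoin_simple_self ℚ _)
    · have := mul_mem (inv_mem (IntermediateField.algebraMap_mem
        (adjoin ℚ {algebraMap ℚ ℂ q * ((√(D : ℝ) : ℝ) : ℂ)}) q)) (mem_adjoin_simple_self ℚ _)
      rwa [inv_mul_cancel_left₀ hqC] at this
  constructor
  · rintro ⟨hh, ε, hε, γ₀, hγ₀, hpow, hnp'⟩
    rw [hK] at hγ₀ hnp'
    obtain ⟨x, hx, rfl⟩ := hγ₀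
    have hx : x ∈ adjoin ℚ {√(D : ℝ)} := hx
    have hεn : ‖(ε : ℂ)‖ = 1 := by rcases hε with rfl | rfl <;> simp
    have h1 : |x| ^ h = g ^ H := by
      have h2 : ‖gamma a₁ a₂‖ = g ^ H := by
        rcases hγ with h | h <;> simp [h, abs_of_pos hg0]
      have h3 : ‖gamma a₁ a₂‖ = |x| ^ h := by
        rw [hpow, norm_mul, hεn, one_mul, norm_pow]
        congr 1
        exact Complex.norm_real x
      rw [← h3, h2]
    have hxS : |x| ∈ adjoin ℚ {√(D : ℝ)} := by
      rcases abs_choice x with h | h <;> rw [h]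
      · exact hx
      · exact neg_mem hx
    have hx0 : 0 < |x| := by
      refine lt_of_le_of_ne (abs_nonneg x) fun h0 => ?_
      rw [← h0, zero_pow hh.ne'] at h1
      exact (pow_pos hg0 H).ne h1
    have hnpx : ∀ v ∈ adjoin ℚ {√(D : ℝ)}, ∀ k : ℕ, 2 ≤ k → v ^ k ≠ |x| := by
      intro v hv k hk hvk
      have h2 := hnp' (j v) ⟨v, hv, rfl⟩ k hk
      rcases abs_choice x with h | h <;> rw [h] at hvk
      · exact h2.1 (by rw [← map_pow, hvk]; rfl)
      · refine h2.2 ?_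
        rw [← map_pow, hvk, map_neg]
        rfl
    -- `|x| ^ h = g ^ H` and neither base is a perfect power, so each exponent divides the other.
    exact Nat.dvd_antisymm
      (dvd_of_pow_eq_pow hgS hxS hg0 hx0 (fun v hv k hk => (hnp v hv k hk).1) hh h1)
      (dvd_of_pow_eq_pow hxS hgS hx0 hg0 hnpx hH h1.symm)
  · rintro rfl
    have hnp' : ∀ δ ∈ fieldK a₁ a₂, ∀ k : ℕ, 2 ≤ k → δ ^ k ≠ (g : ℂ) ∧ δ ^ k ≠ -(g : ℂ) := by
      rw [hK]
      rintro _ ⟨v, hv, rfl⟩ k hk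
      have h1 := hnp v hv k hk
      have h2 : (j : ℝ →+* ℂ) v = (v : ℂ) := rfl
      refine ⟨fun h => h1.1 ?_, fun h => h1.2 ?_⟩
      · rw [h2] at h
        exact_mod_cast h
      · rw [h2] at h
        exact_mod_cast h
    have hgK : (g : ℂ) ∈ fieldK a₁ a₂ := by
      rw [hK]
      exact ⟨g, hgS, rfl⟩
    rcases hγ with h1 | h1
    · exact ⟨hH, 1, Or.inl rfl, g, hgK, by rw [h1]; simp, hnp'⟩
    · exact ⟨hH, -1, Or.inr rfl, g, hgK, by rw [h1]; simp, hnp'⟩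

/-! ### Reduction of the density to an abstract algebraic closure -/

/-- A model of the algebraic closure of `ℚ` inside `ℂ`, with complex conjugation. -/
theorem exists_algebraicClosure_model : ∃ (Ω : Type) (_ : Field Ω) (_ : Algebra ℚ Ω)
    (_ : IsAlgClosed Ω) (_ : Algebra.IsAlgebraic ℚ Ω) (ι : Ω →ₐ[ℚ] ℂ) (conj : Ω ≃ₐ[ℚ] Ω),
    (∀ x, ι (conj x) = starRingEnd ℂ (ι x)) ∧ ∀ z : ℂ, IsAlgebraic ℚ z → ∃ x, ι x = z := by
  refine ⟨algebraicClosure ℚ ℂ, inferInstance, (algebraicClosure ℚ ℂ).algebra',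
    (algebraicClosure.isAlgClosure ℚ ℂ).isAlgClosed, inferInstance, (algebraicClosure ℚ ℂ).val,
    algebraicClosure.algEquivOfAlgEquiv (Complex.conjAe.restrictScalars ℚ), fun x => rfl,
    fun z hz => ⟨⟨z, mem_algebraicClosure_iff.2 hz⟩, rfl⟩⟩

theorem zeta_isPrimitiveRoot {n : ℕ} (hn : 0 < n) : IsPrimitiveRoot (zeta n) n :=
  Complex.isPrimitiveRoot_exp n hn.ne'

theorem gammaRoot_pow (a₁ a₂ : ℤ) {n : ℕ} (hn : 0 < n) : gammaRoot a₁ a₂ n ^ n = gamma a₁ a₂ :=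
  Complex.cpow_nat_inv_pow _ hn.ne'

/-- The Kummer computation is requested for every algebraic closure with an embedding into `ℂ` and a
compatible conjugation. In the conclusion `a` is the Kummer exponent, `b = [K(ζ_n) : ℚ(ζ_n)]` in the
applications, and `P` decides whether `#C_n` is `2` or `1`. -/
theorem density_eq_of_model {a₁ a₂ : ℤ} {D : ℕ} {q u v : ℚ} (hq : q ≠ 0)
    (hs : sqrtDisc a₁ a₂ = algebraMap ℚ ℂ q * ((√(D : ℝ) : ℝ) : ℂ))
    (hγ : gamma a₁ a₂ = algebraMap ℚ ℂ u + algebraMap ℚ ℂ v * ((√(D : ℝ) : ℝ) : ℂ))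
    (hγ0 : gamma a₁ a₂ ≠ 0) (hγ2 : gamma a₁ a₂ ^ 2 ≠ 1) {n : ℕ} (hn : 0 < n)
    {P : Prop} [Decidable P] {a b : ℕ} (ha : a ≠ 0) (hb : b ≠ 0)
    (H : ∀ (Ω : Type) [Field Ω] [Algebra ℚ Ω] [IsAlgClosed Ω] [Algebra.IsAlgebraic ℚ Ω]
      (ι : Ω →ₐ[ℚ] ℂ) (conj : Ω ≃ₐ[ℚ] Ω), (∀ x, ι (conj x) = starRingEnd ℂ (ι x)) →
      ∀ s ζ ρ : Ω, ι s = ((√(D : ℝ) : ℝ) : ℂ) → IsPrimitiveRoot ζ n →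
      ρ ^ n = algebraMap ℚ Ω u + algebraMap ℚ Ω v * s →
      Module.finrank ℚ (adjoin ℚ {s, ζ, ρ}) * a = Nat.totient n * b * n ∧
      ((∃ g : Ω ≃ₐ[ℚ] Ω, g ζ = ζ⁻¹ ∧ g ρ = ρ⁻¹) ↔ P)) :
    density a₁ a₂ n = (if P then 2 else 1) * a / b / (Nat.totient n * n) := by
  obtain ⟨Ω, _, _, _, _, ι, conj, hconj, hex⟩ := exists_algebraicClosure_model
  have hι := algHom_injective ι
  have hsC : ((√(D : ℝ) : ℝ) : ℂ) ^ 2 = (D : ℂ) := by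
    rw [← Complex.ofReal_pow, Real.sq_sqrt (Nat.cast_nonneg D), Complex.ofReal_natCast]
  obtain ⟨s, hs'⟩ := hex ((√(D : ℝ) : ℝ) : ℂ)
    (IsAlgebraic.of_pow two_pos (by rw [hsC]; exact isAlgebraic_natCast D))
  obtain ⟨ζ, hζ⟩ := hex (zeta n) (IsAlgebraic.of_pow hn
    (by rw [(zeta_isPrimitiveRoot hn).pow_eq_one]; exact isAlgebraic_one))
  have hγs : gamma a₁ a₂ = ι (algebraMap ℚ Ω u + algebraMap ℚ Ω v * s) := by
    rw [map_add, map_mul, AlgHom.commutes, AlgHom.commutes, hs', hγ]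
  obtain ⟨ρ, hρ⟩ := hex (gammaRoot a₁ a₂ n) (IsAlgebraic.of_pow hn (by
    rw [gammaRoot_pow a₁ a₂ hn, hγs]
    exact (Algebra.IsAlgebraic.isAlgebraic _).algHom ι))
  have hζ' : IsPrimitiveRoot ζ n :=
    IsPrimitiveRoot.of_map_of_injective (f := ι) (by rw [hζ]; exact zeta_isPrimitiveRoot hn) hι
  have hρn : ρ ^ n = algebraMap ℚ Ω u + algebraMap ℚ Ω v * s :=
    hι (by rw [← hγs, map_pow, hρ, gammaRoot_pow a₁ a₂ hn])
  obtain ⟨h1, h2⟩ := H Ω ι conj hconj s ζ ρ hs' hζ' hρn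
  have hd := density_eq ι (D := D) hq (by rw [hs, hs']) hζ hρ
    (hι (by rw [map_pow, hs', hsC]; simp))
    (by
      rw [hρn]
      exact add_mem (IntermediateField.algebraMap_mem _ u)
        (mul_mem (IntermediateField.algebraMap_mem _ v) (mem_adjoin_simple_self ℚ s)))
    (fun h => hγ2 (by rw [hγs, ← hρn, ← map_pow, h, map_one]))
    (fun h => hγ0 (by rw [hγs, ← hρn, h, zero_pow hn.ne', map_zero]))
  have hφ : (Nat.totient n : ℚ) ≠ 0 := by exact_mod_cast (Nat.totient_pos.2 hn).ne'
  have hn' : (n : ℚ) ≠ 0 := by exact_mod_cast hn.ne'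
  have ha' : (a : ℚ) ≠ 0 := by exact_mod_cast ha
  have hb' : (b : ℚ) ≠ 0 := by exact_mod_cast hb
  have h3 : (Module.finrank ℚ (adjoin ℚ {s, ζ, ρ}) : ℚ) = Nat.totient n * b * n / a := by
    rw [eq_div_iff ha']
    exact_mod_cast h1
  rw [h3] at hd
  split_ifs with hP
  · rw [hd.1 (h2.2 hP)]
    field_simp
  · rw [hd.2 (fun h => hP (h2.1 h))]
    field_simp

/-! ### The three values of `γ` and the density formulas -/

theorem sqrtDisc_eq {a₁ a₂ : ℤ} {q D : ℕ} (h : disc a₁ a₂ = q ^ 2 * D) :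
    sqrtDisc a₁ a₂ = algebraMap ℚ ℂ q * ((√(D : ℝ) : ℝ) : ℂ) := by
  have h1 : ((disc a₁ a₂ : ℤ) : ℂ) = (((q : ℝ) ^ 2 * (D : ℝ) : ℝ) : ℂ) := by
    rw [h]
    push_cast
    rfl
  have h2 : ((2 : ℂ)⁻¹) = (((1 / 2 : ℝ)) : ℂ) := by norm_num
  rw [sqrtDisc, h1, h2, ← Complex.ofReal_cpow (by positivity), ← Real.sqrt_eq_rpow,
    Real.sqrt_mul (by positivity), Real.sqrt_sq (Nat.cast_nonneg q)]
  push_cast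
  simp

theorem gcd_four (n : ℕ) : Nat.gcd n 4 = if 4 ∣ n then 4 else if 2 ∣ n then 2 else 1 := by
  have h : ∀ r < 4, Nat.gcd r 4 = if 4 ∣ r then 4 else if 2 ∣ r then 2 else 1 := by decide
  rw [Nat.gcd_comm, Nat.gcd_rec, h _ (Nat.mod_lt n (by norm_num))]
  simp only [show 4 ∣ n % 4 ↔ 4 ∣ n by omega, show 2 ∣ n % 4 ↔ 2 ∣ n by omega]

theorem gcd_six (n : ℕ) :
    Nat.gcd n 6 = (if 2 ∣ n then 2 else 1) * (if 3 ∣ n then 3 else 1) := by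
  have h : ∀ r < 6, Nat.gcd r 6 = (if 2 ∣ r then 2 else 1) * (if 3 ∣ r then 3 else 1) := by decide
  rw [Nat.gcd_comm, Nat.gcd_rec, h _ (Nat.mod_lt n (by norm_num))]
  simp only [show 3 ∣ n % 6 ↔ 3 ∣ n by omega, show 2 ∣ n % 6 ↔ 2 ∣ n by omega]

/-- `αβ = -1`, so `γ = -α²` with `α` the golden ratio. -/
theorem gamma_fibonacci : gamma 1 1 = -((unitFive : ℝ) : ℂ) ^ 2 := by
  have hs := sqrtDisc_eq (a₁ := 1) (a₂ := 1) (q := 1) (D := 5) (by norm_num [disc])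
  have h1 : (unitFive : ℂ) = (1 + ((√((5 : ℕ) : ℝ) : ℝ) : ℂ)) / 2 := by
    rw [unitFive]
    push_cast
    rfl
  have h2 : ((√((5 : ℕ) : ℝ) : ℝ) : ℂ) ^ 2 = 5 := by
    rw [← Complex.ofReal_pow, sq_sqrt_five]
    norm_num
  have hβ : beta 1 1 ≠ 0 := by
    intro h
    rw [beta, hs] at h
    have h3 : ((√((5 : ℕ) : ℝ) : ℝ) : ℂ) = 1 := by
      simp only [Nat.cast_one, map_one, one_mul, Int.cast_one] at h
      linear_combination -2 * h
    rw [h3] at h2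
    norm_num at h2
  rw [gamma, div_eq_iff hβ, alpha, beta, hs, h1]
  simp only [Nat.cast_one, map_one, one_mul, Int.cast_one]
  generalize ((√((5 : ℕ) : ℝ) : ℝ) : ℂ) = w at h2
  linear_combination ((1 - w) / 8 - 1 / 4) * h2

theorem gamma_four : gamma 4 (-1) = ((unitThree : ℝ) : ℂ) ^ 2 := by
  have hs := sqrtDisc_eq (a₁ := 4) (a₂ := -1) (q := 2) (D := 3) (by norm_num [disc])
  have h1 : (unitThree : ℂ) = 2 + ((√((3 : ℕ) : ℝ) : ℝ) : ℂ) := by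
    rw [unitThree]
    push_cast
    rfl
  have h2 : ((√((3 : ℕ) : ℝ) : ℝ) : ℂ) ^ 2 = 3 := by
    rw [← Complex.ofReal_pow, sq_sqrt_three]
    norm_num
  have hβ : beta 4 (-1) ≠ 0 := by
    intro h
    rw [beta, hs] at h
    have h3 : ((√((3 : ℕ) : ℝ) : ℝ) : ℂ) = 2 := by
      simp at h ⊢
      linear_combination -h / 2
    rw [h3] at h2
    norm_num at h2
  rw [gamma, div_eq_iff hβ, alpha, beta, hs, h1]
  simp only [Nat.cast_ofNat, map_ofNat, Int.cast_ofNat]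
  generalize ((√((3 : ℕ) : ℝ) : ℝ) : ℂ) = w at h2
  linear_combination (2 + w) * h2

/-- `α = 5 + 3√3` and `αβ = -2`, so `γ = -α²/2 = -(26 + 15√3) = -(2 + √3)³`. -/
theorem gamma_ten : gamma 10 2 = -((unitThree : ℝ) : ℂ) ^ 3 := by
  have hs := sqrtDisc_eq (a₁ := 10) (a₂ := 2) (q := 6) (D := 3) (by norm_num [disc])
  have h1 : (unitThree : ℂ) = 2 + ((√((3 : ℕ) : ℝ) : ℝ) : ℂ) := by
    rw [unitThree]
    push_cast
    rfl
  have h2 : ((√((3 : ℕ) : ℝ) : ℝ) : ℂ) ^ 2 = 3 := by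
    rw [← Complex.ofReal_pow, sq_sqrt_three]
    norm_num
  have hβ : beta 10 2 ≠ 0 := by
    intro h
    rw [beta, hs] at h
    have h3 : ((√((3 : ℕ) : ℝ) : ℝ) : ℂ) = 5 / 3 := by
      simp at h ⊢
      linear_combination -h / 6
    rw [h3] at h2
    norm_num at h2
  rw [gamma, div_eq_iff hβ, alpha, beta, hs, h1]
  simp only [Nat.cast_ofNat, map_ofNat, Int.cast_ofNat]
  generalize ((√((3 : ℕ) : ℝ) : ℝ) : ℂ) = w at h2
  linear_combination (-(3 * w ^ 2 + 13 * w + 15)) * h2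

theorem ne_of_one_lt {g : ℝ} (hg : 1 < g) {k : ℕ} (hk : k ≠ 0) {γ : ℂ}
    (hγ : γ = (g : ℂ) ^ k ∨ γ = -(g : ℂ) ^ k) : γ ≠ 0 ∧ γ ^ 2 ≠ 1 := by
  have h1 : ‖γ‖ = g ^ k := by
    rcases hγ with h | h <;> simp [h, abs_of_pos (zero_lt_one.trans hg)]
  have h2 : 1 < ‖γ‖ := h1 ▸ one_lt_pow₀ hg hk
  refine ⟨fun h => ?_, fun h => ?_⟩
  · rw [h, norm_zero] at h2
    exact absurd h2 (by norm_num)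
  · have h3 : ‖γ‖ ^ 2 = 1 := by rw [← norm_pow, h, norm_one]
    exact (one_lt_pow₀ h2 two_ne_zero).ne' h3

theorem density_fibonacci {n : ℕ} (hn : 0 < n) :
    density 1 1 n = (Nat.gcd n (2 * 2) : ℚ) / ((Nat.totient n : ℚ) * (n : ℚ)) *
      ∑ i, coeffFib i * (if modFib i ∣ n then 1 else 0) := by
  obtain ⟨h0, h2⟩ := ne_of_one_lt one_lt_unitFive two_ne_zero (Or.inr gamma_fibonacci)
  have hγ : gamma 1 1 = algebraMap ℚ ℂ (-(3 / 2)) +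
      algebraMap ℚ ℂ (-(1 / 2)) * ((√((5 : ℕ) : ℝ) : ℝ) : ℂ) := by
    have h : ((√((5 : ℕ) : ℝ) : ℝ) : ℂ) ^ 2 = 5 := by
      rw [← Complex.ofReal_pow, sq_sqrt_five]
      norm_num
    rw [gamma_fibonacci, unitFive, Complex.ofReal_div, Complex.ofReal_add]
    generalize ((√((5 : ℕ) : ℝ) : ℝ) : ℂ) = w at h
    simp
    linear_combination -h / 4
  rw [density_eq_of_model one_ne_zero
    (by simpa using sqrtDisc_eq (a₁ := 1) (a₂ := 1) (q := 1) (D := 5) (by norm_num [disc]))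
    hγ h0 h2 hn (P := ¬ 5 ∣ n ∧ ¬ 4 ∣ n) (a := if 4 ∣ n then 2 else 1)
    (b := if 5 ∣ n then 1 else 2) (by split_ifs <;> norm_num) (by split_ifs <;> norm_num)]
  · have h20 : 20 ∣ n ↔ 4 ∣ n ∧ 5 ∣ n := by omega
    have h42 : 4 ∣ n → 2 ∣ n := by omega
    rw [show 2 * 2 = 4 from rfl, gcd_four, div_mul_eq_mul_div]
    congr 1
    -- The density times `φ(n) n` is `1`, or `2` if `20 ∣ n`. The coefficients at `2` and `4` offset
    -- the growth of `(n,4)`; the one at `20` restores the doubling.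
    simp only [Fin.sum_univ_four, coeffFib, modFib]
    by_cases h5 : 5 ∣ n <;> by_cases h4 : 4 ∣ n <;> by_cases h2 : 2 ∣ n <;>
      simp [h20, h5, h4, h2] at h42 ⊢ <;> norm_num
  · intro Ω _ _ _ _ ι conj hconj s ζ ρ hs hζ hρ
    have : CharZero Ω := algebraRat.charZero Ω
    have hs2 : s ^ 2 = 5 := by simpa using sq_eq_of_map_eq_sqrt ι hs
    refine kummer_unitFive ι conj hconj hn hs hζ ?_
    rw [hρ]
    simp
    linear_combination hs2 / 4

theorem density_four {n : ℕ} (hn : 0 < n) :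
    density 4 (-1) n = (Nat.gcd n (2 * 2) : ℚ) / ((Nat.totient n : ℚ) * (n : ℚ)) *
      ∑ i, coeffFour i * (if modFour i ∣ n then 1 else 0) := by
  obtain ⟨h0, h2⟩ := ne_of_one_lt one_lt_unitThree two_ne_zero (Or.inl gamma_four)
  have hγ : gamma 4 (-1) = algebraMap ℚ ℂ 7 +
      algebraMap ℚ ℂ 4 * ((√((3 : ℕ) : ℝ) : ℝ) : ℂ) := by
    have h : ((√((3 : ℕ) : ℝ) : ℝ) : ℂ) ^ 2 = 3 := by
      rw [← Complex.ofReal_pow, sq_sqrt_three]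
      norm_num
    rw [gamma_four, unitThree, Complex.ofReal_add]
    generalize ((√((3 : ℕ) : ℝ) : ℝ) : ℂ) = w at h
    simp
    linear_combination h
  rw [density_eq_of_model two_ne_zero
    (by simpa using sqrtDisc_eq (a₁ := 4) (a₂ := -1) (q := 2) (D := 3) (by norm_num [disc]))
    hγ h0 h2 hn (P := ¬ 12 ∣ n ∧ ¬ 8 ∣ n) (a := if 8 ∣ n then 4 else if 2 ∣ n then 2 else 1)
    (b := if 12 ∣ n then 1 else 2) (by split_ifs <;> norm_num) (by split_ifs <;> norm_num)]
  · have h12 : 12 ∣ n ↔ 4 ∣ n ∧ 3 ∣ n := by omega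
    have h24 : 24 ∣ n ↔ 8 ∣ n ∧ 3 ∣ n := by omega
    have h84 : 8 ∣ n → 4 ∣ n := by omega
    have h42 : 4 ∣ n → 2 ∣ n := by omega
    rw [show 2 * 2 = 4 from rfl, gcd_four, div_mul_eq_mul_div]
    congr 1
    -- The density times `φ(n) n` is `(n,2)`, doubled if `24 ∣ n`.
    simp only [Fin.sum_univ_three, coeffFour, modFour]
    by_cases h3 : 3 ∣ n <;> by_cases h8 : 8 ∣ n <;> by_cases h4 : 4 ∣ n <;>
      by_cases h2 : 2 ∣ n <;> simp [h12, h24, h3, h8, h4, h2] at h84 h42 ⊢ <;> norm_num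
  · intro Ω _ _ _ _ ι conj hconj s ζ ρ hs hζ hρ
    have : CharZero Ω := algebraRat.charZero Ω
    have hs2 : s ^ 2 = 3 := by simpa using sq_eq_of_map_eq_sqrt ι hs
    refine kummer_unitThree_sq ι conj hconj hn hs hζ ?_
    rw [hρ]
    simp
    linear_combination -hs2

theorem density_ten {n : ℕ} (hn : 0 < n) :
    density 10 2 n = (Nat.gcd n (2 * 3) : ℚ) / ((Nat.totient n : ℚ) * (n : ℚ)) *
      ∑ i, coeffTen i * (if modTen i ∣ n then 1 else 0) := by
  obtain ⟨h0, h2⟩ := ne_of_one_lt one_lt_unitThree three_ne_zero (Or.inr gamma_ten)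
  have hγ : gamma 10 2 = algebraMap ℚ ℂ (-26) +
      algebraMap ℚ ℂ (-15) * ((√((3 : ℕ) : ℝ) : ℝ) : ℂ) := by
    have h : ((√((3 : ℕ) : ℝ) : ℝ) : ℂ) ^ 2 = 3 := by
      rw [← Complex.ofReal_pow, sq_sqrt_three]
      norm_num
    rw [gamma_ten, unitThree, Complex.ofReal_add]
    generalize ((√((3 : ℕ) : ℝ) : ℝ) : ℂ) = w at h
    simp
    linear_combination -(w + 6) * h
  rw [density_eq_of_model (q := 6) (by norm_num)
    (by simpa using sqrtDisc_eq (a₁ := 10) (a₂ := 2) (q := 6) (D := 3) (by norm_num [disc]))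
    hγ h0 h2 hn (P := ¬ 12 ∣ n ∧ ¬ 8 ∣ n)
    (a := (if 3 ∣ n then 3 else 1) * if 8 ∣ n then 2 else 1)
    (b := if 12 ∣ n then 1 else 2) (by split_ifs <;> norm_num) (by split_ifs <;> norm_num)]
  · have h12 : 12 ∣ n ↔ 4 ∣ n ∧ 3 ∣ n := by omega
    have h24 : 24 ∣ n ↔ 8 ∣ n ∧ 3 ∣ n := by omega
    have h84 : 8 ∣ n → 4 ∣ n := by omega
    have h42 : 4 ∣ n → 2 ∣ n := by omega
    rw [show 2 * 3 = 6 from rfl, gcd_six, div_mul_eq_mul_div]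
    congr 1
    -- The density times `φ(n) n` is `(n,3)`, doubled if `24 ∣ n`.
    simp only [Fin.sum_univ_three, coeffTen, modTen]
    by_cases h3 : 3 ∣ n <;> by_cases h8 : 8 ∣ n <;> by_cases h4 : 4 ∣ n <;>
      by_cases h2 : 2 ∣ n <;> simp [h12, h24, h3, h8, h4, h2] at h84 h42 ⊢ <;> norm_num
  · intro Ω _ _ _ _ ι conj hconj s ζ ρ hs hζ hρ
    have : CharZero Ω := algebraRat.charZero Ω
    have hs2 : s ^ 2 = 3 := by simpa using sq_eq_of_map_eq_sqrt ι hs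
    refine kummer_unitThree_cube ι conj hconj hn hs hζ ?_
    rw [hρ]
    simp
    linear_combination (s + 6) * hs2

theorem isExponent_fibonacci_iff (h : ℕ) : IsExponent 1 1 h ↔ h = 2 :=
  isExponent_iff (D := 5) one_ne_zero
    (by simpa using sqrtDisc_eq (a₁ := 1) (a₂ := 1) (q := 1) (D := 5) (by norm_num [disc]))
    one_lt_unitFive
    (div_mem (add_mem (one_mem _) (mem_adjoin_simple_self ℚ _)) (ofNat_mem _ 2)) two_pos
    (fun _ hv _ hk => unitFive_not_pow hv hk) (Or.inr gamma_fibonacci) h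

theorem unitThree_mem : unitThree ∈ adjoin ℚ {√((3 : ℕ) : ℝ)} :=
  add_mem (ofNat_mem _ 2) (mem_adjoin_simple_self ℚ _)

theorem isExponent_four_iff (h : ℕ) : IsExponent 4 (-1) h ↔ h = 2 :=
  isExponent_iff (D := 3) two_ne_zero
    (by simpa using sqrtDisc_eq (a₁ := 4) (a₂ := -1) (q := 2) (D := 3) (by norm_num [disc]))
    one_lt_unitThree unitThree_mem two_pos
    (fun _ hv _ hk => unitThree_not_pow hv hk) (Or.inl gamma_four) h

theorem isExponent_ten_iff (h : ℕ) : IsExponent 10 2 h ↔ h = 3 :=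
  isExponent_iff (D := 3) (q := 6) (by norm_num)
    (by simpa using sqrtDisc_eq (a₁ := 10) (a₂ := 2) (q := 6) (D := 3) (by norm_num [disc]))
    one_lt_unitThree unitThree_mem three_pos
    (fun _ hv _ hk => unitThree_not_pow hv hk) (Or.inr gamma_ten) h

theorem exists_isGu {a₁ a₂ : ℤ} {h : ℕ} (hh : IsExponent a₁ a₂ h) {k : ℕ} {c : Fin k → ℚ}
    {m : Fin k → ℕ} (hm : ∀ i, 0 < m i)
    (hd : ∀ n : ℕ, 0 < n → density a₁ a₂ n =
      (Nat.gcd n (2 * h) : ℚ) / ((Nat.totient n : ℚ) * (n : ℚ)) *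
        ∑ i, c i * (if m i ∣ n then 1 else 0)) :
    ∃ (h : ℕ) (G : ℕ → ℚ), IsGu a₁ a₂ h G :=
  ⟨h, fun t => B (2 * h) * ∑ i, c i * Ghm (2 * h) (m i) t, hh, k, c, m, hm, hd, fun _ _ => rfl⟩

theorem IsGu.summable_and_delta {a₁ a₂ : ℤ} {h : ℕ} {G : ℕ → ℚ} (hG : IsGu a₁ a₂ h G) {t : ℕ}
    (ht : 0 < t) : Summable (deltaTerm a₁ a₂ t) ∧
      delta a₁ a₂ t = artinConstant * (F (2 * h) t : ℝ) * (G t : ℝ) :=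
  ⟨(hG.hasSum_deltaTerm ht).summable, (hG.hasSum_deltaTerm ht).tsum_eq⟩

end Lucas

/-! ### Assembly of the three cases -/

theorem mainTheorem3 :
    -- Fibonacci numbers
    ((∃ (h : ℕ) (G : ℕ → ℚ), Lucas.IsGu 1 1 h G) ∧
      ∀ (h : ℕ) (G : ℕ → ℚ), Lucas.IsGu 1 1 h G → h = 2 ∧ ∀ t : ℕ, 0 < t →
        (t % 20 = 0 → G t = 3 / 4) ∧
        (t % 2 = 1 → G t = 1) ∧
        (t % 20 ∈ ({2, 6, 14, 18} : Set ℕ) → G t = 29 / 38) ∧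
        (t % 20 ∈ ({4, 8, 12, 16} : Set ℕ) → G t = 27 / 76) ∧
        (t % 20 = 10 → G t = 1 / 2) ∧
        Summable (Lucas.deltaTerm 1 1 t) ∧
        Lucas.delta 1 1 t = Lucas.artinConstant * (Lucas.F (2 * h) t : ℝ) * (G t : ℝ)) ∧
    -- the case of coefficients 4 and -1
    ((∃ (h : ℕ) (G : ℕ → ℚ), Lucas.IsGu 4 (-1) h G) ∧
      ∀ (h : ℕ) (G : ℕ → ℚ), Lucas.IsGu 4 (-1) h G → h = 2 ∧ ∀ t : ℕ, 0 < t →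
        (t % 24 ∈ ({0, 2, 6, 10, 14, 18, 22} : Set ℕ) → G t = 3 / 2) ∧
        (t % 2 = 1 → G t = 0) ∧
        (t % 24 ∈ ({4, 20} : Set ℕ) → G t = 4 / 5) ∧
        (t % 24 ∈ ({8, 16} : Set ℕ) → G t = 3 / 5) ∧
        (t % 24 = 12 → G t = 1 / 2) ∧
        Summable (Lucas.deltaTerm 4 (-1) t) ∧
        Lucas.delta 4 (-1) t = Lucas.artinConstant * (Lucas.F (2 * h) t : ℝ) * (G t : ℝ)) ∧
    -- the case of coefficients 10 and 2
    ((∃ (h : ℕ) (G : ℕ → ℚ), Lucas.IsGu 10 2 h G) ∧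
      ∀ (h : ℕ) (G : ℕ → ℚ), Lucas.IsGu 10 2 h G → h = 3 ∧ ∀ t : ℕ, 0 < t →
        (t % 24 = 0 → G t = 9 / 10) ∧
        (t % 24 ∈ ({1, 3, 4, 5, 7, 9, 11, 13, 15, 17, 19, 20, 21, 23} : Set ℕ) → G t = 3 / 5) ∧
        (t % 24 ∈ ({2, 6, 10, 14, 18, 22} : Set ℕ) → G t = 9 / 20) ∧
        (t % 24 ∈ ({8, 16} : Set ℕ) → G t = 0) ∧
        (t % 24 = 12 → G t = 3 / 10) ∧
        Summable (Lucas.deltaTerm 10 2 t) ∧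
        Lucas.delta 10 2 t = Lucas.artinConstant * (Lucas.F (2 * h) t : ℝ) * (G t : ℝ)) := by
  refine ⟨?_, ?_, ?_⟩
  · have hm : ∀ i, 0 < Lucas.modFib i := by decide
    refine ⟨Lucas.exists_isGu ((Lucas.isExponent_fibonacci_iff 2).2 rfl) hm fun n hn => Lucas.density_fibonacci hn,
      fun h G hG => ?_⟩
    obtain rfl := (Lucas.isExponent_fibonacci_iff h).1 hG.1
    refine ⟨rfl, fun t ht => ?_⟩
    -- `G` may come from any representation; by independence it is evaluated with the explicit
    -- coefficients and read off the table.
    have hGt := (hG.eq_of_density hm (fun n hn => Lucas.density_fibonacci hn) ht).trans (Lucas.sum_Ghm_fib ht)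
    obtain ⟨h1, h2⟩ := hG.summable_and_delta ht
    refine ⟨?_, ?_, ?_, ?_, ?_, h1, h2⟩ <;> intro hmod <;>
      try simp only [Set.mem_insert_iff, Set.mem_singleton_iff] at hmod
    all_goals
      rw [hGt]
      split_ifs <;> first | rfl | omega
  · have hm : ∀ i, 0 < Lucas.modFour i := by decide
    refine ⟨Lucas.exists_isGu ((Lucas.isExponent_four_iff 2).2 rfl) hm fun n hn => Lucas.density_four hn,
      fun h G hG => ?_⟩
    obtain rfl := (Lucas.isExponent_four_iff h).1 hG.1
    refine ⟨rfl, fun t ht => ?_⟩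
    have hGt := (hG.eq_of_density hm (fun n hn => Lucas.density_four hn) ht).trans (Lucas.sum_Ghm_four ht)
    obtain ⟨h1, h2⟩ := hG.summable_and_delta ht
    refine ⟨?_, ?_, ?_, ?_, ?_, h1, h2⟩ <;> intro hmod <;>
      try simp only [Set.mem_insert_iff, Set.mem_singleton_iff] at hmod
    all_goals
      rw [hGt]
      split_ifs <;> first | rfl | omega
  · have hm : ∀ i, 0 < Lucas.modTen i := by decide
    refine ⟨Lucas.exists_isGu ((Lucas.isExponent_ten_iff 3).2 rfl) hm fun n hn => Lucas.density_ten hn,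
      fun h G hG => ?_⟩
    obtain rfl := (Lucas.isExponent_ten_iff h).1 hG.1
    refine ⟨rfl, fun t ht => ?_⟩
    have hGt := (hG.eq_of_density hm (fun n hn => Lucas.density_ten hn) ht).trans (Lucas.sum_Ghm_ten ht)
    obtain ⟨h1, h2⟩ := hG.summable_and_delta ht
    refine ⟨?_, ?_, ?_, ?_, ?_, h1, h2⟩ <;> intro hmod <;>
      try simp only [Set.mem_insert_iff, Set.mem_singleton_iff] at hmod
    all_goals
      rw [hGt]
      split_ifs <;> first | rfl | omega
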